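/- **Objects.** Let $\mathbb F_q$ be a finite field. A division-free straight-line program (SLP) of length $L\ge 1$ over $\mathbb F_q$ is a sequence of instructions $b_i\leftarrow \alpha\star\beta$ ($1\le i\le L$) with $\star\in\{+,-,\times\}$ and $\alpha,\beta\in\{x\}\cup\{b_j: j<i\}\cup\mathbb F_q$; it computes the polynomial $b_L\in\mathbb F_q[x]$. Write $\#f$ for the number of non-zero terms of $f$, and $f_p=f \bmod (x^p-1)$. **Algorithm DUIHalf** $(\mathcal S_f,f^*,T,T_1,D)$. Let $N_1=\max\{1,\lceil (T-1)\log_2 D\rceil\}$, $N_2=\lceil T\log_2 D\rceil$, $N=\max\{4N_1,N_1+N_2-1\}$, and let $p_1,\dots,p_N$ be the first $N$ primes. Put $f_j=f_{p_j}-f^*_{p_j}$ and $\alpha=\max_{1\le j\le N}\#f_j$; let $j_0$ be the smallest index with $\#f_{j_0}=\alpha$ and $p=p_{j_0}$. If $\alpha=0$, return $0$. Otherwise let $g=(f')_{p}-((f^*)')_{p}$, and let $U$ be the set of all $c\,x^d$ such that, for some non-zero term $c\,x^e$ of $f_{j_0}$, $d$ is an integer in $[0,D)$ with $d=h/c$ in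 $\mathbb F_q$, where $h$ is the coefficient of $g$ at $x^{e-1}$ (at $x^{p-1}$ if $e=0$). Return the sum of those $u\in U$ for which $\#(f_j-u_{p_j})<\#f_j$ holds for at least $N_2$ indices $j\in\{1,\dots,N_1+N_2-1\}$. **Algorithm DUIPoly** $(\mathcal S_f,T,D)$. Put $h=0$, $T_1=T$. While $T_1>0$: let $g=\mathrm{DUIHalf}(\mathcal S_f,h,T,T_1,D)$, replace $h$ by $h+g$ and $T_1$ by $\lfloor T_1/2\rfloor$. Return $h$. **Machine model.** Programs are finite tables of first-order recursive functions over cons cells whose atoms are binary natural numbers and elements of $\mathbb F_q$. They do not depend on $q$, and field elements are accessible only through the following operations. The operations $+,-,\times,/$ and the equality test in $\mathbb F_q$ cost one field operation each. So does reading a field element as an integer: given $a\in\mathbb F_q$ and a bound $B$, return the least $k<B$ with $k=a$ in $\mathbb F_q$, or $B$ if there is none; this costs in addition as many bit operations as $B$ has binary digits, up to an additive constant. For integers, addition, subtraction and comparison cost a number of bit operations linear in the lengths of the operands, and multiplication and division with remainder cost the product of the lengths (up to additive constants). Every evaluation step costs at least one bit operation. **Theorem.** Let $f\in\mathbb F_q[x]$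 be computed by an SLP $\mathcal S_f$ of length $L$, and let $T,D\in\mathbb N$ with $\#f\le T$ and $\deg f<D\le \mathrm{char}(\mathbb F_q)$. Then DUIPoly returns exactly $f$. Moreover, the algorithm can be carried out with $O^\sim(LT^2\log^2 D)$ field operations in $\mathbb F_q$ plus $O^\sim(LT^2\log^2 D)$ bit operations. Precisely: there are a single program and constants $C,k$, independent of $q$, $f$, $\mathcal S_f$, $T$ and $D$, such that for all such data the program, on input $(\mathcal S_f,T,D)$, halts with output the sparse representation of $f$ (all pairs of a non-zero coefficient and its exponent, by increasing exponent) together with, for each pass of the loop of DUIPoly in order, the prime $p_{j_0}$ selected by DUIHalf and the sparse representation of the polynomial $g$ that DUIHalf returns. The number of field operations and the number of bit operations are each at most $C\,\varphi\,(\log_2(1+\varphi))^k$, where $\varphi=L\cdot\max(1,T)^2\cdot\max(1,\log_2 D)^2$ (so $\varphi=LT^2\log_2^2D$ as soon as $T\ge1$ and $D\ge2$). -/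

import Mathlib

universe u

namespace SparseInterp

/-! ## Straight-line programs in one indeterminate -/

/-- The arithmetic operations of a division-free straight-line program. -/
inductive ArithOp
  | add
  | sub
  | mul

/-- An operand is the input `x`, the result `b_j` of an earlier instruction (counted from `0`),
or a constant of the ring. -/
inductive Operand (R : Type u)
  | input
  | reg (j : ℕ)
  | const (c : R)

/-- The operand of the instruction with index `i` may refer only to results `b_j` with `j < i`. -/
def Operand.Allowed {R : Type u} (i : ℕ) : Operand R → Prop
  | .input => True
  | .reg j => j < i
  | .const _ => True

/-- One instruction `b ← lhs ⋆ rhs`. -/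
structure Instr (R : Type u) where
  op : ArithOp
  lhs : Operand R
  rhs : Operand R

/-- A division-free straight-line program with one input: a non-empty sequence of instructions,
each referring only to earlier results. -/
structure SLP (R : Type u) where
  instrs : List (Instr R)
  ne_nil : instrs ≠ []
  allowed : ∀ (i : ℕ) (hi : i < instrs.length),
    (instrs[i]).lhs.Allowed i ∧ (instrs[i]).rhs.Allowed i

noncomputable section

open Polynomial

/-- The polynomial denoted by an operand, where `b` lists the results computed so far. -/
def Operand.value {R : Type u} [CommRing R] (b : List R[X]) : Operand R → R[X]
  | .input => X
  | .reg j => b.getD j 0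
  | .const c => C c

/-- The result of one instruction, where `b` lists the results computed so far. -/
def Instr.value {R : Type u} [CommRing R] (b : List R[X]) (s : Instr R) : R[X] :=
  match s.op with
  | .add => s.lhs.value b + s.rhs.value b
  | .sub => s.lhs.value b - s.rhs.value b
  | .mul => s.lhs.value b * s.rhs.value b

/-- The number `L` of instructions. -/
def SLP.length {R : Type u} (S : SLP R) : ℕ := S.instrs.length

/-- The list `[b_1, …, b_L]` of all results on the indeterminate input `X`. -/
def SLP.results {R : Type u} [CommRing R] (S : SLP R) : List R[X] :=
  S.instrs.foldl (fun b s => b ++ [s.value b]) []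

/-- The polynomial computed by a straight-line program: its last result `b_L`. -/
def SLP.poly {R : Type u} [CommRing R] (S : SLP R) : R[X] :=
  S.results.getLastD 0

/-! ## The algorithm DUIPoly -/

/-- `f_p = f mod (x^p - 1)`. -/
def cyc {F : Type u} [Field F] (p : ℕ) (f : F[X]) : F[X] := f %ₘ (X ^ p - 1)

/-- `#f`, the number of non-zero terms of `f`. -/
def numTerms {F : Type u} [Field F] (f : F[X]) : ℕ := f.support.card

/-- `N₁ = max {1, ⌈(T - 1) log₂ D⌉}`. -/
def numA (T D : ℕ) : ℕ := max 1 ⌈((T : ℝ) - 1) * Real.logb 2 D⌉₊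

/-- `N₂ = ⌈T log₂ D⌉`. -/
def numB (T D : ℕ) : ℕ := ⌈(T : ℝ) * Real.logb 2 D⌉₊

/-- `N = max {4 N₁, N₁ + N₂ - 1}`, the number of primes that are used. -/
def numPrimes (T D : ℕ) : ℕ := max (4 * numA T D) (numA T D + numB T D - 1)

/-- The `j`-th prime, counted from `0`. -/
def pr (j : ℕ) : ℕ := Nat.nth Nat.Prime j

open scoped Classical in
/-- Candidate terms `c x^d`, stored as `(c, d)`, obtained by coefficient division from
`u = f_p` and `v = (f')_p`: for every non-zero term `c x^e` of `u` and every `d` in `[0, D)` with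
`d = h / c` in the field, where `h` is the coefficient of `v` at `e - 1` (at `p - 1` if `e = 0`). -/
def uTerms {F : Type u} [Field F] (u v : F[X]) (p D : ℕ) : Finset (F × ℕ) :=
  ((u.support ×ˢ Finset.range D).filter fun ed =>
      (ed.2 : F) = v.coeff ((ed.1 + p - 1) % p) / u.coeff ed.1).image
    fun ed => (u.coeff ed.1, ed.2)

/-- `f_j = f_{p_j} - f*_{p_j}`, where `f` is the polynomial computed by `S`. -/
def image {F : Type u} [Field F] (S : SLP F) (fs : F[X]) (j : ℕ) : F[X] :=
  cyc (pr j) S.poly - cyc (pr j) fs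

/-- `α = max {#f_j}` over the first `N` primes. -/
def maxTerms {F : Type u} [Field F] (S : SLP F) (fs : F[X]) (T D : ℕ) : ℕ :=
  (Finset.range (numPrimes T D)).sup fun j => numTerms (image S fs j)

/-- The smallest index `j₀` with `#f_{j₀} = α`. -/
def bestIndex {F : Type u} [Field F] (S : SLP F) (fs : F[X]) (T D : ℕ) : ℕ :=
  sInf {j | j < numPrimes T D ∧ numTerms (image S fs j) = maxTerms S fs T D}

/-- The membership test for a term `c x^d`, stored as `(c, d)`: subtracting it lowers the number of
terms of `f_j` for at least `N₂` of the first `N₁ + N₂ - 1` primes. -/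
def Certified {F : Type u} [Field F] (S : SLP F) (fs : F[X]) (T D : ℕ) (t : F × ℕ) : Prop :=
  numB T D ≤ ((Finset.range (numA T D + numB T D - 1)).filter fun j =>
    numTerms (image S fs j - cyc (pr j) (monomial t.2 t.1)) < numTerms (image S fs j)).card

/-- The candidates for the terms of `f - f*` at the selected prime. -/
def candidates {F : Type u} [Field F] (S : SLP F) (fs : F[X]) (T D : ℕ) : Finset (F × ℕ) :=
  let p := pr (bestIndex S fs T D)
  uTerms (image S fs (bestIndex S fs T D))
    (cyc p (derivative S.poly) - cyc p (derivative fs)) p D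

open scoped Classical in
/-- The procedure DUIHalf, on the approximation `fs` of the polynomial computed by `S`.
(The bound `T₁` on the number of terms of the difference is an input that no step uses.) -/
def DUIHalf {F : Type u} [Field F] (S : SLP F) (fs : F[X]) (T _T₁ D : ℕ) : F[X] :=
  if maxTerms S fs T D = 0 then 0
  else ∑ t ∈ (candidates S fs T D).filter (Certified S fs T D), monomial t.2 t.1

/-- The loop `while T₁ > 0 do (g := DUIHalf (…, h, T, T₁, D); h := h + g; T₁ := ⌊T₁ / 2⌋)`.
It returns the final `h` and, for every pass through the loop in order, the selected prime and the
polynomial `g` found in it. -/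
def duiLoop {F : Type u} [Field F] (S : SLP F) (T D : ℕ) (T₁ : ℕ) (h : F[X]) :
    F[X] × List (ℕ × F[X]) :=
  if _hT : T₁ = 0 then (h, [])
  else
    let g := DUIHalf S h T T₁ D
    let r := duiLoop S T D (T₁ / 2) (h + g)
    (r.1, (pr (bestIndex S h T D), g) :: r.2)
termination_by T₁
decreasing_by omega

/-- The polynomial returned by DUIPoly. -/
def DUIPoly {F : Type u} [Field F] (S : SLP F) (T D : ℕ) : F[X] := (duiLoop S T D T 0).1

/-- The selected prime and the polynomial returned by DUIHalf, for all passes of DUIPoly. -/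
def DUIPasses {F : Type u} [Field F] (S : SLP F) (T D : ℕ) : List (ℕ × F[X]) :=
  (duiLoop S T D T 0).2

/-! ## The machine model

First-order recursive programs over cons cells. An atom is a natural number in binary or an element
of the field, which is opaque: it can be used only through the field operations, the test for
equality, and the reading of an element of the prime field as an integer. Field operations are
charged one field operation each. Every evaluation step is charged at least one bit operation, and
integer arithmetic is charged what the schoolbook methods on binary digits need. Structured data are
shared, never traversed or copied by a single step, so that a step handles a bounded number of
pointers. Programs are finite objects that do not mention the field. -/

/-- Values: binary natural numbers, field elements, and cons cells. -/
inductive Val (F : Type u)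
  | nat (n : ℕ)
  | fld (a : F)
  | pair (a b : Val F)

inductive NatOp
  | add
  | sub
  | mul
  | div
  | mod

inductive FldOp
  | add
  | sub
  | mul
  | div

/-- Expressions. Variables are numbered from the innermost binding outwards. -/
inductive Expr
  | var (i : ℕ)
  | letIn (e body : Expr)
  | call (fn : ℕ) (e : Expr)
  | lit (n : ℕ)
  | fldZero
  | fldOne
  | pair (e₁ e₂ : Expr)
  | fst (e : Expr)
  | snd (e : Expr)
  | natOp (o : NatOp) (e₁ e₂ : Expr)
  | fldOp (o : FldOp) (e₁ e₂ : Expr)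
  | toNat (e bound : Expr)
  | ifPair (e yes no : Expr)
  | ifLt (e₁ e₂ yes no : Expr)
  | ifEq (e₁ e₂ yes no : Expr)

/-- A program is a finite table of bodies of one-argument functions, which may call each other;
execution starts with the function number `0`. -/
abbrev Program := List Expr

/-- Subtraction is truncated; division by zero gives `0` with the dividend as remainder. -/
def NatOp.apply : NatOp → ℕ → ℕ → ℕ
  | .add, a, b => a + b
  | .sub, a, b => a - b
  | .mul, a, b => a * b
  | .div, a, b => a / b
  | .mod, a, b => a % b

/-- The bit operations charged for integer arithmetic; `Nat.size` is the binary length. -/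
def NatOp.cost : NatOp → ℕ → ℕ → ℕ
  | .add, a, b => a.size + b.size + 1
  | .sub, a, b => a.size + b.size + 1
  | .mul, a, b => (a.size + 1) * (b.size + 1)
  | .div, a, b => (a.size + 1) * (b.size + 1)
  | .mod, a, b => (a.size + 1) * (b.size + 1)

/-- Division by zero gives `0`. -/
def FldOp.apply {F : Type u} [Field F] : FldOp → F → F → F
  | .add, a, b => a + b
  | .sub, a, b => a - b
  | .mul, a, b => a * b
  | .div, a, b => a / b

/-- The least natural number `k < bound` whose image in the field is `a`, and `bound` itself if
there is none. -/
def readNat {F : Type u} [Field F] (a : F) (bound : ℕ) : ℕ :=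
  sInf {k : ℕ | (k : F) = a ∨ k = bound}

end

/-- `Eval P env e v c`: in the program `P` and the environment `env`, the expression `e` evaluates
to `v` with `c.1` field operations and `c.2` bit operations. Evaluation is strict; an ill-typed
operation has no value. -/
inductive Eval {F : Type u} [Field F] (P : Program) :
    List (Val F) → Expr → Val F → ℕ × ℕ → Prop
  | var {env i v} (h : env[i]? = some v) : Eval P env (.var i) v (0, 1)
  | letIn {env e b v w c d} (h₁ : Eval P env e v c) (h₂ : Eval P (v :: env) b w d) :
      Eval P env (.letIn e b) w (c + d + (0, 1))
  | call {env fn e body v w c d} (hb : P[fn]? = some body)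
      (h₁ : Eval P env e v c) (h₂ : Eval P [v] body w d) :
      Eval P env (.call fn e) w (c + d + (0, 1))
  | lit {env n} : Eval P env (.lit n) (.nat n) (0, n.size + 1)
  | fldZero {env} : Eval P env .fldZero (.fld 0) (0, 1)
  | fldOne {env} : Eval P env .fldOne (.fld 1) (0, 1)
  | pair {env e₁ e₂ v w c d} (h₁ : Eval P env e₁ v c) (h₂ : Eval P env e₂ w d) :
      Eval P env (.pair e₁ e₂) (.pair v w) (c + d + (0, 1))
  | fst {env e v w c} (h : Eval P env e (.pair v w) c) : Eval P env (.fst e) v (c + (0, 1))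
  | snd {env e v w c} (h : Eval P env e (.pair v w) c) : Eval P env (.snd e) w (c + (0, 1))
  | natOp {env o e₁ e₂ a b c d} (h₁ : Eval P env e₁ (.nat a) c) (h₂ : Eval P env e₂ (.nat b) d) :
      Eval P env (.natOp o e₁ e₂) (.nat (o.apply a b)) (c + d + (0, o.cost a b))
  | fldOp {env o e₁ e₂ a b c d} (h₁ : Eval P env e₁ (.fld a) c) (h₂ : Eval P env e₂ (.fld b) d) :
      Eval P env (.fldOp o e₁ e₂) (.fld (o.apply a b)) (c + d + (1, 1))
  | toNat {env e₁ e₂ a b c d} (h₁ : Eval P env e₁ (.fld a) c) (h₂ : Eval P env e₂ (.nat b) d) :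
      Eval P env (.toNat e₁ e₂) (.nat (readNat a b)) (c + d + (1, b.size + 1))
  | ifPair_yes {env e y n a b w c d} (h : Eval P env e (.pair a b) c) (h' : Eval P env y w d) :
      Eval P env (.ifPair e y n) w (c + d + (0, 1))
  | ifPair_nat {env e y n a w c d} (h : Eval P env e (.nat a) c) (h' : Eval P env n w d) :
      Eval P env (.ifPair e y n) w (c + d + (0, 1))
  | ifPair_fld {env e y n a w c d} (h : Eval P env e (.fld a) c) (h' : Eval P env n w d) :
      Eval P env (.ifPair e y n) w (c + d + (0, 1))
  | ifLt_yes {env e₁ e₂ y n a b w c₁ c₂ d} (h₁ : Eval P env e₁ (.nat a) c₁)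
      (h₂ : Eval P env e₂ (.nat b) c₂) (hab : a < b) (h' : Eval P env y w d) :
      Eval P env (.ifLt e₁ e₂ y n) w (c₁ + c₂ + d + (0, a.size + b.size + 1))
  | ifLt_no {env e₁ e₂ y n a b w c₁ c₂ d} (h₁ : Eval P env e₁ (.nat a) c₁)
      (h₂ : Eval P env e₂ (.nat b) c₂) (hab : ¬ a < b) (h' : Eval P env n w d) :
      Eval P env (.ifLt e₁ e₂ y n) w (c₁ + c₂ + d + (0, a.size + b.size + 1))
  | ifEq_yes {env e₁ e₂ y n a b w c₁ c₂ d} (h₁ : Eval P env e₁ (.fld a) c₁)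
      (h₂ : Eval P env e₂ (.fld b) c₂) (hab : a = b) (h' : Eval P env y w d) :
      Eval P env (.ifEq e₁ e₂ y n) w (c₁ + c₂ + d + (1, 1))
  | ifEq_no {env e₁ e₂ y n a b w c₁ c₂ d} (h₁ : Eval P env e₁ (.fld a) c₁)
      (h₂ : Eval P env e₂ (.fld b) c₂) (hab : ¬ a = b) (h' : Eval P env n w d) :
      Eval P env (.ifEq e₁ e₂ y n) w (c₁ + c₂ + d + (1, 1))

/-- Execution is deterministic, so that the output and the two costs are those of the only run. -/
theorem Eval.deterministic {F : Type u} [Field F] {P : Program} {env : List (Val F)} {e : Expr}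
    {v w : Val F} {c d : ℕ × ℕ} (h : Eval P env e v c) (h' : Eval P env e w d) :
    v = w ∧ c = d := by
  induction h generalizing w d <;> cases h' <;> grind

/-- On the input `x`, the program halts with the output `y` after `fieldOps` field operations and
`bitOps` bit operations. -/
def Program.Runs {F : Type u} [Field F] (P : Program) (x y : Val F) (fieldOps bitOps : ℕ) : Prop :=
  ∃ body, P[0]? = some body ∧ Eval P [x] body y (fieldOps, bitOps)

/-! ## Input and output formats -/

/-- A list is a chain of cons cells that ends in the number `0`. -/
def Val.list {F : Type u} : List (Val F) → Val F
  | [] => .nat 0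
  | v :: l => .pair v (Val.list l)

def ArithOp.code {F : Type u} : ArithOp → Val F
  | .add => .nat 0
  | .sub => .nat 1
  | .mul => .nat 2

def Operand.code {F : Type u} : Operand F → Val F
  | .input => .nat 0
  | .reg j => .pair (.nat 0) (.nat j)
  | .const c => .pair (.nat 1) (.fld c)

def Instr.code {F : Type u} (s : Instr F) : Val F :=
  .pair s.op.code (.pair s.lhs.code s.rhs.code)

/-- The input: the list of instructions, and the bounds `T` and `D`. -/
def inputVal {F : Type u} (S : SLP F) (T D : ℕ) : Val F :=
  .pair (Val.list (S.instrs.map Instr.code)) (.pair (.nat T) (.nat D))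

noncomputable section

open Polynomial

/-- Sparse representation: the list of all pairs (coefficient, exponent) of the non-zero terms, in
increasing order of the exponents. -/
def sparseVal {F : Type u} [Field F] (f : F[X]) : Val F :=
  Val.list ((f.support.sort (· ≤ ·)).map fun d => .pair (.fld (f.coeff d)) (.nat d))

/-- The output: the polynomial `f`, and for every pass the selected prime and the polynomial found
in it. -/
def outputVal {F : Type u} [Field F] (f : F[X]) (passes : List (ℕ × F[X])) : Val F :=
  .pair (sparseVal f) (Val.list (passes.map fun r => .pair (.nat r.1) (sparseVal r.2)))

/-- `L T² log₂² D`, where `T` and `log₂ D` are replaced by `1` if they are less than `1`. -/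
def sizeBound (L T D : ℕ) : ℝ :=
  (L : ℝ) * (max 1 (T : ℝ)) ^ 2 * (max 1 (Real.logb 2 D)) ^ 2

end

end SparseInterp

/-!
Sparse interpolation of straight-line programs: correctness of DUIPoly, and a program that carries
it out with quasi-linearly many operations in `L T² log² D`.

*Correctness.* Let `r` be the difference of `f` and the current approximation. Two exponents collide
at a prime `p` if they agree modulo `p`. The product of the primes at which an exponent `d < D`
collides with some exponent of `r` divides the product of the differences of the exponents
(`two_pow_card_collides_le`). Hence, if `D ≥ 2`, an exponent of `r` collides at fewer than `N₁`
primes, and any exponent at fewer than `N₂`. So a term of `r` is visible in at least `N₂` of the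
`N₁ + N₂ - 1` images, whereas a wrong candidate agrees with an image only at a collision, that is,
with fewer than `N₂` images. The test accepts exactly the candidates that are terms of `r`
(`certified_iff`). On the other hand, on
average over the first `4 N₁` primes three quarters of the exponents do not collide, so that the
image with the most terms has at least `3/4 #r` terms (`three_mul_numTerms_le`). A residue hit by
several exponents uses up at least two of them, hence at least half of the exponents do not collide
at the selected prime. For these the coefficients `c` of `r` and `d c` of the Euler derivative
`x r'` are both visible, so `d` is recovered by a division, because `D` is at most the
characteristic. Thus each pass finds half of what is missing (`two_mul_card_sdiff_found_le`), and
the loop ends with `f` (`DUIPoly_eq`).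

*Cost.* The program `prog` is verified by weakest preconditions: `Sym` turns an evaluation with its
cost into a statement about values, and `Cl` is the specification of a function. Each field
operation is also charged a bit operation (`Eval.fst_le_snd`), so that only bit operations are
counted. Three points keep the cost quasi-linear.

* Residues modulo `x^p - 1` are perfect binary trees. Products are computed modulo
  `y^(2^k) + 1` in the manner of Nussbaumer: the ring contains the roots of unity that a fast
  Fourier transform over the ring of half the depth needs, so every field with `2 ≠ 0` will do
  (`smul_spec`). Since `x^p = 1` in the target, a product of degree less than `2 p` is reduced by
  a cyclic shift (`fold_rotation`). In characteristic two the hypotheses force `f` to be linear, and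
  products of bounded size are enough.
* The straight-line program acts on pairs of images of `g` and `x g'`. It is evaluated once for each
  of the `N` primes (`entries_spec`); afterwards the images are updated by the subtraction of the
  terms found (`subEntries_spec`).
* The first `N` primes are `O(N log N)`, by `2^n ≤ (n + 1) lcm(1, …, n)` (`pr_le`). As `N` is
  `O(T log D)`, the evaluations cost `L N` products of this size, that is `L T² log² D` up to
  logarithmic factors. The passes, of which there are `O(log T)`, test at most `T` candidates
  against `O(N)` images each and are cheaper (`loop_spec`, `totalCost_le`, `cost_le_sizeBound`).
-/

namespace SparseInterp

/-! ### Symbolic execution of the machine -/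

/-- Every field operation is also charged a bit operation, so that bit costs dominate. -/
theorem Eval.fst_le_snd {F : Type u} [Field F] {P : Program} {env : List (Val F)} {e : Expr}
    {v : Val F} {c : ℕ × ℕ} (h : Eval P env e v c) : c.1 ≤ c.2 := by
  induction h <;> simp only [Prod.fst_add, Prod.snd_add] <;> omega

/-- The call of function `fn` on `x` halts with a value and a number of bit operations
satisfying `Q`; the cost of evaluating the argument and of the call itself is not included. -/
def Cl {F : Type u} [Field F] (P : Program) (fn : ℕ) (x : Val F) (Q : Val F → ℕ → Prop) : Prop :=
  ∃ body v c, P[fn]? = some body ∧ Eval P [x] body v c ∧ Q v c.2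

/-- `Q` holds for the value, if there is one. -/
def onSome {α : Type u} (o : Option α) (Q : α → Prop) : Prop :=
  match o with
  | some v => Q v
  | none => False

/-- `Q` holds for the two components of a cons cell. -/
def Val.onPair {F : Type u} (v : Val F) (Q : Val F → Val F → Prop) : Prop :=
  match v with
  | .pair a b => Q a b
  | _ => False

/-- `Q` holds for the natural number stored in an atom. -/
def Val.onNat {F : Type u} (v : Val F) (Q : ℕ → Prop) : Prop :=
  match v with
  | .nat a => Q a
  | _ => False

/-- `Q` holds for the field element stored in an atom. -/
def Val.onFld {F : Type u} (v : Val F) (Q : F → Prop) : Prop :=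
  match v with
  | .fld a => Q a
  | _ => False

/-- `A` holds if the value is a cons cell, and `B` if it is an atom. -/
def Val.split {F : Type u} (v : Val F) (A B : Prop) : Prop :=
  match v with
  | .pair _ _ => A
  | _ => B

/-- The weakest precondition of an expression, by recursion on its syntax: a condition under which
its evaluation halts with a value and a number of bit operations satisfying `Q`. -/
def Sym {F : Type u} [Field F] (P : Program) :
    Expr → List (Val F) → (Val F → ℕ → Prop) → Prop
  | .var i, env, Q => onSome env[i]? fun v => Q v 1
  | .letIn e b, env, Q => Sym P e env fun v c => Sym P b (v :: env) fun w d => Q w (c + d + 1)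
  | .call fn e, env, Q => Sym P e env fun v c => Cl P fn v fun w d => Q w (c + d + 1)
  | .lit n, _, Q => Q (.nat n) (n.size + 1)
  | .fldZero, _, Q => Q (.fld 0) 1
  | .fldOne, _, Q => Q (.fld 1) 1
  | .pair e₁ e₂, env, Q =>
    Sym P e₁ env fun v c => Sym P e₂ env fun w d => Q (.pair v w) (c + d + 1)
  | .fst e, env, Q => Sym P e env fun v c => v.onPair fun a _ => Q a (c + 1)
  | .snd e, env, Q => Sym P e env fun v c => v.onPair fun _ b => Q b (c + 1)
  | .natOp o e₁ e₂, env, Q =>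
    Sym P e₁ env fun v c => v.onNat fun a => Sym P e₂ env fun w d => w.onNat fun b =>
      Q (.nat (o.apply a b)) (c + d + o.cost a b)
  | .fldOp o e₁ e₂, env, Q =>
    Sym P e₁ env fun v c => v.onFld fun a => Sym P e₂ env fun w d => w.onFld fun b =>
      Q (.fld (o.apply a b)) (c + d + 1)
  | .toNat e₁ e₂, env, Q =>
    Sym P e₁ env fun v c => v.onFld fun a => Sym P e₂ env fun w d => w.onNat fun b =>
      Q (.nat (readNat a b)) (c + d + (b.size + 1))
  | .ifPair e y n, env, Q =>
    Sym P e env fun v c => v.split (Sym P y env fun w d => Q w (c + d + 1))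
      (Sym P n env fun w d => Q w (c + d + 1))
  | .ifLt e₁ e₂ y n, env, Q =>
    Sym P e₁ env fun v c => v.onNat fun a => Sym P e₂ env fun w d => w.onNat fun b =>
      (a < b → Sym P y env fun r k => Q r (c + d + k + (a.size + b.size + 1))) ∧
      (¬ a < b → Sym P n env fun r k => Q r (c + d + k + (a.size + b.size + 1)))
  | .ifEq e₁ e₂ y n, env, Q =>
    Sym P e₁ env fun v c => v.onFld fun a => Sym P e₂ env fun w d => w.onFld fun b =>
      (a = b → Sym P y env fun r k => Q r (c + d + k + 1)) ∧
      (¬ a = b → Sym P n env fun r k => Q r (c + d + k + 1))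

theorem Sym.eval {F : Type u} [Field F] {P : Program} {e : Expr} :
    ∀ {env : List (Val F)} {Q : Val F → ℕ → Prop},
      Sym P e env Q → ∃ v c, Eval P env e v c ∧ Q v c.2 := by
  induction e with
  | var i =>
    intro env Q h
    simp only [Sym] at h
    cases hi : env[i]? with
    | none => rw [hi] at h; exact h.elim
    | some v => rw [hi] at h; exact ⟨v, _, .var hi, h⟩
  | letIn e b ihe ihb =>
    intro env Q h
    obtain ⟨v, c, h₁, h⟩ := ihe h
    obtain ⟨w, d, h₂, h⟩ := ihb h
    exact ⟨_, _, .letIn h₁ h₂, h⟩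
  | call fn e ihe =>
    intro env Q h
    obtain ⟨v, c, h₁, body, w, d, hb, h₂, h⟩ := ihe h
    exact ⟨_, _, .call hb h₁ h₂, h⟩
  | lit n => exact fun h => ⟨_, _, .lit, h⟩
  | fldZero => exact fun h => ⟨_, _, .fldZero, h⟩
  | fldOne => exact fun h => ⟨_, _, .fldOne, h⟩
  | pair e₁ e₂ ih₁ ih₂ =>
    intro env Q h
    obtain ⟨v, c, h₁, h⟩ := ih₁ h
    obtain ⟨w, d, h₂, h⟩ := ih₂ h
    exact ⟨_, _, .pair h₁ h₂, h⟩
  | fst e ih =>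
    intro env Q h
    obtain ⟨v, c, h₁, h⟩ := ih h
    cases v with
    | pair a b => exact ⟨_, _, .fst h₁, h⟩
    | _ => exact h.elim
  | snd e ih =>
    intro env Q h
    obtain ⟨v, c, h₁, h⟩ := ih h
    cases v with
    | pair a b => exact ⟨_, _, .snd h₁, h⟩
    | _ => exact h.elim
  | natOp o e₁ e₂ ih₁ ih₂ =>
    intro env Q h
    obtain ⟨v, c, h₁, h⟩ := ih₁ h
    cases v with
    | nat a =>
      obtain ⟨w, d, h₂, h⟩ := ih₂ h
      cases w with
      | nat b => exact ⟨_, _, .natOp h₁ h₂, h⟩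
      | _ => exact h.elim
    | _ => exact h.elim
  | fldOp o e₁ e₂ ih₁ ih₂ =>
    intro env Q h
    obtain ⟨v, c, h₁, h⟩ := ih₁ h
    cases v with
    | fld a =>
      obtain ⟨w, d, h₂, h⟩ := ih₂ h
      cases w with
      | fld b => exact ⟨_, _, .fldOp h₁ h₂, h⟩
      | _ => exact h.elim
    | _ => exact h.elim
  | toNat e₁ e₂ ih₁ ih₂ =>
    intro env Q h
    obtain ⟨v, c, h₁, h⟩ := ih₁ h
    cases v with
    | fld a =>
      obtain ⟨w, d, h₂, h⟩ := ih₂ h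
      cases w with
      | nat b => exact ⟨_, _, .toNat h₁ h₂, h⟩
      | _ => exact h.elim
    | _ => exact h.elim
  | ifPair e y n ih ihy ihn =>
    intro env Q h
    obtain ⟨v, c, h₁, h⟩ := ih h
    cases v with
    | pair a b =>
      obtain ⟨w, d, h₂, h⟩ := ihy h
      exact ⟨_, _, .ifPair_yes h₁ h₂, h⟩
    | nat a =>
      obtain ⟨w, d, h₂, h⟩ := ihn h
      exact ⟨_, _, .ifPair_nat h₁ h₂, h⟩
    | fld a =>
      obtain ⟨w, d, h₂, h⟩ := ihn h
      exact ⟨_, _, .ifPair_fld h₁ h₂, h⟩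
  | ifLt e₁ e₂ y n ih₁ ih₂ ihy ihn =>
    intro env Q h
    obtain ⟨v, c, h₁, h⟩ := ih₁ h
    cases v with
    | nat a =>
      obtain ⟨w, d, h₂, h⟩ := ih₂ h
      cases w with
      | nat b =>
        by_cases hab : a < b
        · obtain ⟨r, k, h₃, h⟩ := ihy (h.1 hab)
          exact ⟨_, _, .ifLt_yes h₁ h₂ hab h₃, h⟩
        · obtain ⟨r, k, h₃, h⟩ := ihn (h.2 hab)
          exact ⟨_, _, .ifLt_no h₁ h₂ hab h₃, h⟩
      | _ => exact h.elim
    | _ => exact h.elim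
  | ifEq e₁ e₂ y n ih₁ ih₂ ihy ihn =>
    intro env Q h
    obtain ⟨v, c, h₁, h⟩ := ih₁ h
    cases v with
    | fld a =>
      obtain ⟨w, d, h₂, h⟩ := ih₂ h
      cases w with
      | fld b =>
        by_cases hab : a = b
        · obtain ⟨r, k, h₃, h⟩ := ihy (h.1 hab)
          exact ⟨_, _, .ifEq_yes h₁ h₂ hab h₃, h⟩
        · obtain ⟨r, k, h₃, h⟩ := ihn (h.2 hab)
          exact ⟨_, _, .ifEq_no h₁ h₂ hab h₃, h⟩
      | _ => exact h.elim
    | _ => exact h.elim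

section
variable {F : Type u} [Field F] {P : Program} {Q : Val F → ℕ → Prop}

theorem Cl.intro {fn : ℕ} {x : Val F} {body : Expr} (hb : P[fn]? = some body)
    (h : Sym P body [x] Q) : Cl P fn x Q := by
  obtain ⟨v, c, h, hQ⟩ := h.eval
  exact ⟨body, v, c, hb, h, hQ⟩

theorem Cl.mono {fn : ℕ} {x : Val F} {Q' : Val F → ℕ → Prop} (h : Cl P fn x Q)
    (hQ : ∀ v d, Q v d → Q' v d) : Cl P fn x Q' := by
  obtain ⟨b, v, c, hb, h, hv⟩ := h
  exact ⟨b, v, c, hb, h, hQ _ _ hv⟩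

end

/-- The price of one operation on natural numbers of at most `w` bits, with some reserve for a
bounded number of further steps. -/
def opCost (w : ℕ) : ℕ := (w + 2) ^ 2

theorem le_opCost (w : ℕ) : 4 * w + 4 ≤ opCost w := by unfold opCost; nlinarith

theorem opCost_mono {v w : ℕ} (h : v ≤ w) : opCost v ≤ opCost w := by
  unfold opCost; gcongr

theorem cost_le_opCost (o : NatOp) {a b w : ℕ} (ha : a.size ≤ w) (hb : b.size ≤ w) :
    o.cost a b ≤ opCost w := by
  have h : (a.size + 1) * (b.size + 1) ≤ (w + 1) * (w + 1) := by gcongr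
  cases o <;> simp only [NatOp.cost, opCost] <;> nlinarith

theorem size_le_of_le {a w : ℕ} (h : a ≤ w) : a.size ≤ w :=
  Nat.size_le.2 (lt_of_le_of_lt h Nat.lt_two_pow_self)

/-! ### The program

Comments give the layout of the argument. Polynomials are perfect binary trees with field elements
as leaves: a leaf `a` is the constant `a`, and a cell `(e, o)` is `e(x²) + x o(x²)`, so that the
leaves are addressed by the binary digits of the exponents, least significant digit first. -/

/-- Sum of two trees `(u, v)`. -/
def addE : Expr :=
  .ifPair (.fst (.var 0))
    (.pair (.call 1 (.pair (.fst (.fst (.var 0))) (.fst (.snd (.var 0)))))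
      (.call 1 (.pair (.snd (.fst (.var 0))) (.snd (.snd (.var 0))))))
    (.fldOp .add (.fst (.var 0)) (.snd (.var 0)))

/-- Scalar multiple of a tree, on `(c, u)`. -/
def scaleE : Expr :=
  .ifPair (.snd (.var 0))
    (.pair (.call 2 (.pair (.fst (.var 0)) (.fst (.snd (.var 0)))))
      (.call 2 (.pair (.fst (.var 0)) (.snd (.snd (.var 0))))))
    (.fldOp .mul (.fst (.var 0)) (.snd (.var 0)))

/-- Multiplication by `y ^ s` modulo `y ^ (2 ^ k) + 1`, on `(s, u)` with a tree `u` of depth `k`. -/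
def rotE : Expr :=
  .ifPair (.snd (.var 0))
    (.letIn (.natOp .div (.fst (.var 0)) (.lit 2))
      (.ifLt (.natOp .mod (.fst (.var 1)) (.lit 2)) (.lit 1)
        (.pair (.call 3 (.pair (.var 0) (.fst (.snd (.var 1)))))
          (.call 3 (.pair (.var 0) (.snd (.snd (.var 1))))))
        (.pair (.call 3 (.pair (.natOp .add (.var 0) (.lit 1)) (.snd (.snd (.var 1)))))
          (.call 3 (.pair (.var 0) (.fst (.snd (.var 1))))))))
    (.ifLt (.natOp .mod (.fst (.var 0)) (.lit 2)) (.lit 1) (.snd (.var 0))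
      (.fldOp .sub .fldZero (.snd (.var 0))))

/-- Schoolbook multiplication modulo `y ^ (2 ^ k) + 1` of two trees `(u, v)` of depth `k`. -/
def naiveE : Expr :=
  .ifPair (.fst (.var 0))
    (.pair
      (.call 1 (.pair (.call 4 (.pair (.fst (.fst (.var 0))) (.fst (.snd (.var 0)))))
        (.call 3 (.pair (.lit 1)
          (.call 4 (.pair (.snd (.fst (.var 0))) (.snd (.snd (.var 0)))))))))
      (.call 1 (.pair (.call 4 (.pair (.fst (.fst (.var 0))) (.snd (.snd (.var 0)))))
        (.call 4 (.pair (.snd (.fst (.var 0))) (.fst (.snd (.var 0))))))))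
    (.fldOp .mul (.fst (.var 0)) (.snd (.var 0)))

/-- Fast multiplication modulo `y ^ (2 ^ k) + 1`, on `(k, (u, v))`. -/
def smulE : Expr :=
  .ifLt (.fst (.var 0)) (.lit 3) (.call 4 (.snd (.var 0)))
    (.letIn (.natOp .div (.fst (.var 0)) (.lit 2))
      (.letIn (.natOp .sub (.fst (.var 1)) (.var 0))
        (.call 7 (.pair (.var 1) (.pair (.lit 1)
          (.call 8 (.pair (.var 1) (.pair (.lit 0) (.pair
            (.call 6 (.pair (.var 1) (.pair (.var 0) (.pair (.lit 0) (.snd (.var 2))))))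
            (.call 6 (.pair (.var 1) (.pair (.var 0)
              (.pair (.call 10 (.var 0)) (.snd (.var 2)))))))))))))))

/-- Multiplication modulo `x ^ (2 ^ r) - y ^ s` over the ring of polynomials in `y` modulo
`y ^ (2 ^ b) + 1`, on `(r, (b, (s, (u, v))))`. -/
def mmE : Expr :=
  .ifLt (.fst (.var 0)) (.lit 1)
    (.call 5 (.pair (.fst (.snd (.var 0))) (.snd (.snd (.snd (.var 0))))))
    (.letIn (.natOp .sub (.fst (.var 0)) (.lit 1))
      (.letIn (.natOp .div (.fst (.snd (.snd (.var 1)))) (.lit 2))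
        (.letIn (.natOp .add (.var 0) (.call 10 (.fst (.snd (.var 2)))))
          (.call 8 (.pair (.var 2) (.pair
            (.natOp .sub (.call 10 (.natOp .add (.fst (.snd (.var 3))) (.lit 1))) (.var 1))
            (.pair
              (.call 6 (.pair (.var 2) (.pair (.fst (.snd (.var 3))) (.pair (.var 1) (.pair
                (.call 7 (.pair (.var 2) (.pair (.var 1) (.fst (.snd (.snd (.snd (.var 3))))))))
                (.call 7 (.pair (.var 2)
                  (.pair (.var 1) (.snd (.snd (.snd (.snd (.var 3)))))))))))))
              (.call 6 (.pair (.var 2) (.pair (.fst (.snd (.var 3))) (.pair (.var 0) (.pair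
                (.call 7 (.pair (.var 2) (.pair (.var 0) (.fst (.snd (.snd (.snd (.var 3))))))))
                (.call 7 (.pair (.var 2)
                  (.pair (.var 0) (.snd (.snd (.snd (.snd (.var 3))))))))))))))))))))

/-- Reduction modulo `x ^ (2 ^ r) - y ^ s` of a polynomial in `x` of degree less than
`2 ^ (r + 1)`, on `(r, (s, u))`. -/
def botE : Expr :=
  .ifLt (.fst (.var 0)) (.lit 1)
    (.call 1 (.pair (.fst (.snd (.snd (.var 0))))
      (.call 3 (.pair (.fst (.snd (.var 0))) (.snd (.snd (.snd (.var 0))))))))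
    (.letIn (.natOp .sub (.fst (.var 0)) (.lit 1))
      (.pair
        (.call 7 (.pair (.var 0) (.pair (.fst (.snd (.var 1))) (.fst (.snd (.snd (.var 1)))))))
        (.call 7 (.pair (.var 0) (.pair (.fst (.snd (.var 1))) (.snd (.snd (.snd (.var 1)))))))))

/-- The polynomial `(u + v) / 2 + x ^ (2 ^ r) y ^ s (u - v) / 2`, on `(r, (s, (u, v)))`. -/
def joinE : Expr :=
  .ifLt (.fst (.var 0)) (.lit 1)
    (.letIn (.fldOp .div .fldOne (.fldOp .add .fldOne .fldOne))
      (.pair (.call 2 (.pair (.var 0) (.call 1 (.snd (.snd (.var 1))))))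
        (.call 3 (.pair (.fst (.snd (.var 1)))
          (.call 2 (.pair (.var 0) (.call 9 (.snd (.snd (.var 1))))))))))
    (.letIn (.natOp .sub (.fst (.var 0)) (.lit 1))
      (.pair
        (.call 8 (.pair (.var 0) (.pair (.fst (.snd (.var 1)))
          (.pair (.fst (.fst (.snd (.snd (.var 1))))) (.fst (.snd (.snd (.snd (.var 1)))))))))
        (.call 8 (.pair (.var 0) (.pair (.fst (.snd (.var 1)))
          (.pair (.snd (.fst (.snd (.snd (.var 1))))) (.snd (.snd (.snd (.snd (.var 1)))))))))))

/-- Difference of two trees `(u, v)`. -/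
def subE : Expr :=
  .call 1 (.pair (.fst (.var 0))
    (.call 2 (.pair (.fldOp .sub .fldZero .fldOne) (.snd (.var 0)))))

/-- The number `2 ^ k`, on `k`. -/
def powTwoE : Expr :=
  .ifLt (.var 0) (.lit 1) (.lit 1)
    (.natOp .mul (.lit 2) (.call 10 (.natOp .sub (.var 0) (.lit 1))))

/-- The terms of degree less than `n`, on `(n, u)`. -/
def truncE : Expr :=
  .ifPair (.snd (.var 0))
    (.pair
      (.call 11 (.pair (.natOp .div (.natOp .add (.fst (.var 0)) (.lit 1)) (.lit 2))
        (.fst (.snd (.var 0)))))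
      (.call 11 (.pair (.natOp .div (.fst (.var 0)) (.lit 2)) (.snd (.snd (.var 0))))))
    (.ifLt (.fst (.var 0)) (.lit 1) .fldZero (.snd (.var 0)))

/-- The tree of depth `k` with all leaves equal to `v`, on `(k, v)`. -/
def repE : Expr :=
  .ifLt (.fst (.var 0)) (.lit 1) (.snd (.var 0))
    (.letIn (.call 12 (.pair (.natOp .sub (.fst (.var 0)) (.lit 1)) (.snd (.var 0))))
      (.pair (.var 0) (.var 0)))

/-- The leaf with address `i`, on `(k, (i, t))` with a tree `t` of depth `k`. -/
def getE : Expr :=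
  .ifLt (.fst (.var 0)) (.lit 1) (.snd (.snd (.var 0)))
    (.letIn (.natOp .sub (.fst (.var 0)) (.lit 1))
      (.letIn (.natOp .div (.fst (.snd (.var 1))) (.lit 2))
        (.ifLt (.natOp .mod (.fst (.snd (.var 2))) (.lit 2)) (.lit 1)
          (.call 13 (.pair (.var 1) (.pair (.var 0) (.fst (.snd (.snd (.var 2)))))))
          (.call 13 (.pair (.var 1) (.pair (.var 0) (.snd (.snd (.snd (.var 2))))))))))

/-- Replacement of the leaf with address `i` by `v`, on `(k, (i, (v, t)))` with a tree `t` of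
depth `k`. -/
def setE : Expr :=
  .ifLt (.fst (.var 0)) (.lit 1) (.fst (.snd (.snd (.var 0))))
    (.letIn (.natOp .sub (.fst (.var 0)) (.lit 1))
      (.letIn (.natOp .div (.fst (.snd (.var 1))) (.lit 2))
        (.letIn (.snd (.snd (.snd (.var 2))))
          (.ifLt (.natOp .mod (.fst (.snd (.var 3))) (.lit 2)) (.lit 1)
            (.pair (.call 14 (.pair (.var 2) (.pair (.var 1)
                (.pair (.fst (.snd (.snd (.var 3)))) (.fst (.var 0)))))) (.snd (.var 0)))
            (.pair (.fst (.var 0)) (.call 14 (.pair (.var 2) (.pair (.var 1)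
                (.pair (.fst (.snd (.snd (.var 3)))) (.snd (.var 0)))))))))))

/-- Multiplication modulo `x ^ p - 1`, on `(k, (p, (u, v)))` with trees of depth `k`, where
`2 * p ≤ 2 ^ k`. -/
def cmulE : Expr :=
  .letIn (.call 5 (.pair (.fst (.var 0)) (.snd (.snd (.var 0)))))
    (.call 11 (.pair (.fst (.snd (.var 1))) (.call 1 (.pair (.var 0) (.call 3 (.pair
      (.natOp .sub (.call 10 (.natOp .add (.fst (.var 1)) (.lit 1))) (.fst (.snd (.var 1))))
      (.var 0)))))))

/-- The value of an operand `o` of a straight-line program, on `((g, regs), o)` with the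
parameters `g = (κ, (k, (p, z)))`, the tree `regs` of depth `κ` of the earlier results, and the zero
tree `z` of depth `k`. Values are pairs of trees of depth `k`. -/
def operandE : Expr :=
  .ifPair (.snd (.var 0))
    (.ifLt (.fst (.snd (.var 0))) (.lit 1)
      (.call 13 (.pair (.fst (.fst (.fst (.var 0))))
        (.pair (.snd (.snd (.var 0))) (.snd (.fst (.var 0))))))
      (.letIn (.snd (.fst (.fst (.var 0))))
        (.pair (.call 14 (.pair (.fst (.var 0))
          (.pair (.lit 0) (.pair (.snd (.snd (.var 1))) (.snd (.snd (.var 0)))))))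
          (.snd (.snd (.var 0))))))
    (.letIn (.snd (.fst (.fst (.var 0))))
      (.letIn (.call 14 (.pair (.fst (.var 0))
          (.pair (.lit 1) (.pair .fldOne (.snd (.snd (.var 0)))))))
        (.pair (.var 0) (.var 0))))

/-- The result of an instruction `s`, on `((g, regs), s)`. -/
def instrE : Expr :=
  .letIn (.call 16 (.pair (.fst (.var 0)) (.fst (.snd (.snd (.var 0))))))
    (.letIn (.call 16 (.pair (.fst (.var 1)) (.snd (.snd (.snd (.var 1))))))
      (.ifLt (.fst (.snd (.var 2))) (.lit 1)
        (.pair (.call 1 (.pair (.fst (.var 1)) (.fst (.var 0))))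
          (.call 1 (.pair (.snd (.var 1)) (.snd (.var 0)))))
        (.ifLt (.fst (.snd (.var 2))) (.lit 2)
          (.pair (.call 9 (.pair (.fst (.var 1)) (.fst (.var 0))))
            (.call 9 (.pair (.snd (.var 1)) (.snd (.var 0)))))
          (.letIn (.snd (.fst (.fst (.var 2))))
            (.pair
              (.call 15 (.pair (.fst (.var 0)) (.pair (.fst (.snd (.var 0)))
                (.pair (.fst (.var 2)) (.fst (.var 1))))))
              (.call 1 (.pair
                (.call 15 (.pair (.fst (.var 0)) (.pair (.fst (.snd (.var 0)))
                  (.pair (.fst (.var 2)) (.snd (.var 1))))))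
                (.call 15 (.pair (.fst (.var 0)) (.pair (.fst (.snd (.var 0)))
                  (.pair (.snd (.var 2)) (.fst (.var 1)))))))))))))

/-- The last result of a list of instructions, the first of which has index `i`, on
`((g, regs), (i, instrs))`. -/
def runE : Expr :=
  .letIn (.call 17 (.pair (.fst (.var 0)) (.fst (.snd (.snd (.var 0))))))
    (.ifPair (.snd (.snd (.snd (.var 1))))
      (.call 18 (.pair
        (.pair (.fst (.fst (.var 1))) (.call 14 (.pair (.fst (.fst (.fst (.var 1))))
          (.pair (.fst (.snd (.var 1))) (.pair (.var 0) (.snd (.fst (.var 1))))))))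
        (.pair (.natOp .add (.fst (.snd (.var 1))) (.lit 1)) (.snd (.snd (.snd (.var 1)))))))
      (.var 0))

/-- The length of a list. -/
def lenE : Expr :=
  .ifPair (.var 0) (.natOp .add (.lit 1) (.call 19 (.snd (.var 0)))) (.lit 0)

/-- On `(v, (2 ^ k, k))`: the least `l ≥ k` with `v ≤ 2 ^ l`. -/
def clogE : Expr :=
  .ifLt (.fst (.snd (.var 0))) (.fst (.var 0))
    (.call 20 (.pair (.fst (.var 0)) (.pair (.natOp .mul (.lit 2) (.fst (.snd (.var 0))))
      (.natOp .add (.snd (.snd (.var 0))) (.lit 1)))))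
    (.snd (.snd (.var 0)))

/-- The power `d ^ n`, on `(d, n)`. -/
def powE : Expr :=
  .ifLt (.snd (.var 0)) (.lit 1) (.lit 1)
    (.natOp .mul (.fst (.var 0))
      (.call 21 (.pair (.fst (.var 0)) (.natOp .sub (.snd (.var 0)) (.lit 1)))))

/-- Trial division of `c` by the numbers from `d` on, on `(c, d)`; the result is `0` if a divisor
less than `c` is found, and `1` otherwise. -/
def trialE : Expr :=
  .ifLt (.snd (.var 0)) (.fst (.var 0))
    (.ifLt (.natOp .mod (.fst (.var 0)) (.snd (.var 0))) (.lit 1) (.lit 0)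
      (.call 22 (.pair (.fst (.var 0)) (.natOp .add (.snd (.var 0)) (.lit 1)))))
    (.lit 1)

/-- The list of the first `n` primes that are at least `c`, on `(c, n)`. -/
def primesE : Expr :=
  .ifLt (.snd (.var 0)) (.lit 1) (.lit 0)
    (.ifLt (.call 22 (.pair (.fst (.var 0)) (.lit 2))) (.lit 1)
      (.call 23 (.pair (.natOp .add (.fst (.var 0)) (.lit 1)) (.snd (.var 0))))
      (.pair (.fst (.var 0)) (.call 23 (.pair (.natOp .add (.fst (.var 0)) (.lit 1))
        (.natOp .sub (.snd (.var 0)) (.lit 1))))))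

/-- The images of a straight-line program modulo `x ^ q - 1`, where `q` is the innermost variable
and `(p, (D, instrs))` the next one. -/
def imagesE : Expr :=
  .letIn (.call 20 (.pair (.natOp .mul (.lit 2) (.var 0)) (.pair (.lit 1) (.lit 0))))
    (.letIn (.call 20 (.pair (.call 19 (.snd (.snd (.var 2)))) (.pair (.lit 1) (.lit 0))))
      (.pair (.fst (.var 3)) (.pair (.var 1)
        (.call 18 (.pair
          (.pair (.pair (.var 0) (.pair (.var 1) (.pair (.var 2)
              (.call 12 (.pair (.var 1) .fldZero)))))
            (.call 12 (.pair (.var 0) (.lit 0))))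
          (.pair (.lit 0) (.snd (.snd (.var 3)))))))))

/-- The entry `(p, (k, (u, u')))` of a prime `p`, on `(p, (D, instrs))`. The trees `u` and `u'` of
depth `k` are the images modulo `x ^ p - 1` of the polynomial `f` that is computed, and of `x f'`.
If `D < 3`, then `f` is linear, and both are found by computing modulo `x ^ 2 - 1`. -/
def entryE : Expr :=
  .letIn (.ifLt (.fst (.snd (.var 0))) (.lit 3) (.lit 2) (.fst (.var 0)))
    imagesE

/-- The entries of a list of primes, on `(primes, (D, instrs))`. -/
def entriesE : Expr :=
  .ifPair (.fst (.var 0))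
    (.pair (.call 24 (.pair (.fst (.fst (.var 0))) (.snd (.var 0))))
      (.call 25 (.pair (.snd (.fst (.var 0))) (.snd (.var 0)))))
    (.lit 0)

/-- The number of non-zero leaves of a tree. -/
def countE : Expr :=
  .ifPair (.var 0)
    (.natOp .add (.call 26 (.fst (.var 0))) (.call 26 (.snd (.var 0))))
    (.ifEq (.var 0) .fldZero (.lit 0) (.lit 1))

/-- The pair of the maximal number of terms in a non-empty list of entries, and the first entry
that attains it. -/
def bestE : Expr :=
  .letIn (.call 26 (.fst (.snd (.snd (.fst (.var 0))))))
    (.ifPair (.snd (.var 1))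
      (.letIn (.call 27 (.snd (.var 1)))
        (.ifLt (.var 1) (.fst (.var 0)) (.var 0) (.pair (.var 1) (.fst (.var 2)))))
      (.pair (.var 0) (.fst (.var 1))))

/-- On `(n, (entries, (c, d)))`: the number of those among the first `n` entries for which the
coefficient at the residue of `d` is `c`. -/
def certE : Expr :=
  .ifLt (.fst (.var 0)) (.lit 1) (.lit 0)
    (.letIn (.fst (.fst (.snd (.var 0))))
      (.natOp .add
        (.ifEq
          (.call 13 (.pair (.fst (.snd (.var 0)))
            (.pair (.natOp .mod (.snd (.snd (.snd (.var 1)))) (.fst (.var 0)))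
              (.fst (.snd (.snd (.var 0)))))))
          (.fst (.snd (.snd (.var 1)))) (.lit 1) (.lit 0))
        (.call 28 (.pair (.natOp .sub (.fst (.var 1)) (.lit 1))
          (.pair (.snd (.fst (.snd (.var 1)))) (.snd (.snd (.var 1))))))))

/-- On `((D, (n, (m, entries))), (acc, (u, u')))`: the sorted list `acc`, enlarged by the candidate
terms from the trees `u` and `u'` for which at least `m` of the first `n` entries agree. -/
def collectE : Expr :=
  .ifPair (.fst (.snd (.snd (.var 0))))
    (.call 29 (.pair (.fst (.var 0)) (.pair
      (.call 29 (.pair (.fst (.var 0)) (.pair (.fst (.snd (.var 0)))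
        (.pair (.fst (.fst (.snd (.snd (.var 0))))) (.fst (.snd (.snd (.snd (.var 0)))))))))
      (.pair (.snd (.fst (.snd (.snd (.var 0))))) (.snd (.snd (.snd (.snd (.var 0)))))))))
    (.ifEq (.fst (.snd (.snd (.var 0)))) .fldZero (.fst (.snd (.var 0)))
      (.letIn (.toNat (.fldOp .div (.snd (.snd (.snd (.var 0)))) (.fst (.snd (.snd (.var 0)))))
          (.fst (.fst (.var 0))))
        (.ifLt (.var 0) (.fst (.fst (.var 1)))
          (.ifLt (.call 28 (.pair (.fst (.snd (.fst (.var 1))))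
              (.pair (.snd (.snd (.snd (.fst (.var 1)))))
                (.pair (.fst (.snd (.snd (.var 1)))) (.var 0)))))
            (.fst (.snd (.snd (.fst (.var 1)))))
            (.fst (.snd (.var 1)))
            (.call 30 (.pair
              (.pair (.pair (.fst (.snd (.snd (.var 1)))) (.var 0)) (.snd (.snd (.snd (.var 1)))))
              (.fst (.snd (.var 1))))))
          (.fst (.snd (.var 1))))))

/-- Insertion into a list of items `((c, d), h)` that is sorted by `d`, on `(item, list)`. -/
def insertE : Expr :=
  .ifPair (.snd (.var 0))
    (.ifLt (.snd (.fst (.fst (.var 0)))) (.snd (.fst (.fst (.snd (.var 0)))))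
      (.pair (.fst (.var 0)) (.snd (.var 0)))
      (.ifLt (.snd (.fst (.fst (.snd (.var 0))))) (.snd (.fst (.fst (.var 0))))
        (.pair (.fst (.snd (.var 0))) (.call 30 (.pair (.fst (.var 0)) (.snd (.snd (.var 0))))))
        (.snd (.var 0))))
    (.pair (.fst (.var 0)) (.lit 0))

/-- Subtraction of the term of an item `((c, d), h)` from an entry, on `(entry, item)`. -/
def subItemE : Expr :=
  .letIn (.natOp .mod (.snd (.fst (.snd (.var 0)))) (.fst (.fst (.var 0))))
    (.letIn (.snd (.fst (.var 1)))
      (.pair (.fst (.fst (.var 2))) (.pair (.fst (.var 0)) (.pair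
        (.call 14 (.pair (.fst (.var 0)) (.pair (.var 1) (.pair
          (.fldOp .sub (.call 13 (.pair (.fst (.var 0)) (.pair (.var 1) (.fst (.snd (.var 0))))))
            (.fst (.fst (.snd (.var 2)))))
          (.fst (.snd (.var 0)))))))
        (.call 14 (.pair (.fst (.var 0)) (.pair (.var 1) (.pair
          (.fldOp .sub (.call 13 (.pair (.fst (.var 0)) (.pair (.var 1) (.snd (.snd (.var 0))))))
            (.snd (.snd (.var 2))))
          (.snd (.snd (.var 0)))))))))))

/-- Subtraction of all terms of a list of items from an entry, on `(entry, items)`. -/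
def subItemsE : Expr :=
  .ifPair (.snd (.var 0))
    (.call 32 (.pair (.call 31 (.pair (.fst (.var 0)) (.fst (.snd (.var 0)))))
      (.snd (.snd (.var 0)))))
    (.fst (.var 0))

/-- Subtraction of all terms of a list of items from all entries, on `(entries, items)`. -/
def subEntriesE : Expr :=
  .ifPair (.fst (.var 0))
    (.pair (.call 32 (.pair (.fst (.fst (.var 0))) (.snd (.var 0))))
      (.call 33 (.pair (.snd (.fst (.var 0))) (.snd (.var 0)))))
    (.lit 0)

/-- Insertion of all items of a list into a sorted list, on `(items, list)`. -/
def mergeE : Expr :=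
  .ifPair (.fst (.var 0))
    (.call 34 (.pair (.snd (.fst (.var 0)))
      (.call 30 (.pair (.fst (.fst (.var 0))) (.snd (.var 0))))))
    (.snd (.var 0))

/-- The list of the terms `(c, d)` of a list of items `((c, d), h)`. -/
def stripE : Expr :=
  .ifPair (.var 0)
    (.pair (.fst (.fst (.var 0))) (.call 35 (.snd (.var 0))))
    (.lit 0)

/-- The loop of DUIPoly, on `((D, (n, m)), (T₁, (entries, items)))`. -/
def loopE : Expr :=
  .ifLt (.fst (.snd (.var 0))) (.lit 1) (.pair (.snd (.snd (.snd (.var 0)))) (.lit 0))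
    (.letIn (.snd (.call 27 (.fst (.snd (.snd (.var 0))))))
      (.letIn (.call 29 (.pair
          (.pair (.fst (.fst (.var 1))) (.pair (.fst (.snd (.fst (.var 1))))
            (.pair (.snd (.snd (.fst (.var 1)))) (.fst (.snd (.snd (.var 1)))))))
          (.pair (.lit 0) (.snd (.snd (.var 0))))))
        (.letIn (.call 36 (.pair (.fst (.var 2))
            (.pair (.natOp .div (.fst (.snd (.var 2))) (.lit 2))
              (.pair (.call 33 (.pair (.fst (.snd (.snd (.var 2)))) (.var 0)))
                (.call 34 (.pair (.var 0) (.snd (.snd (.snd (.var 2))))))))))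
          (.pair (.fst (.var 0))
            (.pair (.pair (.fst (.var 2)) (.call 35 (.var 1))) (.snd (.var 0)))))))

/-- The last part of the procedure DUIPoly. The variables are `N`, `4 * N₁`, `N₁ + N₂ - 1`, `N₂`,
`N₁`, `⌈(T - 1) log₂ D⌉` and the input. -/
def passesE : Expr :=
  .letIn (.call 25 (.pair (.call 23 (.pair (.lit 2) (.var 0)))
      (.pair (.snd (.snd (.var 6))) (.fst (.var 6)))))
    (.letIn (.call 36 (.pair
        (.pair (.snd (.snd (.var 7))) (.pair (.var 3) (.var 4)))
        (.pair (.fst (.snd (.var 7))) (.pair (.var 0) (.lit 0)))))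
      (.pair (.call 35 (.fst (.var 0))) (.snd (.var 0))))

/-- The part of the procedure DUIPoly after the computation of `N₁`. The variables are `N₁`,
`⌈(T - 1) log₂ D⌉` and the input. -/
def countsE : Expr :=
  .letIn (.call 20 (.pair
      (.call 21 (.pair (.snd (.snd (.var 2))) (.fst (.snd (.var 2)))))
      (.pair (.lit 1) (.lit 0))))
    (.letIn (.natOp .sub (.natOp .add (.var 1) (.var 0)) (.lit 1))
      (.letIn (.natOp .mul (.lit 4) (.var 2))
        (.letIn (.ifLt (.var 0) (.var 1) (.var 1) (.var 0)) passesE)))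

/-- The procedure DUIPoly, on `(instrs, (T, D))`. -/
def mainE : Expr :=
  .ifLt (.fst (.snd (.var 0))) (.lit 1) (.pair (.lit 0) (.lit 0))
    (.letIn (.call 20 (.pair
        (.call 21 (.pair (.snd (.snd (.var 0))) (.natOp .sub (.fst (.snd (.var 0))) (.lit 1))))
        (.pair (.lit 1) (.lit 0))))
      (.letIn (.ifLt (.var 0) (.lit 1) (.lit 1) (.var 0)) countsE))

/-- The table of all functions. -/
def prog : Program :=
  [mainE, addE, scaleE, rotE, naiveE, smulE, mmE, botE, joinE, subE, powTwoE, truncE, repE, getE,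
    setE, cmulE, operandE, instrE, runE, lenE, clogE, powE, trialE, primesE, entryE, entriesE,
    countE, bestE, certE, collectE, insertE, subItemE, subItemsE, subEntriesE, mergeE, stripE,
    loopE]

noncomputable section

open Polynomial

/-! ### Trees as polynomials -/

section
variable {F : Type u} [Field F]

theorem size_two : Nat.size 2 = 2 := by decide
theorem size_three : Nat.size 3 = 2 := by decide
theorem size_four : Nat.size 4 = 3 := by decide

/-- A perfect binary tree of depth `k`, the leaves of which satisfy `Q`. -/
def Full {F : Type u} (Q : Val F → Prop) : ℕ → Val F → Prop
  | 0, v => Q v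
  | k + 1, v => ∃ a b, v = .pair a b ∧ Full Q k a ∧ Full Q k b

/-- Field elements as values. -/
def IsFld {F : Type u} (v : Val F) : Prop := ∃ a, v = .fld a

/-- The polynomial denoted by a tree, the leaves of which are addressed by the binary digits of the
exponents, least significant digit first. -/
def tpoly : Val F → F[X]
  | .nat _ => 0
  | .fld a => C a
  | .pair e o => expand F 2 (tpoly e) + X * expand F 2 (tpoly o)

theorem coeff_interleave_even {R : Type u} [CommRing R] (f g : R[X]) (i : ℕ) :
    (expand R 2 f + X * expand R 2 g).coeff (2 * i) = f.coeff i := by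
  rw [coeff_add, coeff_expand_mul' (by norm_num)]
  rcases i with _ | i
  · simp
  · rw [show 2 * (i + 1) = (2 * i + 1) + 1 by ring, coeff_X_mul, coeff_expand (by norm_num),
      if_neg (by omega), add_zero]

theorem coeff_interleave_odd {R : Type u} [CommRing R] (f g : R[X]) (i : ℕ) :
    (expand R 2 f + X * expand R 2 g).coeff (2 * i + 1) = g.coeff i := by
  rw [coeff_add, coeff_X_mul, coeff_expand_mul' (by norm_num), coeff_expand (by norm_num),
    if_neg (by omega), zero_add]

theorem coeff_interleave {R : Type u} [CommRing R] (f g : R[X]) (i : ℕ) :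
    (expand R 2 f + X * expand R 2 g).coeff i =
      if i % 2 = 0 then f.coeff (i / 2) else g.coeff (i / 2) := by
  rcases Nat.even_or_odd' i with ⟨j, rfl | rfl⟩
  · rw [coeff_interleave_even, if_pos (by omega)]; congr 1; omega
  · rw [coeff_interleave_odd, if_neg (by omega)]; congr 1; omega

theorem coeff_interleave_eq_zero {R : Type u} [CommRing R] {f g : R[X]} {n : ℕ}
    (hf : ∀ i, n ≤ i → f.coeff i = 0) (hg : ∀ i, n ≤ i → g.coeff i = 0) (i : ℕ) (hi : n * 2 ≤ i) :
    (expand R 2 f + X * expand R 2 g).coeff i = 0 := by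
  rw [coeff_interleave]
  split_ifs
  · exact hf _ (by omega)
  · exact hg _ (by omega)

theorem tpoly_coeff_eq_zero {k : ℕ} : ∀ {u : Val F}, Full IsFld k u →
    ∀ i, 2 ^ k ≤ i → (tpoly u).coeff i = 0 := by
  induction k with
  | zero =>
    rintro u ⟨a, rfl⟩ i hi
    rw [tpoly, coeff_C, if_neg (by simp at hi; omega)]
  | succ k ih =>
    rintro u ⟨a, b, rfl, ha, hb⟩ i hi
    exact coeff_interleave_eq_zero (ih ha) (ih hb) i (by rwa [pow_succ] at hi)

theorem degree_tpoly_lt {k : ℕ} {u : Val F} (h : Full IsFld k u) :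
    (tpoly u).degree < (2 ^ k : ℕ) :=
  degree_lt_iff_coeff_zero _ _ |>.2 (tpoly_coeff_eq_zero h)

/-! ### Linear operations on trees -/

theorem add_spec (k : ℕ) : ∀ u v : Val F, Full IsFld k u → Full IsFld k v →
    Cl prog 1 (.pair u v) fun w d =>
      (Full IsFld k w ∧ tpoly w = tpoly u + tpoly v) ∧ d + 20 ≤ 40 * 2 ^ k := by
  induction k with
  | zero =>
    rintro u v ⟨a, rfl⟩ ⟨b, rfl⟩
    refine Cl.intro rfl ?_
    simp [addE, Sym, onSome, Val.onPair, Val.onFld, Val.split, FldOp.apply, Full, IsFld, tpoly]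
  | succ k ih =>
    rintro u v ⟨a, b, rfl, ha, hb⟩ ⟨a', b', rfl, ha', hb'⟩
    refine Cl.intro rfl ?_
    simp only [addE, Sym, onSome, Val.onPair, Val.split, List.getElem?_cons_zero]
    refine (ih a a' ha ha').mono ?_
    rintro w d ⟨⟨hw, hwp⟩, hd⟩
    refine (ih b b' hb hb').mono ?_
    rintro w' d' ⟨⟨hw', hwp'⟩, hd'⟩
    refine ⟨⟨⟨_, _, rfl, hw, hw'⟩, ?_⟩, ?_⟩
    · simp only [tpoly, hwp, hwp', map_add]; ring
    · rw [pow_succ]; omega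

theorem scale_spec (c : F) (k : ℕ) : ∀ u : Val F, Full IsFld k u →
    Cl prog 2 (.pair (.fld c) u) fun w d =>
      (Full IsFld k w ∧ tpoly w = C c * tpoly u) ∧ d + 20 ≤ 40 * 2 ^ k := by
  induction k with
  | zero =>
    rintro u ⟨a, rfl⟩
    refine Cl.intro rfl ?_
    simp [scaleE, Sym, onSome, Val.onPair, Val.onFld, Val.split, FldOp.apply, Full, IsFld, tpoly]
  | succ k ih =>
    rintro u ⟨a, b, rfl, ha, hb⟩
    refine Cl.intro rfl ?_
    simp only [scaleE, Sym, onSome, Val.onPair, Val.split, List.getElem?_cons_zero]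
    refine (ih a ha).mono ?_
    rintro w d ⟨⟨hw, hwp⟩, hd⟩
    refine (ih b hb).mono ?_
    rintro w' d' ⟨⟨hw', hwp'⟩, hd'⟩
    refine ⟨⟨⟨_, _, rfl, hw, hw'⟩, ?_⟩, ?_⟩
    · simp only [tpoly, hwp, hwp', map_mul, expand_C]; ring
    · rw [pow_succ]; omega

theorem sub_spec {k : ℕ} {u v : Val F} (hu : Full IsFld k u) (hv : Full IsFld k v) :
    Cl prog 9 (.pair u v) fun w d =>
      (Full IsFld k w ∧ tpoly w = tpoly u - tpoly v) ∧ d ≤ 80 * 2 ^ k := by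
  refine Cl.intro rfl ?_
  simp only [subE, Sym, onSome, Val.onPair, Val.onFld, FldOp.apply, List.getElem?_cons_zero]
  refine (scale_spec (0 - 1) k v hv).mono ?_
  rintro w d ⟨⟨hw, hwp⟩, hd⟩
  refine (add_spec k u w hu hw).mono ?_
  rintro w' d' ⟨⟨hw', hwp'⟩, hd'⟩
  refine ⟨⟨hw', ?_⟩, by omega⟩
  rw [hwp', hwp, zero_sub, C_neg, C_1]; ring

theorem expand_dvd {R : Type u} [CommRing R] {f g : R[X]} (h : f ∣ g) :
    expand R 2 f ∣ expand R 2 g := by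
  obtain ⟨c, rfl⟩ := h
  exact ⟨expand R 2 c, map_mul _ _ _⟩

theorem expand_modulus (k : ℕ) :
    expand F 2 (X ^ 2 ^ k + 1 : F[X]) = X ^ 2 ^ (k + 1) + 1 := by
  rw [map_add, map_pow, expand_X, map_one, ← pow_mul, pow_succ']

/-- Multiplication by `y` swaps the two halves of a tree, up to one more multiplication by `y²`.
The summand added to the cost pays for the call itself, so that the bound is stable under the
recursion. -/
theorem rot_spec (w k : ℕ) : ∀ (s : ℕ) (u : Val F), s ≤ 2 ^ w → Full IsFld k u →
    Cl prog 3 (.pair (.nat s) u) fun v d =>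
      (Full IsFld k v ∧ (X ^ 2 ^ k + 1 : F[X]) ∣ X ^ s * tpoly u - tpoly v) ∧
        d + 20 * opCost (w + 1) ≤ 40 * (opCost (w + 1) * 2 ^ k) := by
  have hK := le_opCost (w + 1)
  have hsize : ∀ s, s ≤ 2 ^ w → s.size ≤ w + 1 := fun s hs =>
    Nat.size_le.2 (lt_of_le_of_lt hs (Nat.pow_lt_pow_right (by norm_num) (by omega)))
  have h2 : Nat.size 2 ≤ w + 1 ∨ w = 0 := by rw [size_two]; omega
  induction k with
  | zero =>
    rintro s u hs ⟨a, rfl⟩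
    refine Cl.intro rfl ?_
    simp only [rotE, Sym, onSome, Val.onPair, Val.onFld, Val.onNat, Val.split, FldOp.apply,
      NatOp.apply, List.getElem?_cons_zero, size_two, Nat.size_one, tpoly, pow_zero, pow_one]
    have hc : NatOp.cost .mod s 2 ≤ 3 * (w + 2) := by
      simp only [NatOp.cost, size_two]; have := hsize s hs; nlinarith
    have hm : (s % 2).size ≤ 1 := Nat.size_le.2 (by omega)
    have hdvd : (X + 1 : F[X]) ∣ X ^ s - (-1) ^ s := by
      have := sub_dvd_pow_sub_pow (X : F[X]) (-1) s
      rwa [sub_neg_eq_add] at this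
    constructor
    · intro h
      refine ⟨⟨⟨a, rfl⟩, ?_⟩, by omega⟩
      rw [Even.neg_one_pow (Nat.even_iff.2 (by omega))] at hdvd
      have := hdvd.mul_right (C a)
      rwa [sub_mul, one_mul] at this
    · intro h
      refine ⟨⟨⟨_, rfl⟩, ?_⟩, by omega⟩
      rw [Odd.neg_one_pow (Nat.odd_iff.2 (by omega))] at hdvd
      have := hdvd.mul_right (C a)
      rw [zero_sub, C_neg]
      rwa [sub_mul, neg_one_mul] at this
  | succ k ih =>
    rintro s u hs ⟨a, b, rfl, ha, hb⟩
    refine Cl.intro rfl ?_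
    simp only [rotE, Sym, onSome, Val.onPair, Val.onNat, Val.split,
      NatOp.apply, List.getElem?_cons_zero, List.getElem?_cons_succ, size_two, Nat.size_one]
    have hc : NatOp.cost .mod s 2 ≤ opCost (w + 1) := by
      simp only [NatOp.cost, size_two, opCost]; have := hsize s hs; nlinarith
    have hc' : NatOp.cost .div s 2 ≤ opCost (w + 1) := by
      simp only [NatOp.cost, size_two, opCost]; have := hsize s hs; nlinarith
    have hc'' : NatOp.cost .add (s / 2) 1 ≤ opCost (w + 1) :=
      cost_le_opCost _ (hsize _ (by omega)) (by rw [Nat.size_one]; omega)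
    have hm : (s % 2).size ≤ 1 := Nat.size_le.2 (by omega)
    constructor
    · intro h
      refine (ih (s / 2) a (by omega) ha).mono ?_
      rintro v d ⟨⟨hv, hvp⟩, hd⟩
      refine (ih (s / 2) b (by omega) hb).mono ?_
      rintro v' d' ⟨⟨hv', hvp'⟩, hd'⟩
      refine ⟨⟨⟨_, _, rfl, hv, hv'⟩, ?_⟩, ?_⟩
      · rw [← expand_modulus]
        convert (expand_dvd hvp).add ((expand_dvd hvp').mul_left X) using 1
        simp only [tpoly, map_sub, map_mul, map_pow, expand_X, ← pow_mul]
        rw [show 2 * (s / 2) = s by omega]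
        ring
      · rw [pow_succ]; nlinarith
    · intro h
      refine (ih (s / 2 + 1) b (by omega) hb).mono ?_
      rintro v d ⟨⟨hv, hvp⟩, hd⟩
      refine (ih (s / 2) a (by omega) ha).mono ?_
      rintro v' d' ⟨⟨hv', hvp'⟩, hd'⟩
      refine ⟨⟨⟨_, _, rfl, hv, hv'⟩, ?_⟩, ?_⟩
      · rw [← expand_modulus]
        convert (expand_dvd hvp).add ((expand_dvd hvp').mul_left X) using 1
        simp only [tpoly, map_sub, map_mul, map_pow, expand_X, ← pow_mul]
        rw [show 2 * (s / 2 + 1) = s + 1 by omega, pow_succ]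
        obtain ⟨t, ht⟩ : ∃ t, 2 * (s / 2) = t := ⟨_, rfl⟩
        rw [ht, show s = t + 1 by omega]
        ring
      · rw [pow_succ]; nlinarith

/-- Four recursive products for trees of half the size: quadratic cost, for a bounded depth only.
-/
theorem naive_spec (k : ℕ) : ∀ u v : Val F, Full IsFld k u → Full IsFld k v →
    Cl prog 4 (.pair u v) fun w d =>
      (Full IsFld k w ∧ (X ^ 2 ^ k + 1 : F[X]) ∣ tpoly u * tpoly v - tpoly w) ∧
        d + 600 * 2 ^ k ≤ 1200 * 4 ^ k := by
  induction k with
  | zero =>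
    rintro u v ⟨a, rfl⟩ ⟨b, rfl⟩
    refine Cl.intro rfl ?_
    simp [naiveE, Sym, onSome, Val.onPair, Val.onFld, Val.split, FldOp.apply, Full, IsFld, tpoly]
  | succ k ih =>
    rintro u v ⟨a, b, rfl, ha, hb⟩ ⟨a', b', rfl, ha', hb'⟩
    refine Cl.intro rfl ?_
    simp only [naiveE, Sym, onSome, Val.onPair, Val.split, List.getElem?_cons_zero, Nat.size_one]
    refine (ih a a' ha ha').mono ?_
    rintro v₁ d₁ ⟨⟨hv₁, hp₁⟩, hd₁⟩
    refine (ih b b' hb hb').mono ?_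
    rintro v₂ d₂ ⟨⟨hv₂, hp₂⟩, hd₂⟩
    refine (rot_spec 0 k 1 v₂ le_rfl hv₂).mono ?_
    rintro v₃ d₃ ⟨⟨hv₃, hp₃⟩, hd₃⟩
    refine (add_spec k v₁ v₃ hv₁ hv₃).mono ?_
    rintro v₄ d₄ ⟨⟨hv₄, hp₄⟩, hd₄⟩
    refine (ih a b' ha hb').mono ?_
    rintro v₅ d₅ ⟨⟨hv₅, hp₅⟩, hd₅⟩
    refine (ih b a' hb ha').mono ?_
    rintro v₆ d₆ ⟨⟨hv₆, hp₆⟩, hd₆⟩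
    refine (add_spec k v₅ v₆ hv₅ hv₆).mono ?_
    rintro v₇ d₇ ⟨⟨hv₇, hp₇⟩, hd₇⟩
    refine ⟨⟨⟨_, _, rfl, hv₄, hv₇⟩, ?_⟩, ?_⟩
    · rw [← expand_modulus]
      convert ((expand_dvd hp₁).add ((expand_dvd hp₂).mul_left (X ^ 2))).add
        ((expand_dvd hp₃).add (((expand_dvd hp₅).add (expand_dvd hp₆)).mul_left X)) using 1
      simp only [tpoly, hp₄, hp₇, map_sub, map_add, map_mul, expand_X, pow_one]
      ring
    · have h1 : (opCost (0 + 1)) = 9 := rfl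
      rw [h1] at hd₃
      have : 1 ≤ 2 ^ k := Nat.one_le_two_pow
      rw [pow_succ, pow_succ]
      omega

theorem powTwo_spec (k : ℕ) : Cl prog 10 (.nat k : Val F) fun w d =>
    w = .nat (2 ^ k) ∧ d ≤ 4 * opCost (k + 2) * 2 ^ k := by
  induction k with
  | zero =>
    refine Cl.intro rfl ?_
    simp [powTwoE, Sym, onSome, Val.onNat, opCost]
  | succ k ih =>
    refine Cl.intro rfl ?_
    simp only [powTwoE, Sym, onSome, Val.onNat, List.getElem?_cons_zero, Nat.size_one,
      NatOp.apply, size_two, Nat.add_sub_cancel]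
    refine ⟨fun h => by omega, fun _ => ih.mono ?_⟩
    rintro w d ⟨rfl, hd⟩
    have h1 : (k + 1).size ≤ k + 1 := size_le_of_le le_rfl
    have h2 : NatOp.cost .mul 2 (2 ^ k) ≤ opCost (k + 3) :=
      cost_le_opCost _ (by rw [size_two]; omega) (by rw [Nat.size_pow]; omega)
    have h3 : NatOp.cost .sub (k + 1) 1 ≤ opCost (k + 3) :=
      cost_le_opCost _ (by omega) (by rw [Nat.size_one]; omega)
    have h4 := le_opCost (k + 3)
    have h5 : opCost (k + 2) ≤ opCost (k + 3) := opCost_mono (by omega)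
    have h6 : 1 ≤ 2 ^ k := Nat.one_le_two_pow
    refine ⟨by rw [pow_succ'], ?_⟩
    have h7 : 4 * opCost (k + 2) * 2 ^ k ≤ 4 * opCost (k + 3) * 2 ^ k := by gcongr
    have h8 : opCost (k + 3) ≤ opCost (k + 3) * 2 ^ k := Nat.le_mul_of_pos_right _ h6
    rw [show k + 1 + 2 = k + 3 by ring, pow_succ]
    nlinarith

end

/-! ### Fast multiplication -/

section
variable {F : Type u} [Field F]

/-- The ring `F[y] / (y ^ (2 ^ b) + 1)`. -/
abbrev NegRing (F : Type u) [Field F] (b : ℕ) : Type u := AdjoinRoot (X ^ 2 ^ b + 1 : F[X])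

/-- The class of the indeterminate, a root of unity of order `2 ^ (b + 1)`. -/
def yy (F : Type u) [Field F] (b : ℕ) : NegRing F b := AdjoinRoot.root _

theorem yy_pow (b : ℕ) : yy F b ^ 2 ^ b = -1 := by
  have h := AdjoinRoot.eval₂_root (X ^ 2 ^ b + 1 : F[X])
  simp only [eval₂_add, eval₂_pow, eval₂_X, eval₂_one] at h
  exact eq_neg_of_add_eq_zero_left h

/-- The element of `F[y] / (y ^ (2 ^ b) + 1)` denoted by a tree of depth `b`. -/
def nval (b : ℕ) (u : Val F) : NegRing F b := AdjoinRoot.mk _ (tpoly u)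

theorem nval_eq_iff {b : ℕ} {f : F[X]} {u : Val F} :
    AdjoinRoot.mk (X ^ 2 ^ b + 1 : F[X]) f = nval b u ↔ X ^ 2 ^ b + 1 ∣ f - tpoly u :=
  AdjoinRoot.mk_eq_mk

/-- A tree of depth `b + r` as a polynomial of degree less than `2 ^ r` over
`F[y] / (y ^ (2 ^ b) + 1)`, the coefficients of which are the subtrees of depth `b`. -/
def opoly (b : ℕ) : ℕ → Val F → (NegRing F b)[X]
  | 0, u => C (nval b u)
  | r + 1, .pair e o => expand _ 2 (opoly b r e) + X * expand _ 2 (opoly b r o)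
  | _ + 1, _ => 0

theorem opoly_coeff_eq_zero (b r : ℕ) : ∀ (u : Val F) (i : ℕ), 2 ^ r ≤ i →
    (opoly b r u).coeff i = 0 := by
  induction r with
  | zero =>
    intro u i hi
    rw [opoly, coeff_C, if_neg (by simp at hi; omega)]
  | succ r ih =>
    intro u i hi
    cases u with
    | pair e o => exact coeff_interleave_eq_zero (ih e) (ih o) i (by rwa [pow_succ] at hi)
    | _ => simp [opoly]

theorem degree_opoly_lt (b r : ℕ) (u : Val F) : (opoly b r u).degree < (2 ^ r : ℕ) :=
  degree_lt_iff_coeff_zero _ _ |>.2 (opoly_coeff_eq_zero b r u)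

theorem expand_modulus_sub (b r : ℕ) (c : NegRing F b) :
    expand _ 2 (X ^ 2 ^ r - C c) = X ^ 2 ^ (r + 1) - C c := by
  rw [map_sub, map_pow, expand_X, expand_C, ← pow_mul, pow_succ']

theorem nval_rot {b s : ℕ} {u v : Val F}
    (h : (X ^ 2 ^ b + 1 : F[X]) ∣ X ^ s * tpoly u - tpoly v) :
    nval b v = yy F b ^ s * nval b u := by
  rw [← nval_eq_iff, map_mul, map_pow] at h
  exact h.symm

theorem size_le_of_le_pow {s w : ℕ} (hs : s ≤ 2 ^ w) : s.size ≤ w + 1 :=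
  Nat.size_le.2 (lt_of_le_of_lt hs (Nat.pow_lt_pow_right (by norm_num) (by omega)))

/-- The two halves of a polynomial in `x` are polynomials in `x²`, so the reduction modulo `x ^ (2
^ r) - y ^ s` acts on both of them by reduction modulo `x ^ (2 ^ (r - 1)) - y ^ s`. In the base
case `x` is replaced by `y ^ s`. -/
theorem bot_spec (w b s : ℕ) (hs : s ≤ 2 ^ w) (r : ℕ) (hr : r ≤ w) : ∀ u : Val F,
    Full IsFld (b + (r + 1)) u →
    Cl prog 7 (.pair (.nat r) (.pair (.nat s) u)) fun v d =>
      (Full IsFld (b + r) v ∧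
        X ^ 2 ^ r - C (yy F b ^ s) ∣ opoly b (r + 1) u - opoly b r v) ∧
      d + 50 * opCost (w + 1) ≤ 150 * (opCost (w + 1) * 2 ^ (b + r)) := by
  have hK := le_opCost (w + 1)
  induction r with
  | zero =>
    rintro u ⟨a, c, rfl, ha, hc⟩
    refine Cl.intro rfl ?_
    simp only [botE, Sym, onSome, Val.onPair, Val.onNat, NatOp.apply,
      List.getElem?_cons_zero, List.getElem?_cons_succ, Nat.size_one, Nat.size_zero]
    refine ⟨fun _ => ?_, fun h => by omega⟩
    refine (rot_spec w b s c hs hc).mono ?_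
    rintro v₁ d₁ ⟨⟨hv₁, hp₁⟩, hd₁⟩
    refine (add_spec b a v₁ ha hv₁).mono ?_
    rintro v₂ d₂ ⟨⟨hv₂, hp₂⟩, hd₂⟩
    refine ⟨⟨hv₂, ?_⟩, ?_⟩
    · have h2 : nval b v₂ = nval b a + yy F b ^ s * nval b c := by
        rw [← nval_rot hp₁, nval, hp₂, map_add]; rfl
      refine ⟨C (nval b c), ?_⟩
      simp only [opoly, h2, expand_C, pow_zero, pow_one, map_add, map_mul]
      ring
    · have h1 : opCost (w + 1) ≤ opCost (w + 1) * 2 ^ b :=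
        Nat.le_mul_of_pos_right _ (by positivity)
      have h2 : 8 * 2 ^ b ≤ opCost (w + 1) * 2 ^ b := Nat.mul_le_mul_right _ (by omega)
      rw [add_zero]
      omega
  | succ r ih =>
    rintro u ⟨a, c, rfl, ha, hc⟩
    refine Cl.intro rfl ?_
    have hsz : (r + 1).size ≤ w := (Nat.size_le.2 Nat.lt_two_pow_self).trans hr
    have hcost : NatOp.cost .sub (r + 1) 1 ≤ opCost (w + 1) :=
      cost_le_opCost _ (by omega) (by rw [Nat.size_one]; omega)
    simp only [botE, Sym, onSome, Val.onPair, Val.onNat, NatOp.apply,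
      List.getElem?_cons_zero, List.getElem?_cons_succ, Nat.size_one, Nat.add_sub_cancel]
    refine ⟨fun h => by omega, fun _ => ?_⟩
    refine (ih (by omega) a ha).mono ?_
    rintro v₁ d₁ ⟨⟨hv₁, hp₁⟩, hd₁⟩
    refine (ih (by omega) c hc).mono ?_
    rintro v₂ d₂ ⟨⟨hv₂, hp₂⟩, hd₂⟩
    refine ⟨⟨⟨_, _, rfl, hv₁, hv₂⟩, ?_⟩, ?_⟩
    · rw [← expand_modulus_sub]
      convert (expand_dvd hp₁).add ((expand_dvd hp₂).mul_left X) using 1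
      rw [opoly, opoly]
      simp only [map_sub]
      ring
    · rw [show b + (r + 1) = (b + r) + 1 from rfl, pow_succ]
      nlinarith

/-- The lift of two residues, for the moduli `x ^ (2 ^ r) ∓ y ^ t` with `y ^ (s + t) = 1`, to a
residue for the product of the moduli. Like the reduction, it acts on the halves of the trees. -/
theorem join_spec (w b s : ℕ) (hs : s ≤ 2 ^ w) (h2 : (2 : F) ≠ 0) (r : ℕ) (hr : r ≤ w) :
    ∀ u v : Val F, Full IsFld (b + r) u → Full IsFld (b + r) v →
    Cl prog 8 (.pair (.nat r) (.pair (.nat s) (.pair u v))) fun t d =>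
      (Full IsFld (b + (r + 1)) t ∧
        2 * opoly b (r + 1) t = (opoly b r u + opoly b r v) +
          X ^ 2 ^ r * C (yy F b ^ s) * (opoly b r u - opoly b r v)) ∧
      d + 100 * opCost (w + 1) ≤ 250 * (opCost (w + 1) * 2 ^ (b + r)) := by
  have hK := le_opCost (w + 1)
  induction r with
  | zero =>
    intro u v hu hv
    refine Cl.intro rfl ?_
    simp only [joinE, Sym, onSome, Val.onPair, Val.onNat, Val.onFld, NatOp.apply,
      FldOp.apply, List.getElem?_cons_zero, List.getElem?_cons_succ, Nat.size_one, Nat.size_zero]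
    refine ⟨fun _ => ?_, fun h => by omega⟩
    refine (add_spec b u v hu hv).mono ?_
    rintro v₁ d₁ ⟨⟨hv₁, hp₁⟩, hd₁⟩
    refine (scale_spec (1 / (1 + 1)) b v₁ hv₁).mono ?_
    rintro v₂ d₂ ⟨⟨hv₂, hp₂⟩, hd₂⟩
    refine (sub_spec hu hv).mono ?_
    rintro v₃ d₃ ⟨⟨hv₃, hp₃⟩, hd₃⟩
    refine (scale_spec (1 / (1 + 1)) b v₃ hv₃).mono ?_
    rintro v₄ d₄ ⟨⟨hv₄, hp₄⟩, hd₄⟩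
    refine (rot_spec w b s v₄ hs hv₄).mono ?_
    rintro v₅ d₅ ⟨⟨hv₅, hp₅⟩, hd₅⟩
    refine ⟨⟨⟨_, _, rfl, hv₂, hv₅⟩, ?_⟩, ?_⟩
    · have hhalf : (2 : F[X]) * C (1 / (1 + 1)) = 1 := by
        rw [one_add_one_eq_two, show (2 : F[X]) = C 2 from rfl, ← C_mul, mul_one_div_cancel h2, C_1]
      have e2 : 2 * nval b v₂ = nval b u + nval b v := by
        simp only [nval, hp₂, hp₁]
        rw [← map_add, ← map_ofNat (AdjoinRoot.mk (X ^ 2 ^ b + 1 : F[X])) 2, ← map_mul, ← mul_assoc,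
          hhalf, one_mul]
      have e4 : 2 * nval b v₄ = nval b u - nval b v := by
        simp only [nval, hp₄, hp₃]
        rw [← map_sub, ← map_ofNat (AdjoinRoot.mk (X ^ 2 ^ b + 1 : F[X])) 2, ← map_mul, ← mul_assoc,
          hhalf, one_mul]
      have e2' := congrArg C e2
      have e4' := congrArg C e4
      simp only [map_mul, map_add, map_sub, map_ofNat] at e2' e4'
      simp only [opoly, expand_C, nval_rot hp₅, map_mul, pow_zero, pow_one]
      linear_combination e2' + X * C (yy F b ^ s) * e4'
    · have h1 : opCost (w + 1) ≤ opCost (w + 1) * 2 ^ b :=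
        Nat.le_mul_of_pos_right _ (by positivity)
      have h2 : 8 * 2 ^ b ≤ opCost (w + 1) * 2 ^ b := Nat.mul_le_mul_right _ (by omega)
      rw [add_zero] at hd₃ ⊢
      omega
  | succ r ih =>
    rintro u v ⟨a, c, rfl, ha, hc⟩ ⟨a', c', rfl, ha', hc'⟩
    refine Cl.intro rfl ?_
    have hsz : (r + 1).size ≤ w := (Nat.size_le.2 Nat.lt_two_pow_self).trans hr
    have hcost : NatOp.cost .sub (r + 1) 1 ≤ opCost (w + 1) :=
      cost_le_opCost _ (by omega) (by rw [Nat.size_one]; omega)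
    simp only [joinE, Sym, onSome, Val.onPair, Val.onNat, NatOp.apply,
      List.getElem?_cons_zero, List.getElem?_cons_succ, Nat.size_one, Nat.add_sub_cancel]
    refine ⟨fun h => by omega, fun _ => ?_⟩
    refine (ih (by omega) a a' ha ha').mono ?_
    rintro v₁ d₁ ⟨⟨hv₁, hp₁⟩, hd₁⟩
    refine (ih (by omega) c c' hc hc').mono ?_
    rintro v₂ d₂ ⟨⟨hv₂, hp₂⟩, hd₂⟩
    refine ⟨⟨⟨_, _, rfl, hv₁, hv₂⟩, ?_⟩, ?_⟩
    · have e1 := congrArg (expand (NegRing F b) 2) hp₁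
      have e2 := congrArg (expand (NegRing F b) 2) hp₂
      simp only [map_mul, map_add, map_sub, map_ofNat, expand_C, map_pow, expand_X,
        ← pow_mul] at e1 e2
      rw [show 2 * 2 ^ r = 2 ^ (r + 1) by ring] at e1 e2
      rw [show opoly b (r + 1 + 1) (Val.pair v₁ v₂) = expand _ 2 (opoly b (r + 1) v₁) +
        X * expand _ 2 (opoly b (r + 1) v₂) from rfl]
      simp only [opoly, map_pow]
      linear_combination e1 + X * e2
    · rw [show b + (r + 1) = (b + r) + 1 from rfl, pow_succ]
      nlinarith

/-- The statement that fast multiplication of trees of depth `b` is correct and takes at most `S`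
bit operations. -/
def MulSpec (F : Type u) [Field F] (b S : ℕ) : Prop :=
  ∀ u v : Val F, Full IsFld b u → Full IsFld b v →
    Cl prog 5 (.pair (.nat b) (.pair u v)) fun t d =>
      (Full IsFld b t ∧ nval b u * nval b v = nval b t) ∧ d ≤ S

theorem exists_two_mul_eq_one (b : ℕ) (h2 : (2 : F) ≠ 0) : ∃ c : (NegRing F b)[X], 2 * c = 1 := by
  refine ⟨C (algebraMap F (NegRing F b) 2⁻¹), ?_⟩
  have h := congrArg (algebraMap F (NegRing F b)) (mul_inv_cancel₀ h2)
  rw [map_mul, map_ofNat, map_one] at h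
  have h' := congrArg C h
  rwa [C_mul, C_1, map_ofNat] at h'

/-- Chinese remaindering for the moduli `N - w` and `N + w`. -/
theorem dvd_sub_of_halves {R : Type u} [CommRing R] {c N w w' A p q t : R} (hc : 2 * c = 1)
    (hw : w' * w = 1) (hp : N - w ∣ A - p) (hq : N + w ∣ A - q)
    (ht : 2 * t = (p + q) + N * w' * (p - q)) : N ^ 2 - w ^ 2 ∣ A - t := by
  obtain ⟨U, hU⟩ := hp
  obtain ⟨V, hV⟩ := hq
  refine ⟨c * w' * (U - V), ?_⟩
  linear_combination (-(A - t)) * hc - c * ht + c * (1 + w' * N) * hU + c * (1 - w' * N) * hV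
    + c * ((N - w) * U + (N + w) * V) * (-hw)

/-- Recursive Chinese remaindering: `x ^ (2 ^ (r + 1)) - y ^ (2 * s)` is the product of `x ^ (2 ^
r) - y ^ s` and `x ^ (2 ^ r) + y ^ s`, and the latter is `x ^ (2 ^ r) - y ^ (s + 2 ^ b)`. After
`r` levels the moduli are linear, and `2 ^ r` products of elements of `F[y] / (y ^ (2 ^ b) + 1)`
remain. -/
theorem mm_spec (b S : ℕ) (h2 : (2 : F) ≠ 0) (hS : MulSpec F b S) (r : ℕ) (hr : r ≤ b + 1) :
    ∀ (s : ℕ) (u v : Val F), s ≤ 2 ^ (b + 1) → 2 ^ r ∣ s →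
    Full IsFld (b + r) u → Full IsFld (b + r) v →
    Cl prog 6 (.pair (.nat r) (.pair (.nat b) (.pair (.nat s) (.pair u v)))) fun t d =>
      (Full IsFld (b + r) t ∧
        X ^ 2 ^ r - C (yy F b ^ s) ∣ opoly b r u * opoly b r v - opoly b r t) ∧
      d ≤ 2 ^ r * (S + 40) + 500 * r * (opCost (b + 4) * 2 ^ (b + r)) := by
  have hK := le_opCost (b + 4)
  have hsz : ∀ s, s ≤ 2 ^ (b + 1) → s.size ≤ b + 4 := fun s hs =>
    (size_le_of_le_pow hs).trans (by omega)
  induction r with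
  | zero =>
    intro s u v hs hd hu hv
    refine Cl.intro rfl ?_
    dsimp only [mmE, Sym, onSome, Val.onPair, Val.onNat, Val.split, NatOp.apply,
      List.getElem?_cons_zero, List.getElem?_cons_succ, Nat.size_one, Nat.size_zero]
    refine ⟨fun _ => (hS u v hu hv).mono ?_, fun h => by omega⟩
    rintro t d ⟨⟨ht, hp⟩, hd⟩
    refine ⟨⟨ht, ?_⟩, ?_⟩
    · simp only [opoly]
      rw [← C_mul, hp, sub_self]
      exact dvd_zero _
    · omega
  | succ r ih =>
    intro s u v hs hd hu hv
    refine Cl.intro rfl ?_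
    have hpow : 2 ^ r ∣ 2 ^ b := Nat.pow_dvd_pow _ (by omega)
    have hb1 : 2 ^ (b + 1) = 2 * 2 ^ b := pow_succ' _ _
    obtain ⟨m, rfl⟩ := hd
    have hhalf : 2 ^ (r + 1) * m / 2 = 2 ^ r * m := by
      rw [pow_succ, mul_right_comm]; exact Nat.mul_div_cancel _ (by norm_num)
    have htwo : 2 ^ (r + 1) * m = 2 * (2 ^ r * m) := by rw [pow_succ]; ring
    set s := 2 ^ r * m with hsdef
    have c1 : NatOp.cost .sub (r + 1) 1 ≤ opCost (b + 4) :=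
      cost_le_opCost _ ((size_le_of_le hr).trans (by omega)) (by rw [Nat.size_one]; omega)
    have c2 : NatOp.cost .div (2 ^ (r + 1) * m) 2 ≤ opCost (b + 4) :=
      cost_le_opCost _ (hsz _ hs) (by rw [size_two]; omega)
    have c3 : NatOp.cost .add s (2 ^ b) ≤ opCost (b + 4) :=
      cost_le_opCost _ (hsz _ (by omega)) (hsz _ (by omega))
    have c4 : NatOp.cost .add b 1 ≤ opCost (b + 4) :=
      cost_le_opCost _ ((size_le_of_le le_rfl).trans (by omega)) (by rw [Nat.size_one]; omega)
    have c5 : NatOp.cost .sub (2 ^ (b + 1)) s ≤ opCost (b + 4) :=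
      cost_le_opCost _ (hsz _ le_rfl) (hsz _ (by omega))
    have c6 : (r + 1).size ≤ b + 1 := size_le_of_le hr
    have hKm : opCost (b + 1 + 1) ≤ opCost (b + 4) := opCost_mono (by omega)
    have hKm' : opCost (b + 2) ≤ opCost (b + 4) := opCost_mono (by omega)
    have hKm'' : opCost (b + 1 + 2) ≤ opCost (b + 4) := opCost_mono (by omega)
    dsimp only [mmE, Sym, onSome, Val.onPair, Val.onNat, Val.split, NatOp.apply,
      List.getElem?_cons_zero, List.getElem?_cons_succ, Nat.size_one, Nat.add_one_sub_one]
    rw [hhalf]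
    refine ⟨fun h => by omega, fun _ => ?_⟩
    refine (powTwo_spec b).mono ?_
    rintro _ d₁ ⟨rfl, hd₁⟩
    dsimp only
    refine (powTwo_spec (b + 1)).mono ?_
    rintro _ d₂ ⟨rfl, hd₂⟩
    dsimp only
    refine (bot_spec (b + 1) b s (by omega) r (by omega) u hu).mono ?_
    rintro u₁ e₁ ⟨⟨hu₁, hup₁⟩, he₁⟩
    refine (bot_spec (b + 1) b s (by omega) r (by omega) v hv).mono ?_
    rintro v₁ e₂ ⟨⟨hv₁, hvp₁⟩, he₂⟩
    refine (ih (by omega) s u₁ v₁ (by omega) (Dvd.intro _ rfl) hu₁ hv₁).mono ?_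
    rintro t₁ e₃ ⟨⟨ht₁, htp₁⟩, he₃⟩
    refine (bot_spec (b + 1) b (s + 2 ^ b) (by omega) r (by omega) u hu).mono ?_
    rintro u₂ e₄ ⟨⟨hu₂, hup₂⟩, he₄⟩
    refine (bot_spec (b + 1) b (s + 2 ^ b) (by omega) r (by omega) v hv).mono ?_
    rintro v₂ e₅ ⟨⟨hv₂, hvp₂⟩, he₅⟩
    refine (ih (by omega) (s + 2 ^ b) u₂ v₂ (by omega)
      (Dvd.dvd.add (Dvd.intro _ rfl) hpow) hu₂ hv₂).mono ?_
    rintro t₂ e₆ ⟨⟨ht₂, htp₂⟩, he₆⟩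
    refine (join_spec (b + 1) b (2 ^ (b + 1) - s) (by omega) h2 r (by omega) t₁ t₂ ht₁ ht₂).mono ?_
    rintro t e₇ ⟨⟨ht, htp⟩, he₇⟩
    refine ⟨⟨ht, ?_⟩, ?_⟩
    · have hyy : yy F b ^ (s + 2 ^ b) = -(yy F b ^ s) := by rw [pow_add, yy_pow, mul_neg_one]
      have hinv : yy F b ^ (2 ^ (b + 1) - s) * yy F b ^ s = 1 := by
        rw [← pow_add, Nat.sub_add_cancel (by omega), hb1, mul_comm, pow_mul, yy_pow]
        norm_num
      have hinv' := congrArg C hinv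
      obtain ⟨c, hc⟩ := exists_two_mul_eq_one b h2
      rw [hyy, C_neg, sub_neg_eq_add] at hup₂ hvp₂ htp₂
      have h₁ : X ^ 2 ^ r - C (yy F b ^ s) ∣
          opoly b (r + 1) u * opoly b (r + 1) v - opoly b r t₁ := by
        convert ((hvp₁.mul_left (opoly b (r + 1) u)).add
          (hup₁.mul_right (opoly b r v₁))).add htp₁ using 1
        ring
      have h₂ : X ^ 2 ^ r + C (yy F b ^ s) ∣
          opoly b (r + 1) u * opoly b (r + 1) v - opoly b r t₂ := by
        convert ((hvp₂.mul_left (opoly b (r + 1) u)).add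
          (hup₂.mul_right (opoly b r v₂))).add htp₂ using 1
        ring
      rw [C_mul, C_1] at hinv'
      rw [htwo, pow_mul' (yy F b) 2 s, C_pow, pow_succ' 2 r, pow_mul' X 2 (2 ^ r)]
      exact dvd_sub_of_halves hc hinv' h₁ h₂ htp
    · have hX : opCost (b + 4) * 2 ^ b ≤ opCost (b + 4) * 2 ^ (b + r) := by gcongr <;> omega
      have hX' : opCost (b + 4) ≤ opCost (b + 4) * 2 ^ b :=
        Nat.le_mul_of_pos_right _ (by positivity)
      have f₁ : 4 * opCost (b + 2) * 2 ^ b ≤ 4 * (opCost (b + 4) * 2 ^ b) := by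
        rw [mul_assoc]; gcongr
      have f₂ : 4 * opCost (b + 1 + 2) * 2 ^ (b + 1) ≤ 8 * (opCost (b + 4) * 2 ^ b) := by
        rw [hb1]
        calc _ ≤ 4 * opCost (b + 4) * (2 * 2 ^ b) := by gcongr
          _ = _ := by ring
      have f₃ : opCost (b + 1 + 1) * 2 ^ (b + r) ≤ opCost (b + 4) * 2 ^ (b + r) := by gcongr
      have g₁ : 2 ^ (r + 1) * (S + 40) = 2 * (2 ^ r * (S + 40)) := by ring
      have g₂ : 500 * (r + 1) * (opCost (b + 4) * 2 ^ (b + (r + 1))) =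
        1000 * (r * (opCost (b + 4) * 2 ^ (b + r))) + 1000 * (opCost (b + 4) * 2 ^ (b + r)) := by
        ring
      have g₃ : 500 * r * (opCost (b + 4) * 2 ^ (b + r)) =
        500 * (r * (opCost (b + 4) * 2 ^ (b + r))) := by ring
      rw [g₃] at he₃ he₆
      have h2' := size_two
      rw [g₁, g₂]
      omega

theorem eval₂_interleave {R S : Type u} [CommRing R] [CommRing S] (φ : R →+* S) (y : S)
    (f g : R[X]) : eval₂ φ y (expand R 2 f + X * expand R 2 g) =
      eval₂ φ (y ^ 2) f + y * eval₂ φ (y ^ 2) g := by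
  rw [eval₂_add, eval₂_mul, eval₂_X, expand_eq_comp_X_pow, expand_eq_comp_X_pow, eval₂_comp,
    eval₂_comp, eval₂_pow, eval₂_X]

/-- A tree denotes the same element whether its coefficients or its subtrees of depth `b` are read
off. -/
theorem eval₂_opoly {R : Type u} [CommRing R] [Algebra F R] (b : ℕ) (φ : NegRing F b →ₐ[F] R)
    (a : ℕ) : ∀ (y : R) (u : Val F), φ (yy F b) = y ^ 2 ^ a → Full IsFld (b + a) u →
      eval₂ (φ : NegRing F b →+* R) y (opoly b a u) = aeval y (tpoly u) := by
  induction a with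
  | zero =>
    intro y u hy hu
    rw [pow_zero, pow_one] at hy
    rw [opoly, eval₂_C, ← hy, yy, aeval_algHom_apply, AdjoinRoot.aeval_eq]
    rfl
  | succ a ih =>
    rintro y u hy ⟨e, o, rfl, he, ho⟩
    have hy' : φ (yy F b) = (y ^ 2) ^ 2 ^ a := by rw [hy, ← pow_mul, pow_succ']
    rw [opoly, eval₂_interleave, ih _ _ hy' he, ih _ _ hy' ho]
    exact (eval₂_interleave (algebraMap F R) y (tpoly e) (tpoly o)).symm

instance (b : ℕ) : Nontrivial (NegRing F b) := by
  refine AdjoinRoot.nontrivial _ ?_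
  rw [← C_1, degree_X_pow_add_C (by positivity)]
  exact_mod_cast (by positivity : 2 ^ b ≠ 0)

theorem eq_of_monic_dvd_sub {R : Type u} [CommRing R] [Nontrivial R] {m f g : R[X]} {n : ℕ}
    (hm : m.Monic) (hn : m.degree = n) (h : m ∣ f - g) (hf : f.degree < n) (hg : g.degree < n) :
    f = g := by
  rw [← sub_eq_zero]
  by_contra hne
  exact hm.not_dvd_of_degree_lt hne
    (by rw [hn]; exact lt_of_le_of_lt (degree_sub_le _ _) (max_lt hf hg)) h

/-- Multiplication modulo `y ^ (2 ^ k) + 1` with quasi-linear cost. With `k = b + a` and `a = k /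
2`, a tree of depth `k` denotes a polynomial in `x` of degree less than `2 ^ a` over `F[z] / (z ^
(2 ^ b) + 1)`, where `x = y` and `z = y ^ (2 ^ a)`. The product in `x` has degree less than `2 ^
(a + 1)`, so it is found from its residues modulo `x ^ (2 ^ a) ∓ 1`; this calls for `2 * 2 ^ a`
products in depth `b`. A final reduction modulo `x ^ (2 ^ a) - z` gives the result. The fourth
power in the bound absorbs the factor two in the recursion, as `256 * (b + 1) ^ 4 ≤ 81 * (k + 1) ^
4`. The division by two excludes characteristic two, except in depths where the schoolbook method
is used. -/
theorem smul_spec (k : ℕ) (h : (2 : F) ≠ 0 ∨ k < 3) : MulSpec F k (4000 * (2 ^ k * (k + 1) ^ 4)) := by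
  induction k using Nat.strong_induction_on with
  | _ k ih =>
    intro u v hu hv
    refine Cl.intro rfl ?_
    have hk : k.size ≤ k := size_le_of_le le_rfl
    have hK := le_opCost (k + 2)
    dsimp only [smulE, Sym, onSome, Val.onPair, Val.onNat, Val.split, NatOp.apply,
      List.getElem?_cons_zero, List.getElem?_cons_succ, Nat.size_one, Nat.size_zero]
    refine ⟨fun hlt => ?_, fun hge => ?_⟩
    · refine (naive_spec k u v hu hv).mono ?_
      rintro t d ⟨⟨ht, htp⟩, hd⟩
      refine ⟨⟨ht, ?_⟩, ?_⟩
      · rw [← nval_eq_iff, map_mul] at htp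
        exact htp
      · rw [size_three]
        interval_cases k <;> norm_num at hd ⊢ <;> omega
    · have h2 : (2 : F) ≠ 0 := h.resolve_right hge
      obtain ⟨a, ha⟩ : ∃ a, a = k / 2 := ⟨_, rfl⟩
      obtain ⟨b, hb⟩ : ∃ b, b = k - a := ⟨_, rfl⟩
      have hab : b + a = k := by omega
      have c₁ : NatOp.cost .div k 2 ≤ opCost (k + 2) :=
        cost_le_opCost _ (by omega) (by rw [size_two]; omega)
      have c₂ : NatOp.cost .sub k a ≤ opCost (k + 2) :=
        cost_le_opCost _ (by omega) ((size_le_of_le (show a ≤ k by omega)).trans (by omega))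
      rw [← ha, ← hb]
      have hS := ih b (by omega) (Or.inl h2)
      have hba : 2 ^ a ≤ 2 ^ b := Nat.pow_le_pow_right (by norm_num) (by omega)
      have hu' : Full IsFld (b + a) u := by rwa [hab]
      have hv' : Full IsFld (b + a) v := by rwa [hab]
      refine (mm_spec b _ h2 hS a (by omega) 0 u v (by positivity) (dvd_zero _) hu' hv').mono ?_
      rintro t₁ d₁ ⟨⟨ht₁, htp₁⟩, hd₁⟩
      refine (powTwo_spec b).mono ?_
      rintro _ d₂ ⟨rfl, hd₂⟩
      refine (mm_spec b _ h2 hS a (by omega) (2 ^ b) u v (by rw [pow_succ]; omega)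
        (Nat.pow_dvd_pow _ (by omega)) hu' hv').mono ?_
      rintro t₃ d₃ ⟨⟨ht₃, htp₃⟩, hd₃⟩
      refine (join_spec (b + 1) b 0 (by positivity) h2 a (by omega) t₁ t₃ ht₁ ht₃).mono ?_
      rintro t₄ d₄ ⟨⟨ht₄, htp₄⟩, hd₄⟩
      refine (bot_spec (b + 1) b 1 Nat.one_le_two_pow a (by omega) t₄ ht₄).mono ?_
      rintro t₅ d₅ ⟨⟨ht₅, htp₅⟩, hd₅⟩
      refine ⟨⟨by rwa [hab] at ht₅, ?_⟩, ?_⟩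
      · obtain ⟨c, hc⟩ := exists_two_mul_eq_one b h2
        rw [pow_zero, C_1] at htp₁ htp₄
        rw [yy_pow, C_neg, C_1, sub_neg_eq_add] at htp₃
        have hdvd := dvd_sub_of_halves hc (one_mul 1) htp₁ htp₃ htp₄
        -- The residue modulo `x ^ (2 ^ (a + 1)) - 1` is the product itself, by degrees.
        have hJ : opoly b a u * opoly b a v = opoly b (a + 1) t₄ := by
          rw [one_pow, ← pow_mul, ← pow_succ] at hdvd
          have hm := monic_X_pow_sub_C (1 : NegRing F b) (n := 2 ^ (a + 1)) (by positivity)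
          have hdeg := degree_X_pow_sub_C (n := 2 ^ (a + 1)) (by positivity) (1 : NegRing F b)
          rw [C_1] at hm hdeg
          refine eq_of_monic_dvd_sub hm hdeg hdvd ?_ (degree_opoly_lt b (a + 1) t₄)
          rw [degree_lt_iff_coeff_zero]
          intro i hi
          rw [coeff_mul]
          refine Finset.sum_eq_zero fun x hx => ?_
          have hx := Finset.HasAntidiagonal.mem_antidiagonal.1 hx
          rw [pow_succ] at hi
          rcases le_or_gt (2 ^ a) x.1 with h1 | h1
          · rw [opoly_coeff_eq_zero b a u _ h1, zero_mul]
          · rw [opoly_coeff_eq_zero b a v _ (by omega), mul_zero]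
        -- The substitution of `y` for `x` and of `y ^ (2 ^ a)` for the root of unity.
        have hroot : eval₂ ((Algebra.ofId F (NegRing F k) : F →ₐ[F] NegRing F k) : F →+* NegRing F k)
            (yy F k ^ 2 ^ a) (X ^ 2 ^ b + 1) = 0 := by
          rw [eval₂_add, eval₂_pow, eval₂_X, eval₂_one, ← pow_mul, ← pow_add, add_comm a b, hab,
            yy_pow, neg_add_cancel]
        let φ : NegRing F b →ₐ[F] NegRing F k :=
          AdjoinRoot.liftAlgHom _ (Algebra.ofId F _) (yy F k ^ 2 ^ a) hroot
        have hφ : φ (yy F b) = yy F k ^ 2 ^ a := AdjoinRoot.liftAlgHom_root _ _ _ _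
        have key : ∀ t, Full IsFld (b + a) t →
            eval₂ (φ : NegRing F b →+* NegRing F k) (yy F k) (opoly b a t) = nval k t := by
          intro t ht
          rw [eval₂_opoly b φ a (yy F k) t hφ ht]
          exact AdjoinRoot.aeval_eq _
        obtain ⟨W, hW⟩ := htp₅
        have := congrArg (eval₂ (φ : NegRing F b →+* NegRing F k) (yy F k)) hW
        rw [eval₂_mul, eval₂_sub, eval₂_sub, eval₂_C, eval₂_pow, eval₂_X, pow_one, RingHom.coe_coe,
          hφ, sub_self, zero_mul, ← hJ, eval₂_mul, key u hu', key v hv', key t₅ ht₅] at this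
        exact sub_eq_zero.1 this
      · have e₁ : 4 * (b + 1) ≤ 3 * (k + 1) := by omega
        have e₂ : 256 * (b + 1) ^ 4 ≤ 81 * (k + 1) ^ 4 := by
          have := Nat.pow_le_pow_left e₁ 4
          rw [mul_pow, mul_pow] at this
          simpa using this
        have e₃ : opCost (b + 4) ≤ 4 * (k + 1) ^ 2 := by
          have := Nat.pow_le_pow_left (show b + 4 + 2 ≤ 2 * (k + 1) by omega) 2
          rw [mul_pow] at this
          exact this
        have e₄ : opCost (k + 2) ≤ 4 * (k + 1) ^ 2 := by
          have := Nat.pow_le_pow_left (show k + 2 + 2 ≤ 2 * (k + 1) by omega) 2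
          rw [mul_pow] at this
          exact this
        have e₅ : opCost (b + 1 + 1) ≤ opCost (b + 4) := opCost_mono (by omega)
        have e₆ : opCost (b + 2) ≤ opCost (b + 4) := opCost_mono (by omega)
        rw [hab] at hd₁ hd₃ hd₄ hd₅
        have f₁ : 256 * (2 ^ k * (b + 1) ^ 4) ≤ 81 * (2 ^ k * (k + 1) ^ 4) := by
          calc _ = 2 ^ k * (256 * (b + 1) ^ 4) := by ring
            _ ≤ 2 ^ k * (81 * (k + 1) ^ 4) := Nat.mul_le_mul_left _ e₂
            _ = _ := by ring
        have f₂ : 4 * (opCost (b + 4) * 2 ^ k) ≤ 2 ^ k * (k + 1) ^ 4 := by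
          calc _ ≤ 4 * (4 * (k + 1) ^ 2 * 2 ^ k) := by gcongr
            _ = 2 ^ k * (4 ^ 2 * (k + 1) ^ 2) := by ring
            _ ≤ 2 ^ k * ((k + 1) ^ 2 * (k + 1) ^ 2) := by gcongr; omega
            _ = _ := by ring
        have f₃ : 2 * (a * (opCost (b + 4) * 2 ^ k)) ≤ 2 ^ k * (k + 1) ^ 4 := by
          calc _ = (2 * a) * (opCost (b + 4) * 2 ^ k) := by ring
            _ ≤ (k + 1) * (4 * (k + 1) ^ 2 * 2 ^ k) := by gcongr; omega
            _ = 2 ^ k * ((k + 1) ^ 3 * 4) := by ring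
            _ ≤ 2 ^ k * ((k + 1) ^ 3 * (k + 1)) := by gcongr; omega
            _ = _ := by ring
        have f₄ : 256 * 2 ^ k ≤ 2 ^ k * (k + 1) ^ 4 := by
          calc _ = 2 ^ k * 4 ^ 4 := by ring
            _ ≤ _ := by gcongr; omega
        have f₅ : 4 * opCost (k + 2) ≤ 2 ^ k * (k + 1) ^ 4 := by
          calc _ ≤ 4 * (4 * (k + 1) ^ 2) := by gcongr
            _ = 1 * (4 ^ 2 * (k + 1) ^ 2) := by ring
            _ ≤ 2 ^ k * ((k + 1) ^ 2 * (k + 1) ^ 2) := by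
              gcongr
              · exact Nat.one_le_two_pow
              · omega
            _ = _ := by ring
        have g₁ : 2 ^ a * (4000 * (2 ^ b * (b + 1) ^ 4) + 40) + 500 * a * (opCost (b + 4) * 2 ^ k) =
            4000 * (2 ^ k * (b + 1) ^ 4) + 40 * 2 ^ a + 500 * (a * (opCost (b + 4) * 2 ^ k)) := by
          rw [← hab, pow_add]; ring
        have g₂ : opCost (b + 1 + 1) * 2 ^ k ≤ opCost (b + 4) * 2 ^ k := by gcongr
        have g₃ : 4 * opCost (b + 2) * 2 ^ b ≤ 4 * (opCost (b + 4) * 2 ^ k) := by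
          rw [mul_assoc]
          gcongr
          · norm_num
          · omega
        have g₄ : 2 ^ a ≤ 2 ^ k := Nat.pow_le_pow_right (by norm_num) (by omega)
        have s₂ := size_two
        have s₃ := size_three
        rw [g₁] at hd₁ hd₃
        omega

end

/-! ### Reduction modulo `x ^ p - 1` -/

section
variable {F : Type u} [Field F]

theorem monic_cyc {p : ℕ} (hp : 0 < p) : (X ^ p - 1 : F[X]).Monic := by
  have h := monic_X_pow_sub_C (1 : F) hp.ne'
  rwa [C_1] at h

theorem degree_cyc_modulus {p : ℕ} (hp : 0 < p) : (X ^ p - 1 : F[X]).degree = p := by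
  have h := degree_X_pow_sub_C hp (1 : F)
  rwa [C_1] at h

theorem degree_cyc_lt {p : ℕ} (hp : 0 < p) (f : F[X]) : (cyc p f).degree < p := by
  rw [← degree_cyc_modulus (F := F) hp]
  exact degree_modByMonic_lt _ (monic_cyc hp)

theorem dvd_sub_cyc (p : ℕ) (f : F[X]) : X ^ p - 1 ∣ f - cyc p f :=
  ⟨f /ₘ (X ^ p - 1), by rw [sub_eq_iff_eq_add']; exact (modByMonic_add_div f _).symm⟩

theorem cyc_eq_of_dvd {p : ℕ} (hp : 0 < p) {f g : F[X]} (h : X ^ p - 1 ∣ f - g)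
    (hg : g.degree < p) : cyc p f = g := by
  refine eq_of_monic_dvd_sub (monic_cyc hp) (degree_cyc_modulus hp) ?_ (degree_cyc_lt hp f) hg
  have := h.sub (dvd_sub_cyc p f)
  rwa [sub_sub_sub_cancel_left] at this

theorem cyc_congr {p : ℕ} (hp : 0 < p) {f g : F[X]} (h : X ^ p - 1 ∣ f - g) :
    cyc p f = cyc p g :=
  cyc_eq_of_dvd hp (by simpa using h.add (dvd_sub_cyc p g)) (degree_cyc_lt hp g)

theorem cyc_add (p : ℕ) (f g : F[X]) : cyc p (f + g) = cyc p f + cyc p g :=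
  add_modByMonic f g

theorem cyc_sub (p : ℕ) (f g : F[X]) : cyc p (f - g) = cyc p f - cyc p g :=
  sub_modByMonic f g _

theorem cyc_eq_self {p : ℕ} (hp : 0 < p) {f : F[X]} (h : f.degree < p) : cyc p f = f :=
  cyc_eq_of_dvd hp (by rw [sub_self]; exact dvd_zero _) h

theorem cyc_zero {p : ℕ} (hp : 0 < p) : cyc p (0 : F[X]) = 0 :=
  cyc_eq_self hp (by rw [degree_zero]; exact WithBot.bot_lt_coe _)

theorem cyc_monomial {p : ℕ} (hp : 0 < p) (e : ℕ) (c : F) :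
    cyc p (monomial e c) = monomial (e % p) c := by
  refine cyc_eq_of_dvd hp ?_ (lt_of_le_of_lt (degree_monomial_le _ _) ?_)
  · have h := sub_dvd_pow_sub_pow (X ^ p : F[X]) 1 (e / p)
    rw [one_pow, ← pow_mul] at h
    have h' := h.mul_left (C c * X ^ (e % p))
    rwa [mul_sub, mul_one, mul_assoc, ← pow_add, Nat.mod_add_div, C_mul_X_pow_eq_monomial,
      C_mul_X_pow_eq_monomial] at h'
  · exact_mod_cast Nat.mod_lt e hp

theorem cyc_sum {p : ℕ} (hp : 0 < p) {ι : Type*} (s : Finset ι) (f : ι → F[X]) :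
    cyc p (∑ i ∈ s, f i) = ∑ i ∈ s, cyc p (f i) := by
  classical
  induction s using Finset.induction_on with
  | empty => simp [cyc_zero hp]
  | insert a s ha ih => rw [Finset.sum_insert ha, Finset.sum_insert ha, cyc_add, ih]

/-! ### Access to the leaves of a tree -/

/-- The leaf with address `i` of a tree of depth `k`. -/
def leaf {F : Type u} : ℕ → Val F → ℕ → Val F
  | 0, v, _ => v
  | k + 1, .pair a b, i => if i % 2 = 0 then leaf k a (i / 2) else leaf k b (i / 2)
  | _ + 1, _, _ => .nat 0

theorem leaf_eq_coeff (k : ℕ) : ∀ (u : Val F) (i : ℕ), Full IsFld k u → i < 2 ^ k →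
    leaf k u i = .fld ((tpoly u).coeff i) := by
  induction k with
  | zero =>
    rintro u i ⟨a, rfl⟩ hi
    obtain rfl : i = 0 := by simpa using hi
    simp [leaf, tpoly]
  | succ k ih =>
    rintro u i ⟨a, b, rfl, ha, hb⟩ hi
    rw [pow_succ] at hi
    rw [leaf, tpoly, coeff_interleave]
    split_ifs
    · exact ih a _ ha (by omega)
    · exact ih b _ hb (by omega)

theorem get_spec (w : ℕ) (hw : 2 ≤ w) (Q : Val F → Prop) (k : ℕ) (hk : k ≤ w) :
    ∀ (i : ℕ) (t : Val F), i.size ≤ w → Full Q k t →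
      Cl prog 13 (.pair (.nat k) (.pair (.nat i) t)) fun v d =>
        v = leaf k t i ∧ d ≤ 10 * opCost w * (k + 1) := by
  have hK := le_opCost w
  have s2 := size_two
  have s1 := Nat.size_one
  have s0 := Nat.size_zero
  induction k with
  | zero =>
    intro i t hi ht
    refine Cl.intro rfl ?_
    dsimp only [getE, Sym, onSome, Val.onPair, Val.onNat, List.getElem?_cons_zero]
    exact ⟨fun _ => ⟨rfl, by omega⟩, fun h => by omega⟩
  | succ k ih =>
    rintro i t hi ⟨a, b, rfl, ha, hb⟩
    refine Cl.intro rfl ?_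
    dsimp only [getE, Sym, onSome, Val.onPair, Val.onNat, NatOp.apply,
      List.getElem?_cons_zero, List.getElem?_cons_succ, Nat.add_one_sub_one]
    have hks : (k + 1).size ≤ w := size_le_of_le hk
    have c1 : NatOp.cost .sub (k + 1) 1 ≤ opCost w := cost_le_opCost _ hks (by omega)
    have c2 : NatOp.cost .div i 2 ≤ opCost w := cost_le_opCost _ hi (by omega)
    have c3 : NatOp.cost .mod i 2 ≤ opCost w := cost_le_opCost _ hi (by omega)
    have hm : (i % 2).size ≤ 1 := Nat.size_le.2 (by omega)
    have hi2 : (i / 2).size ≤ w := (Nat.size_le_size (Nat.div_le_self i 2)).trans hi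
    have hring : 10 * opCost w * (k + 1 + 1) = 10 * opCost w * (k + 1) + 10 * opCost w := by ring
    rw [hring]
    refine ⟨fun h => by omega, fun _ => ⟨fun h => ?_, fun h => ?_⟩⟩
    · refine (ih (by omega) (i / 2) a hi2 ha).mono ?_
      rintro v d ⟨rfl, hd⟩
      exact ⟨by rw [leaf, if_pos (by omega)], by omega⟩
    · refine (ih (by omega) (i / 2) b hi2 hb).mono ?_
      rintro v d ⟨rfl, hd⟩
      exact ⟨by rw [leaf, if_neg (by omega)], by omega⟩

theorem set_spec (w : ℕ) (hw : 2 ≤ w) (Q : Val F → Prop) (v : Val F) (hv : Q v) (k : ℕ)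
    (hk : k ≤ w) : ∀ (i : ℕ) (t : Val F), i.size ≤ w → i < 2 ^ k → Full Q k t →
      Cl prog 14 (.pair (.nat k) (.pair (.nat i) (.pair v t))) fun t' d =>
        (Full Q k t' ∧ ∀ j < 2 ^ k, leaf k t' j = if j = i then v else leaf k t j) ∧
          d ≤ 10 * opCost w * (k + 1) := by
  have hK := le_opCost w
  have s2 := size_two
  have s1 := Nat.size_one
  have s0 := Nat.size_zero
  induction k with
  | zero =>
    intro i t hi hik ht
    refine Cl.intro rfl ?_
    dsimp only [setE, Sym, onSome, Val.onPair, Val.onNat, List.getElem?_cons_zero]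
    refine ⟨fun _ => ⟨⟨hv, fun j hj => ?_⟩, by omega⟩, fun h => by omega⟩
    rw [if_pos (by simp at hj hik; omega)]
    rfl
  | succ k ih =>
    rintro i t hi hik ⟨a, b, rfl, ha, hb⟩
    refine Cl.intro rfl ?_
    dsimp only [setE, Sym, onSome, Val.onPair, Val.onNat, NatOp.apply,
      List.getElem?_cons_zero, List.getElem?_cons_succ, Nat.add_one_sub_one]
    have hks : (k + 1).size ≤ w := size_le_of_le hk
    have c1 : NatOp.cost .sub (k + 1) 1 ≤ opCost w := cost_le_opCost _ hks (by omega)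
    have c2 : NatOp.cost .div i 2 ≤ opCost w := cost_le_opCost _ hi (by omega)
    have c3 : NatOp.cost .mod i 2 ≤ opCost w := cost_le_opCost _ hi (by omega)
    have hm : (i % 2).size ≤ 1 := Nat.size_le.2 (by omega)
    have hi2 : (i / 2).size ≤ w := (Nat.size_le_size (Nat.div_le_self i 2)).trans hi
    have hring : 10 * opCost w * (k + 1 + 1) = 10 * opCost w * (k + 1) + 10 * opCost w := by ring
    rw [hring]
    rw [pow_succ] at hik
    refine ⟨fun h => by omega, fun _ => ⟨fun h => ?_, fun h => ?_⟩⟩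
    · refine (ih (by omega) (i / 2) a hi2 (by omega) ha).mono ?_
      rintro t' d ⟨⟨ht', hl⟩, hd⟩
      refine ⟨⟨⟨_, _, rfl, ht', hb⟩, fun j hj => ?_⟩, by omega⟩
      rw [pow_succ] at hj
      rw [leaf, leaf]
      by_cases hji : j % 2 = 0
      · rw [if_pos hji, if_pos hji, hl _ (by omega)]
        exact if_congr (by omega) rfl rfl
      · rw [if_neg hji, if_neg hji, if_neg (by omega)]
    · refine (ih (by omega) (i / 2) b hi2 (by omega) hb).mono ?_
      rintro t' d ⟨⟨ht', hl⟩, hd⟩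
      refine ⟨⟨⟨_, _, rfl, ha, ht'⟩, fun j hj => ?_⟩, by omega⟩
      rw [pow_succ] at hj
      rw [leaf, leaf]
      by_cases hji : j % 2 = 0
      · rw [if_pos hji, if_pos hji, if_neg (by omega)]
      · rw [if_neg hji, if_neg hji, hl _ (by omega)]
        exact if_congr (by omega) rfl rfl

/-- Replacement of a coefficient. -/
theorem setFld_spec (w : ℕ) (hw : 2 ≤ w) (a : F) {k : ℕ} (hk : k ≤ w) {i : ℕ} {t : Val F}
    (hi : i < 2 ^ k) (ht : Full IsFld k t) :
    Cl prog 14 (.pair (.nat k) (.pair (.nat i) (.pair (.fld a) t))) fun t' d =>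
      (Full IsFld k t' ∧ tpoly t' = tpoly t + monomial i (a - (tpoly t).coeff i)) ∧
        d ≤ 10 * opCost w * (k + 1) := by
  have his : i.size ≤ w := (Nat.size_le.2 hi).trans hk
  refine (set_spec w hw IsFld (.fld a) ⟨a, rfl⟩ k hk i t his hi ht).mono ?_
  rintro t' d ⟨⟨ht', hl⟩, hd⟩
  refine ⟨⟨ht', ?_⟩, hd⟩
  ext j
  rw [coeff_add, coeff_monomial]
  rcases lt_or_ge j (2 ^ k) with hj | hj
  · have := hl j hj
    rw [leaf_eq_coeff k t' j ht' hj, leaf_eq_coeff k t j ht hj] at this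
    split_ifs at this with h
    · rw [if_pos h.symm, Val.fld.inj this, h, add_sub_cancel]
    · rw [if_neg (Ne.symm h), add_zero, Val.fld.inj this]
  · rw [tpoly_coeff_eq_zero ht' j hj, tpoly_coeff_eq_zero ht j hj, if_neg (by omega), add_zero]

/-- The tree is built with shared subtrees, in time polynomial in its depth. -/
theorem rep_spec (w : ℕ) (hw : 2 ≤ w) (Q : Val F → Prop) (v : Val F) (hv : Q v) (k : ℕ)
    (hk : k ≤ w) : Cl prog 12 (.pair (.nat k) v) fun t d =>
      (Full Q k t ∧ (v = .fld 0 → tpoly t = 0)) ∧ d ≤ 10 * opCost w * (k + 1) := by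
  have hK := le_opCost w
  have s1 := Nat.size_one
  have s0 := Nat.size_zero
  induction k with
  | zero =>
    refine Cl.intro rfl ?_
    dsimp only [repE, Sym, onSome, Val.onPair, Val.onNat, List.getElem?_cons_zero]
    exact ⟨fun _ => ⟨⟨hv, fun h => by rw [h, tpoly, C_0]⟩, by omega⟩, fun h => by omega⟩
  | succ k ih =>
    refine Cl.intro rfl ?_
    dsimp only [repE, Sym, onSome, Val.onPair, Val.onNat, NatOp.apply,
      List.getElem?_cons_zero, List.getElem?_cons_succ, Nat.add_one_sub_one]
    have hks : (k + 1).size ≤ w := size_le_of_le hk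
    have c1 : NatOp.cost .sub (k + 1) 1 ≤ opCost w := cost_le_opCost _ hks (by omega)
    have hring : 10 * opCost w * (k + 1 + 1) = 10 * opCost w * (k + 1) + 10 * opCost w := by ring
    rw [hring]
    refine ⟨fun h => by omega, fun _ => (ih (by omega)).mono ?_⟩
    rintro t d ⟨⟨ht, h0⟩, hd⟩
    refine ⟨⟨⟨_, _, rfl, ht, ht⟩, fun h => ?_⟩, by omega⟩
    rw [tpoly, h0 h, map_zero, mul_zero, add_zero]

/-- Truncation to degree less than `n`; the even half is truncated at `⌈n / 2⌉` and the odd half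
at `⌊n / 2⌋`. -/
theorem trunc_spec (w k : ℕ) : ∀ (n : ℕ) (u : Val F), n ≤ 2 ^ w → Full IsFld k u →
    Cl prog 11 (.pair (.nat n) u) fun t d =>
      (Full IsFld k t ∧ ∀ i, (tpoly t).coeff i = if i < n then (tpoly u).coeff i else 0) ∧
        d + 20 * opCost (w + 1) ≤ 40 * (opCost (w + 1) * 2 ^ k) := by
  have hK := le_opCost (w + 1)
  have s2 := size_two
  have s1 := Nat.size_one
  induction k with
  | zero =>
    rintro n u hn ⟨a, rfl⟩
    refine Cl.intro rfl ?_
    dsimp only [truncE, Sym, onSome, Val.onPair, Val.onNat, Val.split, NatOp.apply,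
      List.getElem?_cons_zero, List.getElem?_cons_succ]
    have := size_le_of_le_pow hn
    refine ⟨fun h => ⟨⟨⟨0, rfl⟩, fun i => ?_⟩, by omega⟩, fun h => ⟨⟨⟨a, rfl⟩, fun i => ?_⟩, by omega⟩⟩
    · rw [if_neg (by omega), tpoly, C_0, coeff_zero]
    · split_ifs with hi
      · rfl
      · rw [tpoly, coeff_C, if_neg (by omega)]
  | succ k ih =>
    rintro n u hn ⟨a, b, rfl, ha, hb⟩
    refine Cl.intro rfl ?_
    dsimp only [truncE, Sym, onSome, Val.onPair, Val.onNat, Val.split, NatOp.apply,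
      List.getElem?_cons_zero, List.getElem?_cons_succ]
    have hns := size_le_of_le_pow hn
    have c1 : NatOp.cost .add n 1 ≤ opCost (w + 1) := cost_le_opCost _ hns (by omega)
    have hn1 : 1 ≤ 2 ^ w := Nat.one_le_two_pow
    have c2 : NatOp.cost .div (n + 1) 2 ≤ 3 * opCost (w + 1) := by
      have : (n + 1).size ≤ w + 2 := (size_le_of_le_pow (w := w + 1) (by rw [pow_succ]; omega))
      simp only [NatOp.cost, s2, opCost]
      nlinarith
    have c3 : NatOp.cost .div n 2 ≤ 3 * opCost (w + 1) := by
      simp only [NatOp.cost, s2, opCost]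
      nlinarith
    refine (ih ((n + 1) / 2) a (by omega) ha).mono ?_
    rintro t₁ d₁ ⟨⟨ht₁, hc₁⟩, hd₁⟩
    refine (ih (n / 2) b (by omega) hb).mono ?_
    rintro t₂ d₂ ⟨⟨ht₂, hc₂⟩, hd₂⟩
    refine ⟨⟨⟨_, _, rfl, ht₁, ht₂⟩, fun i => ?_⟩, ?_⟩
    · rw [tpoly, tpoly, coeff_interleave, coeff_interleave, hc₁, hc₂]
      split_ifs <;> first | rfl | omega
    · rw [pow_succ]
      nlinarith

/-! ### Multiplication modulo `x ^ p - 1` -/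

theorem coeff_mul_eq_zero_of_le {R : Type u} [CommRing R] {f g : R[X]} {m n : ℕ}
    (hf : ∀ i, m ≤ i → f.coeff i = 0) (hg : ∀ i, n ≤ i → g.coeff i = 0) (i : ℕ)
    (hi : m + n ≤ i) : (f * g).coeff i = 0 := by
  rw [coeff_mul]
  refine Finset.sum_eq_zero fun x hx => ?_
  have hx := Finset.HasAntidiagonal.mem_antidiagonal.1 hx
  rcases le_or_gt m x.1 with h1 | h1
  · rw [hf _ h1, zero_mul]
  · rw [hg _ (by omega), mul_zero]

/-- Folding modulo `x ^ p - 1` by means of a rotation modulo `x ^ n + 1`: if `n` is large, the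
rotation by `2 n - p` moves the coefficients from `x ^ p` on down to `1`. -/
theorem fold_rotation {n p : ℕ} (hp : 0 < p) (hpn : 2 * p ≤ n) {c r t : F[X]}
    (hc : ∀ i, 2 * p ≤ i → c.coeff i = 0) (hr : ∀ i, n ≤ i → r.coeff i = 0)
    (hdvd : X ^ n + 1 ∣ X ^ (2 * n - p) * c - r)
    (ht : ∀ i, t.coeff i = if i < p then (c + r).coeff i else 0) : t = cyc p c := by
  obtain ⟨U, hU⟩ : ∃ U, c %ₘ X ^ p = U := ⟨_, rfl⟩
  obtain ⟨V, hV⟩ : ∃ V, c /ₘ X ^ p = V := ⟨_, rfl⟩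
  have hUV : U + X ^ p * V = c := by rw [← hU, ← hV]; exact modByMonic_add_div c _
  have hUc : ∀ i, p ≤ i → U.coeff i = 0 := by
    rw [← degree_lt_iff_coeff_zero, ← hU, ← degree_X_pow (R := F) p]
    exact degree_modByMonic_lt _ (monic_X_pow p)
  have hVc : ∀ i, p ≤ i → V.coeff i = 0 := by
    intro i hi
    have := hc (i + p) (by omega)
    rwa [← hUV, coeff_add, hUc _ (by omega), zero_add, coeff_X_pow_mul] at this
  have hrot : r = V - X ^ (n - p) * U := by
    have hm : (X ^ n + 1 : F[X]).Monic := by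
      have h := monic_X_pow_add_C (1 : F) (show n ≠ 0 by omega)
      rwa [C_1] at h
    have hdeg : (X ^ n + 1 : F[X]).degree = n := by
      have h := degree_X_pow_add_C (show 0 < n by omega) (1 : F)
      rwa [C_1] at h
    refine eq_of_monic_dvd_sub hm hdeg ?_ ((degree_lt_iff_coeff_zero _ _).2 hr)
      ((degree_lt_iff_coeff_zero _ _).2 fun i hi => ?_)
    · have h1 : X ^ n + 1 ∣ X ^ (2 * n - p) * c - (V - X ^ (n - p) * U) := by
        have e1 : (X : F[X]) ^ (2 * n - p) = X ^ n * X ^ (n - p) := by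
          rw [← pow_add]; congr 1; omega
        have e2 : (X : F[X]) ^ (n - p) * X ^ p = X ^ n := by
          rw [← pow_add]; congr 1; omega
        refine ⟨X ^ (n - p) * U + (X ^ n - 1) * V, ?_⟩
        rw [← hUV, e1]
        linear_combination X ^ n * V * e2
      have := h1.sub hdvd
      rwa [sub_sub_sub_cancel_left] at this
    · rw [coeff_sub, hVc i (by omega), coeff_X_pow_mul', hUc _ (by omega), ite_self, sub_zero]
  have htUV : t = U + V := by
    ext i
    rw [ht, coeff_add]
    split_ifs with hi
    · rw [← hUV, hrot, coeff_add, coeff_add, coeff_sub, coeff_X_pow_mul', coeff_X_pow_mul',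
        if_neg (by omega), if_neg (by omega)]
      ring
    · rw [coeff_add, hUc i (by omega), hVc i (by omega), add_zero]
  refine (cyc_eq_of_dvd hp ⟨V, ?_⟩ ((degree_lt_iff_coeff_zero _ _).2 fun i hi => ?_)).symm
  · rw [htUV, ← hUV]; ring
  · rw [ht, if_neg (by omega)]

/-- For residues of degree less than `p` the product modulo `x ^ (2 ^ k) + 1` is the product
itself, because `2 * p ≤ 2 ^ k`; it is then reduced by a rotation, an addition and a truncation.
-/
theorem cmul_spec {k p : ℕ} (h : (2 : F) ≠ 0 ∨ k < 3) (hp : 0 < p) (hpk : 2 * p ≤ 2 ^ k)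
    {u v : Val F} (hu : Full IsFld k u) (hv : Full IsFld k v)
    (hup : (tpoly u).degree < p) (hvp : (tpoly v).degree < p) :
    Cl prog 15 (.pair (.nat k) (.pair (.nat p) (.pair u v))) fun t d =>
      (Full IsFld k t ∧ tpoly t = cyc p (tpoly u * tpoly v)) ∧
        d ≤ 6000 * (2 ^ k * (k + 1) ^ 4) := by
  refine Cl.intro rfl ?_
  have s1 := Nat.size_one
  have hk1 : 1 ≤ k := by
    rcases k with _ | k
    · simp at hpk; omega
    · omega
  have hpow : 2 ^ (k + 1) = 2 * 2 ^ k := pow_succ' _ _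
  dsimp only [cmulE, Sym, onSome, Val.onPair, Val.onNat, Val.split, NatOp.apply,
    List.getElem?_cons_zero, List.getElem?_cons_succ]
  refine (smul_spec k h u v hu hv).mono ?_
  rintro c d₁ ⟨⟨hc, hcp⟩, hd₁⟩
  refine (powTwo_spec (k + 1)).mono ?_
  rintro _ d₂ ⟨rfl, hd₂⟩
  refine (rot_spec (k + 1) k (2 ^ (k + 1) - p) c (by omega) hc).mono ?_
  rintro r d₃ ⟨⟨hr, hrp⟩, hd₃⟩
  refine (add_spec k c r hc hr).mono ?_
  rintro a d₄ ⟨⟨ha, hap⟩, hd₄⟩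
  refine (trunc_spec k k p a (by omega) ha).mono ?_
  rintro t d₅ ⟨⟨ht, htc⟩, hd₅⟩
  rw [degree_lt_iff_coeff_zero] at hup hvp
  have huv := coeff_mul_eq_zero_of_le hup hvp
  have hprod : tpoly u * tpoly v = tpoly c := by
    have hm : (X ^ 2 ^ k + 1 : F[X]).Monic := by
      have h := monic_X_pow_add_C (1 : F) (show 2 ^ k ≠ 0 by positivity)
      rwa [C_1] at h
    have hdeg : (X ^ 2 ^ k + 1 : F[X]).degree = (2 ^ k : ℕ) := by
      have h := degree_X_pow_add_C (show 0 < 2 ^ k by positivity) (1 : F)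
      rwa [C_1] at h
    refine eq_of_monic_dvd_sub hm hdeg ?_ ((degree_lt_iff_coeff_zero _ _).2 fun i hi => ?_)
      (degree_tpoly_lt hc)
    · rw [← nval_eq_iff, map_mul]
      exact hcp
    · exact huv i (by omega)
  refine ⟨⟨ht, ?_⟩, ?_⟩
  · rw [hprod]
    refine fold_rotation hp hpk (fun i hi => ?_) (tpoly_coeff_eq_zero hr) ?_ fun i => ?_
    · rw [← hprod]; exact huv i (by omega)
    · rwa [← hpow]
    · rw [htc, hap]
  · have hks : (k + 1).size ≤ k + 1 := size_le_of_le le_rfl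
    have hks' : k.size ≤ k := size_le_of_le le_rfl
    have c1 : NatOp.cost .add k 1 ≤ opCost (k + 2) := cost_le_opCost _ (by omega) (by omega)
    have c2 : NatOp.cost .sub (2 ^ (k + 1)) p ≤ opCost (k + 2) :=
      cost_le_opCost _ (by rw [Nat.size_pow])
        ((size_le_of_le_pow (show p ≤ 2 ^ k by omega)).trans (by omega))
    have e1 : opCost (k + 1 + 2) ≤ 9 * (k + 1) ^ 2 := by
      have := Nat.pow_le_pow_left (show k + 1 + 2 + 2 ≤ 3 * (k + 1) by omega) 2
      rwa [mul_pow] at this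
    have e2 : opCost (k + 2) ≤ opCost (k + 1 + 2) := opCost_mono (by omega)
    have e3 : opCost (k + 1) ≤ opCost (k + 1 + 2) := opCost_mono (by omega)
    have e4 : opCost (k + 1 + 1) ≤ opCost (k + 1 + 2) := opCost_mono (by omega)
    have f1 : opCost (k + 1 + 2) * 2 ^ k ≤ 3 * (2 ^ k * (k + 1) ^ 4) := by
      calc _ ≤ 9 * (k + 1) ^ 2 * 2 ^ k := by gcongr
        _ ≤ 3 * (2 ^ k * ((k + 1) ^ 2 * (k + 1) ^ 2)) := by
          have : 2 ^ 2 ≤ (k + 1) ^ 2 := Nat.pow_le_pow_left (by omega) 2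
          have h3 : 3 * ((k + 1) ^ 2 * 2 ^ k) * 3 ≤ 3 * ((k + 1) ^ 2 * 2 ^ k) * (k + 1) ^ 2 := by
            gcongr; omega
          nlinarith
        _ = _ := by ring
    have f2 : opCost (k + 1 + 2) ≤ opCost (k + 1 + 2) * 2 ^ k :=
      Nat.le_mul_of_pos_right _ (by positivity)
    have f3 : opCost (k + 1 + 1) * 2 ^ k ≤ opCost (k + 1 + 2) * 2 ^ k := by gcongr
    have f4 : opCost (k + 1) * 2 ^ k ≤ opCost (k + 1 + 2) * 2 ^ k := by gcongr
    have f5 : 4 * opCost (k + 1 + 2) * 2 ^ (k + 1) = 8 * (opCost (k + 1 + 2) * 2 ^ k) := by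
      rw [hpow]; ring
    have f6 := le_opCost (k + 1 + 2)
    have f7 : 2 ^ k ≤ opCost (k + 1 + 2) * 2 ^ k := Nat.le_mul_of_pos_left _ (by omega)
    rw [f5] at hd₂
    omega

end

/-! ### Logarithms, powers and primes -/

section
variable {F : Type u} [Field F]

theorem len_spec (w : ℕ) (l : List (Val F)) (hl : l.length ≤ 2 ^ w) :
    Cl prog 19 (Val.list l) fun v d => v = .nat l.length ∧ d ≤ (w + 20) * (l.length + 1) := by
  have s1 := Nat.size_one
  have s0 := Nat.size_zero
  induction l with
  | nil =>
    refine Cl.intro rfl ?_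
    dsimp only [lenE, Sym, onSome, Val.onPair, Val.split, Val.list, List.getElem?_cons_zero]
    exact ⟨rfl, by rw [List.length_nil]; omega⟩
  | cons a l ih =>
    rw [List.length_cons] at hl
    refine Cl.intro rfl ?_
    dsimp only [lenE, Sym, onSome, Val.onPair, Val.onNat, Val.split, Val.list, NatOp.apply,
      NatOp.cost, List.getElem?_cons_zero]
    refine (ih (by omega)).mono ?_
    rintro _ d ⟨rfl, hd⟩
    have : l.length.size ≤ w := Nat.size_le.2 (by omega)
    refine ⟨by rw [List.length_cons, add_comm], ?_⟩
    rw [List.length_cons, show (w + 20) * (l.length + 1 + 1) = (w + 20) * (l.length + 1) + (w + 20)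
      by ring]
    omega

/-- The search for the binary logarithm of `v`, started at `j`, takes `n` steps if `j` is `n`
below it. -/
theorem clogAux_spec (w v : ℕ) (hv : v.size ≤ w) (n : ℕ) : ∀ j, Nat.clog 2 v = j + n →
    Cl prog 20 (.pair (.nat v) (.pair (.nat (2 ^ j)) (.nat j)) : Val F) fun r d =>
      r = .nat (Nat.clog 2 v) ∧ d ≤ 10 * (w + 5) * (n + 1) := by
  have s1 := Nat.size_one
  have s2 := size_two
  have hw : Nat.clog 2 v ≤ w :=
    (Nat.clog_le_iff_le_pow (by norm_num)).2 (Nat.size_le.1 hv).le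
  induction n with
  | zero =>
    intro j hj
    refine Cl.intro rfl ?_
    dsimp only [clogE, Sym, onSome, Val.onPair, Val.onNat, List.getElem?_cons_zero]
    refine ⟨fun h => ?_, fun h => ⟨by rw [hj, add_zero], ?_⟩⟩
    · have := (Nat.lt_clog_iff_pow_lt (by norm_num)).2 h
      omega
    · have : (2 ^ j).size = j + 1 := Nat.size_pow
      omega
  | succ n ih =>
    intro j hj
    refine Cl.intro rfl ?_
    dsimp only [clogE, Sym, onSome, Val.onPair, Val.onNat, NatOp.apply, NatOp.cost,
      List.getElem?_cons_zero]
    refine ⟨fun h => ?_, fun h => ?_⟩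
    · rw [← pow_succ']
      refine (ih (j + 1) (by omega)).mono ?_
      rintro r d ⟨rfl, hd⟩
      refine ⟨rfl, ?_⟩
      have : (2 ^ j).size = j + 1 := Nat.size_pow
      have := size_le_of_le (le_refl j)
      have e1 : (Nat.size 2 + 1) * ((2 ^ j).size + 1) = 3 * (j + 2) := by
        rw [s2, Nat.size_pow]
      rw [e1, show 10 * (w + 5) * (n + 1 + 1) = 10 * (w + 5) * (n + 1) + 10 * (w + 5) by ring]
      omega
    · exact absurd ((Nat.lt_clog_iff_pow_lt (by norm_num)).1 (show j < Nat.clog 2 v by omega)) h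

theorem clog_spec (w v : ℕ) (hv : v.size ≤ w) :
    Cl prog 20 (.pair (.nat v) (.pair (.nat 1) (.nat 0)) : Val F) fun r d =>
      r = .nat (Nat.clog 2 v) ∧ d ≤ 10 * (w + 5) * (w + 1) := by
  refine (clogAux_spec w v hv (Nat.clog 2 v) 0 (by rw [zero_add])).mono ?_
  rintro r d ⟨rfl, hd⟩
  refine ⟨rfl, hd.trans ?_⟩
  have hw : Nat.clog 2 v ≤ w :=
    (Nat.clog_le_iff_le_pow (by norm_num)).2 (Nat.size_le.1 hv).le
  gcongr

theorem size_pow_le (D n : ℕ) : (D ^ n).size ≤ n * D.size + 1 := by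
  rw [Nat.size_le]
  calc D ^ n ≤ (2 ^ D.size) ^ n := Nat.pow_le_pow_left (Nat.lt_size_self D).le n
    _ = 2 ^ (n * D.size) := by rw [← pow_mul, mul_comm]
    _ < _ := Nat.pow_lt_pow_right (by norm_num) (by omega)

theorem pow_spec (D N : ℕ) (hD : 1 ≤ D.size) (n : ℕ) (hn : n ≤ N) :
    Cl prog 21 (.pair (.nat D) (.nat n) : Val F) fun r d =>
      r = .nat (D ^ n) ∧ d ≤ 20 * ((D.size + 1) * (N * D.size + 2)) * (n + 1) := by
  have s1 := Nat.size_one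
  have hN : N * D.size ≥ N := Nat.le_mul_of_pos_right _ hD
  have hA : 2 * (N * D.size + 2) ≤ (D.size + 1) * (N * D.size + 2) :=
    Nat.mul_le_mul_right _ (by omega)
  have hns := size_le_of_le (le_refl n)
  induction n with
  | zero =>
    refine Cl.intro rfl ?_
    dsimp only [powE, Sym, onSome, Val.onPair, Val.onNat, List.getElem?_cons_zero]
    exact ⟨fun _ => ⟨by rw [pow_zero], by omega⟩, fun h => by omega⟩
  | succ n ih =>
    refine Cl.intro rfl ?_
    dsimp only [powE, Sym, onSome, Val.onPair, Val.onNat, NatOp.apply, NatOp.cost,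
      Nat.add_one_sub_one, List.getElem?_cons_zero]
    refine ⟨fun h => by omega, fun _ => (ih (by omega) (size_le_of_le le_rfl)).mono ?_⟩
    rintro _ d ⟨rfl, hd⟩
    refine ⟨by rw [pow_succ'], ?_⟩
    have h1 : (D.size + 1) * ((D ^ n).size + 1) ≤ (D.size + 1) * (N * D.size + 2) := by
      refine Nat.mul_le_mul_left _ ?_
      have := size_pow_le D n
      have : n * D.size ≤ N * D.size := Nat.mul_le_mul_right _ (by omega)
      omega
    rw [show 20 * ((D.size + 1) * (N * D.size + 2)) * (n + 1 + 1) =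
      20 * ((D.size + 1) * (N * D.size + 2)) * (n + 1) + 20 * ((D.size + 1) * (N * D.size + 2))
      by ring]
    have hns' := size_le_of_le (le_refl (n + 1))
    omega

/-- Trial division of `c` by the `n` numbers from `d` up to `c - 1`. -/
theorem trial_spec (w c : ℕ) (hw : 2 ≤ w) (hc : c.size ≤ w) (n : ℕ) :
    ∀ d, 2 ≤ d → d ≤ c → c = d + n →
    Cl prog 22 (.pair (.nat c) (.nat d) : Val F) fun r k =>
      (∃ b, r = .nat b ∧ b ≤ 1 ∧ (b = 1 ↔ ∀ m, d ≤ m → m < c → ¬ m ∣ c)) ∧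
        k ≤ 10 * opCost w * (n + 1) := by
  have hK := le_opCost w
  have s1 := Nat.size_one
  have s0 := Nat.size_zero
  induction n with
  | zero =>
    intro d hd hdc h
    have hds : d.size ≤ w := (Nat.size_le_size hdc).trans hc
    refine Cl.intro rfl ?_
    dsimp only [trialE, Sym, onSome, Val.onPair, Val.onNat, NatOp.apply, List.getElem?_cons_zero]
    refine ⟨fun h => by omega, fun _ => ⟨⟨1, rfl, le_rfl, by simp; intros; omega⟩, by omega⟩⟩
  | succ n ih =>
    intro d hd hdc h
    have hds : d.size ≤ w := (Nat.size_le_size hdc).trans hc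
    have c1 : NatOp.cost .mod c d ≤ opCost w := cost_le_opCost _ hc hds
    have c2 : NatOp.cost .add d 1 ≤ opCost w := cost_le_opCost _ hds (by omega)
    have hm : (c % d).size ≤ w :=
      (Nat.size_le_size (Nat.mod_le c d)).trans hc
    have hring : 10 * opCost w * (n + 1 + 1) = 10 * opCost w * (n + 1) + 10 * opCost w := by ring
    rw [hring]
    refine Cl.intro rfl ?_
    dsimp only [trialE, Sym, onSome, Val.onPair, Val.onNat, NatOp.apply, List.getElem?_cons_zero]
    refine ⟨fun _ => ⟨fun h0 => ⟨⟨0, rfl, by omega, ?_⟩, by omega⟩, fun h0 => ?_⟩,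
      fun h => by omega⟩
    · simp only [zero_ne_one, false_iff, not_forall, not_not]
      exact ⟨d, le_rfl, by omega, Nat.dvd_of_mod_eq_zero (by omega)⟩
    · refine (ih (d + 1) (by omega) (by omega) (by omega)).mono ?_
      rintro r k ⟨⟨b, rfl, hb, hiff⟩, hk⟩
      refine ⟨⟨b, rfl, hb, ?_⟩, by omega⟩
      rw [hiff]
      constructor
      · intro h m hm1 hm2
        rcases Nat.eq_or_lt_of_le hm1 with rfl | hlt
        · exact fun hdvd => h0 (by rw [Nat.mod_eq_zero_of_dvd hdvd]; omega)
        · exact h m hlt hm2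
      · intro h m hm1 hm2
        exact h m (by omega) hm2

/-- The search for `n` primes, started at `c`, ends below a bound `B` on these primes. The measure
of the recursion is `B - c`. -/
theorem primes_spec (w B : ℕ) (hw : 2 ≤ w) (hB : B < 2 ^ w) (m : ℕ) :
    ∀ c n, 2 ≤ c → B = c + m → n.size ≤ w → (∀ i < Nat.count Nat.Prime c + n, pr i < B) →
    Cl prog 23 (.pair (.nat c) (.nat n) : Val F) fun r d =>
      r = Val.list ((List.range n).map fun i => .nat (pr (Nat.count Nat.Prime c + i))) ∧
        d ≤ 20 * opCost w * (B + 1) * (m + 1) := by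
  have hK := le_opCost w
  have s1 := Nat.size_one
  have s0 := Nat.size_zero
  have s2 := size_two
  induction m with
  | zero =>
    intro c n hc hBc hns hpr
    refine Cl.intro rfl ?_
    dsimp only [primesE, Sym, onSome, Val.onPair, Val.onNat, NatOp.apply, List.getElem?_cons_zero]
    rcases n with _ | n
    · refine ⟨fun _ => ⟨rfl, ?_⟩, fun h => by omega⟩
      have : opCost w ≤ opCost w * (B + 1) := Nat.le_mul_of_pos_right _ (by omega)
      nlinarith
    · exfalso
      have h1 := hpr (Nat.count Nat.Prime c) (by omega)
      have h2 : c ≤ Nat.nth Nat.Prime (Nat.count Nat.Prime c) :=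
        Nat.le_nth_count Nat.infinite_setOfPred_prime c
      unfold pr at h1
      omega
  | succ m ih =>
    intro c n hc hBc hns hpr
    have hcs : c.size ≤ w := Nat.size_le.2 (by omega)
    have c1 : NatOp.cost .add c 1 ≤ opCost w := cost_le_opCost _ hcs (by omega)
    have c2 : NatOp.cost .sub n 1 ≤ opCost w := cost_le_opCost _ hns (by omega)
    have e1 : 20 * opCost w * (B + 1) * (m + 1 + 1) =
      20 * opCost w * (B + 1) * (m + 1) + 20 * (opCost w * (B + 1)) := by ring
    have e2 : opCost w ≤ opCost w * (B + 1) := Nat.le_mul_of_pos_right _ (by omega)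
    rw [e1]
    refine Cl.intro rfl ?_
    dsimp only [primesE, Sym, onSome, Val.onPair, Val.onNat, NatOp.apply, List.getElem?_cons_zero]
    refine ⟨fun h => ⟨?_, by omega⟩, fun hn => ?_⟩
    · obtain rfl : n = 0 := by omega
      rfl
    · refine (trial_spec w c hw hcs (c - 2) 2 le_rfl hc (by omega)).mono ?_
      rintro _ k ⟨⟨b, rfl, hb, hiff⟩, hk⟩
      have hbs : b.size ≤ 1 := size_le_of_le hb
      have hk' : k ≤ 10 * (opCost w * (B + 1)) := by
        refine hk.trans ?_
        rw [mul_assoc]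
        gcongr
        omega
      have hprime : b = 1 ↔ c.Prime := by
        rw [hiff, Nat.prime_def_lt']
        exact ⟨fun h => ⟨hc, h⟩, fun h => h.2⟩
      refine ⟨fun h => ?_, fun h => ?_⟩
      · have hnp : ¬ c.Prime := fun hp => by rw [← hprime] at hp; omega
        have hcount : Nat.count Nat.Prime (c + 1) = Nat.count Nat.Prime c := by
          rw [Nat.count_succ, if_neg hnp, add_zero]
        refine (ih (c + 1) n (by omega) (by omega) hns (by rwa [hcount])).mono ?_
        rintro _ d ⟨rfl, hd⟩
        exact ⟨by rw [hcount], by omega⟩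
      · have hp : c.Prime := hprime.1 (by omega)
        have hcount : Nat.count Nat.Prime (c + 1) = Nat.count Nat.Prime c + 1 := by
          rw [Nat.count_succ, if_pos hp]
        have hn1 : (n - 1).size ≤ w := (Nat.size_le_size (by omega)).trans hns
        refine (ih (c + 1) (n - 1) (by omega) (by omega) hn1
          (fun i hi => hpr i (by omega))).mono ?_
        rintro _ d ⟨rfl, hd⟩
        refine ⟨?_, by omega⟩
        obtain ⟨n, rfl⟩ : ∃ m, n = m + 1 := ⟨n - 1, by omega⟩
        rw [List.range_succ_eq_map, List.map_cons, List.map_map, Nat.add_one_sub_one, Val.list,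
          add_zero, pr, Nat.nth_count hp, hcount]
        congr 3
        funext i
        simp only [Function.comp]
        congr 2
        omega

end

/-! ### Evaluation of straight-line programs modulo `x ^ p - 1` -/

section
variable {F : Type u} [Field F]

/-- A pair of trees of depth `k` that denote the images modulo `x ^ p - 1` of `g` and of the Euler
derivative `x g'`. Unlike the derivative, `x g'` has the same exponents as `g`. -/
def IsImg (k p : ℕ) (g : F[X]) (v : Val F) : Prop :=
  ∃ u u', v = .pair u u' ∧ Full IsFld k u ∧ Full IsFld k u' ∧ tpoly u = cyc p g ∧
    tpoly u' = cyc p (X * derivative g)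

/-- Parameters for computations modulo `x ^ p - 1`: the depth `κ` of the tree of registers, the
depth `k` of the trees that denote polynomials, and the zero tree `z`. -/
structure EvalParams (F : Type u) [Field F] (w κ k p : ℕ) (z : Val F) : Prop where
  hw : 2 ≤ w
  hκ : κ ≤ w
  hk : k ≤ w
  hp : 2 ≤ p
  hpk : 2 * p ≤ 2 ^ k
  h2 : (2 : F) ≠ 0 ∨ k < 3
  hz : Full IsFld k z
  hz0 : tpoly z = 0

/-- The parameters as a value. -/
def paramVal (κ k p : ℕ) (z : Val F) : Val F :=
  .pair (.nat κ) (.pair (.nat k) (.pair (.nat p) z))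

theorem cyc_mul_cyc {p : ℕ} (hp : 0 < p) (f g : F[X]) :
    cyc p (cyc p f * cyc p g) = cyc p (f * g) := by
  refine (cyc_congr hp ?_).symm
  convert ((dvd_sub_cyc p f).mul_right g).add ((dvd_sub_cyc p g).mul_left (cyc p f)) using 1
  ring

/-- An operand is replaced by its image: the class of `x` has the Euler derivative `x`, and a
constant has the Euler derivative zero. -/
theorem operand_spec {w κ k p : ℕ} {z : Val F} (hP : EvalParams F w κ k p z) {regs : Val F}
    {b : List F[X]} (hregs : Full (fun _ => True) κ regs) (hb : b.length ≤ 2 ^ κ)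
    (hreg : ∀ j < b.length, IsImg k p (b.getD j 0) (leaf κ regs j)) (o : Operand F)
    (ho : o.Allowed b.length) :
    Cl prog 16 (.pair (.pair (paramVal κ k p z) regs) o.code) fun v d =>
      IsImg k p (o.value b) v ∧ d ≤ 30 * (opCost w * (w + 1)) := by
  obtain ⟨hw, hκ, hk, hp, hpk, h2, hz, hz0⟩ := hP
  have hK := le_opCost w
  have s1 := Nat.size_one
  have s0 := Nat.size_zero
  have hp0 : 0 < p := by omega
  have hmono : ∀ n, n ≤ w → 10 * opCost w * (n + 1) ≤ 10 * (opCost w * (w + 1)) := by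
    intro n hn
    rw [mul_assoc]
    gcongr
  have hK' : opCost w ≤ opCost w * (w + 1) := Nat.le_mul_of_pos_right _ (by omega)
  refine Cl.intro rfl ?_
  cases o with
  | input =>
    dsimp only [operandE, Operand.code, paramVal, Sym, onSome, Val.onPair, Val.onNat, Val.split,
      List.getElem?_cons_zero, List.getElem?_cons_succ]
    refine (setFld_spec w hw (1 : F) hk (i := 1) (by omega) hz).mono ?_
    rintro v d ⟨⟨hv, hvp⟩, hd⟩
    have hX : tpoly v = cyc p (X : F[X]) := by
      rw [hvp, hz0, coeff_zero, sub_zero, zero_add, cyc_eq_self hp0]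
      · rfl
      · rw [degree_X]; exact_mod_cast hp
    have := hmono k hk
    exact ⟨⟨v, v, rfl, hv, hv, hX, by rw [Operand.value, derivative_X, mul_one, hX]⟩, by omega⟩
  | reg j =>
    dsimp only [operandE, Operand.code, paramVal, Sym, onSome, Val.onPair, Val.onNat, Val.split,
      List.getElem?_cons_zero, List.getElem?_cons_succ]
    have hj : j < b.length := ho
    have hjs : j.size ≤ w := (Nat.size_le.2 (by omega)).trans hκ
    refine ⟨fun _ => (get_spec w hw _ κ hκ j regs hjs hregs).mono ?_, fun h => by omega⟩
    rintro v d ⟨rfl, hd⟩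
    have := hmono κ hκ
    exact ⟨hreg j hj, by omega⟩
  | const c =>
    dsimp only [operandE, Operand.code, paramVal, Sym, onSome, Val.onPair, Val.onNat, Val.split,
      List.getElem?_cons_zero, List.getElem?_cons_succ]
    refine ⟨fun h => by omega, fun _ => (setFld_spec w hw c hk (i := 0) (by omega) hz).mono ?_⟩
    rintro v d ⟨⟨hv, hvp⟩, hd⟩
    have := hmono k hk
    refine ⟨⟨v, z, rfl, hv, hz, ?_, ?_⟩, by omega⟩
    · rw [hvp, hz0, coeff_zero, sub_zero, zero_add, Operand.value, monomial_zero_left,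
        cyc_eq_self hp0]
      exact lt_of_le_of_lt degree_C_le (by exact_mod_cast hp0)
    · rw [hz0, Operand.value, derivative_C, mul_zero, cyc_zero hp0]

/-- The bit operations charged for one instruction of a straight-line program. -/
def instrCost (w k : ℕ) : ℕ := 100 * (opCost w * (w + 1)) + 20000 * (2 ^ k * (k + 1) ^ 4)

/-- The images of the operands determine the image of the result; for products this is the Leibniz
rule. -/
theorem instr_spec {w κ k p : ℕ} {z : Val F} (hP : EvalParams F w κ k p z) {regs : Val F}
    {b : List F[X]} (hregs : Full (fun _ => True) κ regs) (hb : b.length ≤ 2 ^ κ)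
    (hreg : ∀ j < b.length, IsImg k p (b.getD j 0) (leaf κ regs j)) (s : Instr F)
    (hs : s.lhs.Allowed b.length ∧ s.rhs.Allowed b.length) :
    Cl prog 17 (.pair (.pair (paramVal κ k p z) regs) s.code) fun v d =>
      IsImg k p (s.value b) v ∧ d + 10 * opCost w ≤ instrCost w k := by
  obtain ⟨op, lhs, rhs⟩ := s
  have hK := le_opCost w
  have s1 := Nat.size_one
  have s0 := Nat.size_zero
  have s2 := size_two
  have hp0 : 0 < p := by have := hP.hp; omega
  have hw := hP.hw
  have hK' : opCost w ≤ opCost w * (w + 1) := Nat.le_mul_of_pos_right _ (by omega)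
  have hK2 : 3 * opCost w ≤ opCost w * (w + 1) := by
    rw [mul_comm]; exact Nat.mul_le_mul_left _ (by omega)
  have hB : 2 ^ k ≤ 2 ^ k * (k + 1) ^ 4 := Nat.le_mul_of_pos_right _ (by positivity)
  refine Cl.intro rfl ?_
  dsimp only [instrE, Instr.code, Sym, onSome, Val.onPair, Val.onNat, Val.split,
      List.getElem?_cons_zero, List.getElem?_cons_succ]
  refine (operand_spec hP hregs hb hreg lhs hs.1).mono ?_
  rintro _ d₁ ⟨⟨u, u', rfl, hu, hu', hup, hup'⟩, hd₁⟩
  refine (operand_spec hP hregs hb hreg rhs hs.2).mono ?_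
  rintro _ d₂ ⟨⟨v, v', rfl, hv, hv', hvp, hvp'⟩, hd₂⟩
  unfold instrCost
  cases op with
  | add =>
    dsimp only [ArithOp.code]
    refine ⟨fun _ => (add_spec k u v hu hv).mono ?_, fun h => by omega⟩
    rintro t d₃ ⟨⟨ht, htp⟩, hd₃⟩
    refine (add_spec k u' v' hu' hv').mono ?_
    rintro t' d₄ ⟨⟨ht', htp'⟩, hd₄⟩
    refine ⟨⟨t, t', rfl, ht, ht', ?_, ?_⟩, by omega⟩
    · rw [htp, hup, hvp, ← cyc_add]; rfl
    · rw [htp', hup', hvp', ← cyc_add, ← mul_add, ← derivative_add]; rfl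
  | sub =>
    dsimp only [ArithOp.code]
    refine ⟨fun h => by omega, fun _ => ⟨fun _ => (sub_spec hu hv).mono ?_, fun h => by omega⟩⟩
    rintro t d₃ ⟨⟨ht, htp⟩, hd₃⟩
    refine (sub_spec hu' hv').mono ?_
    rintro t' d₄ ⟨⟨ht', htp'⟩, hd₄⟩
    refine ⟨⟨t, t', rfl, ht, ht', ?_, ?_⟩, by omega⟩
    · rw [htp, hup, hvp, ← cyc_sub]; rfl
    · rw [htp', hup', hvp', ← cyc_sub, ← mul_sub, ← derivative_sub]; rfl
  | mul =>
    dsimp only [ArithOp.code, paramVal]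
    have hdeg : ∀ {a : Val F} {g : F[X]}, tpoly a = cyc p g → (tpoly a).degree < p :=
      fun h => by rw [h]; exact degree_cyc_lt hp0 _
    refine ⟨fun h => by omega, fun _ => ⟨fun h => by omega, fun _ => ?_⟩⟩
    refine (cmul_spec hP.h2 hp0 hP.hpk hu hv (hdeg hup) (hdeg hvp)).mono ?_
    rintro t d₃ ⟨⟨ht, htp⟩, hd₃⟩
    refine (cmul_spec hP.h2 hp0 hP.hpk hu hv' (hdeg hup) (hdeg hvp')).mono ?_
    rintro t₁ d₄ ⟨⟨ht₁, htp₁⟩, hd₄⟩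
    refine (cmul_spec hP.h2 hp0 hP.hpk hu' hv (hdeg hup') (hdeg hvp)).mono ?_
    rintro t₂ d₅ ⟨⟨ht₂, htp₂⟩, hd₅⟩
    refine (add_spec k t₁ t₂ ht₁ ht₂).mono ?_
    rintro t' d₆ ⟨⟨ht', htp'⟩, hd₆⟩
    refine ⟨⟨t, t', rfl, ht, ht', ?_, ?_⟩, by omega⟩
    · rw [htp, hup, hvp, cyc_mul_cyc hp0]; rfl
    · rw [htp', htp₁, htp₂, hup, hvp', hup', hvp, cyc_mul_cyc hp0, cyc_mul_cyc hp0, ← cyc_add]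
      congr 1
      change _ = X * derivative (lhs.value b * rhs.value b)
      rw [derivative_mul]
      ring

/-- The invariant of the evaluation: the register with index `j` holds the image of the result
`b_j`. -/
theorem run_spec {w κ k p : ℕ} {z : Val F} (hP : EvalParams F w κ k p z) (l : List (Instr F))
    (hl : l ≠ []) : ∀ (regs : Val F) (b : List F[X]), Full (fun _ => True) κ regs →
    b.length + l.length ≤ 2 ^ κ →
    (∀ j < b.length, IsImg k p (b.getD j 0) (leaf κ regs j)) →
    (∀ (i : ℕ) (hi : i < l.length),
      (l[i]).lhs.Allowed (b.length + i) ∧ (l[i]).rhs.Allowed (b.length + i)) →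
    Cl prog 18 (.pair (.pair (paramVal κ k p z) regs)
        (.pair (.nat b.length) (Val.list (l.map Instr.code)))) fun v d =>
      IsImg k p ((l.foldl (fun b s => b ++ [s.value b]) b).getLastD 0) v ∧
        d ≤ 2 * instrCost w k * l.length := by
  have hK := le_opCost w
  have s1 := Nat.size_one
  have hw := hP.hw
  have hic : 100 * (opCost w * (w + 1)) ≤ instrCost w k := Nat.le_add_right _ _
  have hK' : opCost w ≤ opCost w * (w + 1) := Nat.le_mul_of_pos_right _ (by omega)
  induction l with
  | nil => exact absurd rfl hl
  | cons s l ih =>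
    intro regs b hregs hlen hreg hall
    rw [List.length_cons] at hlen
    refine Cl.intro rfl ?_
    dsimp only [runE, List.map_cons, Val.list, Sym, onSome, Val.onPair, Val.onNat, Val.split,
      NatOp.apply, List.getElem?_cons_zero, List.getElem?_cons_succ]
    refine (instr_spec hP hregs (by omega) hreg s (hall 0 (by simp))).mono ?_
    rintro v d ⟨hv, hd⟩
    cases l with
    | nil =>
      refine ⟨?_, ?_⟩
      · simpa using hv
      · rw [List.length_cons, List.length_nil]
        omega
    | cons s' l =>
      dsimp only [List.map_cons, Val.list, paramVal]
      have hbs : b.length.size ≤ w :=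
        (Nat.size_le.2 (by rw [List.length_cons] at hlen; omega)).trans hP.hκ
      have c1 : NatOp.cost .add b.length 1 ≤ opCost w := cost_le_opCost _ hbs (by omega)
      have hset : 10 * opCost w * (κ + 1) ≤ 10 * (opCost w * (w + 1)) := by
        rw [mul_assoc]; gcongr; exact hP.hκ
      refine (set_spec w hw (fun _ => True) v trivial κ hP.hκ b.length regs hbs
        (by rw [List.length_cons] at hlen; omega) hregs).mono ?_
      rintro regs' d₂ ⟨⟨hregs', hleaf⟩, hd₂⟩
      have := ih (by simp) regs' (b ++ [s.value b]) hregs'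
        (by rw [List.length_append, List.length_singleton]; omega) ?_ ?_
      · rw [List.length_append, List.length_singleton] at this
        refine this.mono ?_
        rintro r d₃ ⟨hr, hd₃⟩
        refine ⟨hr, ?_⟩
        rw [List.length_cons, mul_add_one]
        omega
      · intro j hj
        rw [List.length_append, List.length_singleton] at hj
        rw [hleaf j (by rw [List.length_cons] at hlen; omega)]
        split_ifs with hjb
        · subst hjb
          rw [List.getD_append_right _ _ _ _ le_rfl, Nat.sub_self]
          exact hv
        · rw [List.getD_append _ _ _ _ (by omega)]
          exact hreg j (by omega)
      · intro i hi
        have := hall (i + 1) (by rw [List.length_cons]; omega)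
        rw [List.length_append, List.length_singleton, add_assoc, add_comm 1 i]
        exact this

/-- An entry of the table of images: the prime `p`, the depth `k` and the images of `r` and
`x r'` modulo `x ^ p - 1`, in trees that have an address for every residue of an exponent. -/
def IsEntry (w D p : ℕ) (r : F[X]) (e : Val F) : Prop :=
  ∃ k v, e = .pair (.nat p) (.pair (.nat k) v) ∧ IsImg k p r v ∧ k ≤ w ∧ 2 ^ k ≤ 4 * p ∧
    ∀ d < D, d % p < 2 ^ k

theorem two_ne_zero_of_le_ringChar {D : ℕ} (hD : D ≤ ringChar F) (h : 3 ≤ D) : (2 : F) ≠ 0 := by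
  intro h0
  have h1 : ringChar F ∣ 2 := ringChar.dvd (by exact_mod_cast h0)
  have := Nat.le_of_dvd (by norm_num) h1
  omega

theorem degree_X_mul_derivative_lt {f : F[X]} {n : ℕ} (h : f.degree < (n : WithBot ℕ)) :
    (X * derivative f).degree < (n : WithBot ℕ) := by
  rw [degree_lt_iff_coeff_zero] at h ⊢
  intro i hi
  rcases i with _ | i
  · simp
  · rw [coeff_X_mul, coeff_derivative, h _ hi, zero_mul]

/-- The depth of the trees used for computations modulo `x ^ q - 1`: products fit, and at most a
constant factor is lost. -/
theorem two_pow_clog_le {q : ℕ} (hq : 2 ≤ q) :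
    2 * q ≤ 2 ^ Nat.clog 2 (2 * q) ∧ 2 ^ Nat.clog 2 (2 * q) ≤ 4 * q := by
  refine ⟨Nat.le_pow_clog (by norm_num) _, ?_⟩
  have h1 := Nat.pow_pred_clog_lt_self (b := 2) (by norm_num) (x := 2 * q) (by omega)
  have h2 : 0 < Nat.clog 2 (2 * q) := Nat.clog_pos (by norm_num) (by omega)
  rw [← Nat.succ_pred_eq_of_pos h2, Nat.pow_succ]
  omega

theorem instrCost_le {w k q : ℕ} (hq : 0 < q) (hk : k ≤ w) (h : 2 ^ k ≤ 4 * q) :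
    instrCost w k ≤ 80100 * (q * (w + 2) ^ 4) := by
  have h1 : 2 ^ k * (k + 1) ^ 4 ≤ 4 * q * (w + 2) ^ 4 := by gcongr; omega
  have h2 : opCost w * (w + 1) ≤ q * (w + 2) ^ 4 := by
    calc opCost w * (w + 1) ≤ (w + 2) ^ 2 * (w + 2) ^ 2 := by
          unfold opCost; gcongr; nlinarith
      _ = (w + 2) ^ 4 := by ring
      _ ≤ _ := Nat.le_mul_of_pos_left _ hq
  unfold instrCost
  rw [mul_assoc] at h1
  omega

theorem four_mul_sq_le (w : ℕ) : 4 * (w + 2) ^ 2 ≤ (w + 2) ^ 4 := by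
  have h : 2 ^ 2 ≤ (w + 2) ^ 2 := Nat.pow_le_pow_left (by omega) 2
  rw [show (w + 2) ^ 4 = (w + 2) ^ 2 * (w + 2) ^ 2 by ring]
  exact Nat.mul_le_mul_right _ h

theorem clogCost_le (w : ℕ) : 10 * (w + 1 + 5) * (w + 1 + 1) ≤ 30 * (w + 2) ^ 2 ∧
    10 * (w + 5) * (w + 1) ≤ 30 * (w + 2) ^ 2 ∧ w + 20 ≤ 5 * (w + 2) ^ 2 := by
  refine ⟨?_, ?_, ?_⟩ <;> nlinarith

theorem opCost_mul_le {w n : ℕ} (hn : n ≤ w) : 2 * (opCost w * (n + 1)) ≤ (w + 2) ^ 4 := by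
  have h : 2 * (w + 2) ≤ (w + 2) ^ 2 := by nlinarith
  calc 2 * (opCost w * (n + 1)) = (w + 2) ^ 2 * (2 * (n + 1)) := by unfold opCost; ring
    _ ≤ (w + 2) ^ 2 * (w + 2) ^ 2 := by gcongr; omega
    _ = (w + 2) ^ 4 := by ring

/-- The entry of `p` for the polynomial computed by a straight-line program. Fast multiplication
divides by two, which is impossible in characteristic two; then `D ≤ 2`, the polynomial is linear,
its residues modulo `x ^ 2 - 1` and `x ^ p - 1` coincide, and trees of depth two suffice. -/
theorem entry_spec (S : SLP F) {w D p : ℕ} (hD : S.poly.natDegree < D) (hDF : D ≤ ringChar F)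
    (hp : 2 ≤ p) (hw : 4 * p ≤ 2 ^ w) (hL : S.length ≤ 2 ^ w) :
    Cl prog 24 (.pair (.nat p) (.pair (.nat D) (Val.list (S.instrs.map Instr.code)))) fun e d =>
      IsEntry w D p S.poly e ∧
        d ≤ 2 * D.size + 200000 * (S.length * (p * (w + 2) ^ 4)) := by
  have s0 := Nat.size_zero
  have s1 := Nat.size_one
  have s2 := size_two
  have s3 := size_three
  obtain ⟨q, hqdef⟩ : ∃ q, q = if D < 3 then 2 else p := ⟨_, rfl⟩
  have hq : 2 ≤ q := by split_ifs at hqdef <;> omega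
  have hqp : q ≤ p := by split_ifs at hqdef <;> omega
  obtain ⟨hk1, hk2⟩ := two_pow_clog_le hq
  have hLpos : 0 < S.length := List.length_pos_iff.2 S.ne_nil
  have hw2 : 2 ≤ w := by
    by_contra h
    have : 2 ^ w ≤ 2 ^ 1 := Nat.pow_le_pow_right (by norm_num) (by omega)
    omega
  have hkw : Nat.clog 2 (2 * q) ≤ w :=
    (Nat.clog_le_iff_le_pow (by norm_num)).2 (by omega)
  have hκw : Nat.clog 2 S.length ≤ w := (Nat.clog_le_iff_le_pow (by norm_num)).2 hL
  have hκ : S.length ≤ 2 ^ Nat.clog 2 S.length := Nat.le_pow_clog (by norm_num) _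
  have hps : p.size ≤ w := Nat.size_le.2 (by omega)
  have hqs : q.size ≤ w := Nat.size_le.2 (by omega)
  have hqs' : (2 * q).size ≤ w := Nat.size_le.2 (by omega)
  have hLs : S.length.size ≤ w + 1 := Nat.size_le.2 (by rw [pow_succ]; omega)
  have hcost := instrCost_le (by omega) hkw hk2
  have hpos : ∀ x, x ≤ p * x := fun x => Nat.le_mul_of_pos_left _ (by omega)
  have hcost' : q * (w + 2) ^ 4 ≤ p * (w + 2) ^ 4 := Nat.mul_le_mul_right _ hqp
  have hu := four_mul_sq_le w
  have hpu := hpos ((w + 2) ^ 4)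
  have c1 : NatOp.cost .mul 2 q ≤ opCost w := cost_le_opCost _ (by omega) hqs
  have hrep : ∀ n ≤ w, 10 * opCost w * (n + 1) ≤ 5 * (w + 2) ^ 4 := by
    intro n hn
    have := opCost_mul_le hn
    rw [mul_assoc]
    omega
  obtain ⟨hclog, hclog', h5⟩ := clogCost_le w
  have hlen : (w + 20) * (S.length + 1) ≤ 10 * (S.length * (p * (w + 2) ^ 4)) := by
    calc _ ≤ 5 * (p * (w + 2) ^ 4) * (2 * S.length) :=
          Nat.mul_le_mul (by omega) (by omega)
      _ = _ := by ring
  have hG : p * (w + 2) ^ 4 ≤ S.length * (p * (w + 2) ^ 4) := Nat.le_mul_of_pos_left _ hLpos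
  have ho : opCost w = (w + 2) ^ 2 := rfl
  have hentry : ∀ v, IsImg (Nat.clog 2 (2 * q)) q S.poly v →
      IsEntry w D p S.poly (.pair (.nat p) (.pair (.nat (Nat.clog 2 (2 * q))) v)) := by
    rintro v ⟨u, u', rfl, hu, hu', hup, hup'⟩
    refine ⟨_, _, rfl, ⟨u, u', rfl, hu, hu', ?_, ?_⟩, hkw, by omega, ?_⟩
    all_goals
      by_cases h3 : D < 3
    all_goals first | rw [if_pos h3] at hqdef | rw [if_neg h3] at hqdef
    · have hdeg : S.poly.degree < ((2 : ℕ) : WithBot ℕ) :=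
        lt_of_le_of_lt degree_le_natDegree (by exact_mod_cast (by omega : S.poly.natDegree < 2))
      have hdeg' : S.poly.degree < ((p : ℕ) : WithBot ℕ) :=
        lt_of_lt_of_le hdeg (by exact_mod_cast hp)
      rw [hup, hqdef, cyc_eq_self (by norm_num) hdeg, cyc_eq_self (by omega) hdeg']
    · rw [hup, hqdef]
    · have hdeg : S.poly.degree < ((2 : ℕ) : WithBot ℕ) :=
        lt_of_le_of_lt degree_le_natDegree (by exact_mod_cast (by omega : S.poly.natDegree < 2))
      have hdeg' : S.poly.degree < ((p : ℕ) : WithBot ℕ) :=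
        lt_of_lt_of_le hdeg (by exact_mod_cast hp)
      rw [hup', hqdef, cyc_eq_self (by norm_num) (degree_X_mul_derivative_lt hdeg),
        cyc_eq_self (by omega) (degree_X_mul_derivative_lt hdeg')]
    · rw [hup', hqdef]
    · intro d hd
      have := Nat.mod_le d p
      omega
    · intro d hd
      have := Nat.mod_lt d (by omega : p > 0)
      omega
  have h2 : (2 : F) ≠ 0 ∨ Nat.clog 2 (2 * q) < 3 := by
    by_cases h3 : D < 3
    · right
      rw [if_pos h3] at hqdef
      rw [hqdef, Nat.lt_succ_iff, Nat.clog_le_iff_le_pow (by norm_num)]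
    · exact Or.inl (two_ne_zero_of_le_ringChar hDF (by omega))
  have main : ∀ cost : ℕ, cost ≤ 2 * D.size + w + 100 → Sym prog imagesE
      [.nat q, .pair (.nat p) (.pair (.nat D) (Val.list (S.instrs.map Instr.code)))] fun e d =>
      IsEntry w D p S.poly e ∧
        cost + d + 1 ≤ 2 * D.size + 200000 * (S.length * (p * (w + 2) ^ 4)) := by
    intro cost hc
    dsimp only [imagesE, Sym, onSome, Val.onPair, Val.onNat, Val.split,
      NatOp.apply, List.getElem?_cons_zero, List.getElem?_cons_succ]
    refine (clog_spec w (2 * q) hqs').mono ?_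
    rintro _ d₁ ⟨rfl, hd₁⟩
    refine (len_spec w (S.instrs.map Instr.code) (by rw [List.length_map]; exact hL)).mono ?_
    rintro _ d₂ ⟨rfl, hd₂⟩
    rw [List.length_map, show S.instrs.length = S.length from rfl] at hd₂ ⊢
    refine (clog_spec (w + 1) S.length hLs).mono ?_
    rintro _ d₃ ⟨rfl, hd₃⟩
    refine (rep_spec w hw2 IsFld (.fld 0) ⟨0, rfl⟩ _ hkw).mono ?_
    rintro z d₄ ⟨⟨hz, hz0⟩, hd₄⟩
    refine (rep_spec w hw2 (fun _ => True) (.nat 0) trivial _ hκw).mono ?_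
    rintro regs d₅ ⟨⟨hregs, -⟩, hd₅⟩
    have hP : EvalParams F w (Nat.clog 2 S.length) (Nat.clog 2 (2 * q)) q z :=
      ⟨hw2, hκw, hkw, hq, hk1, h2, hz, hz0 rfl⟩
    have := run_spec hP S.instrs S.ne_nil regs [] hregs
      (by rw [List.length_nil, zero_add]; exact hκ) (fun j hj => absurd hj (by simp))
      (fun i hi => by simpa using S.allowed i hi)
    refine this.mono ?_
    rintro v d₆ ⟨hv, hd₆⟩
    refine ⟨hentry v hv, ?_⟩
    have h6 : 2 * instrCost w (Nat.clog 2 (2 * q)) * S.instrs.length ≤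
        160200 * (S.length * (p * (w + 2) ^ 4)) := by
      calc _ ≤ 2 * (80100 * (p * (w + 2) ^ 4)) * S.length := by
            gcongr
            · omega
            · exact le_rfl
        _ = _ := by ring
    have r1 := hrep _ hkw
    have r2 := hrep _ hκw
    omega
  refine Cl.intro rfl ?_
  refine ⟨fun h3 => ?_, fun h3 => ?_⟩
  · rw [if_pos h3] at hqdef
    subst hqdef
    refine main _ ?_
    omega
  · rw [if_neg h3] at hqdef
    subst hqdef
    refine main _ ?_
    omega

end

/-! ### The size of the primes -/

theorem prime_pr (j : ℕ) : (pr j).Prime := Nat.prime_nth_prime j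

theorem pr_injective : Function.Injective pr := Nat.nth_injective Nat.infinite_setOfPred_prime

/-- Chebyshev's lower bound for the number of primes, in terms of the least common multiple of the
numbers up to `n`: it is at least `2 ^ n / (n + 1)`, and each prime contributes a factor of at most
`n`. -/
theorem two_pow_le_mul_pow_primeCounting (n : ℕ) :
    2 ^ n ≤ (n + 1) * n ^ Nat.primeCounting n := by
  refine (Chebyshev.two_pow_le_mul_lcmUpto n).trans ?_
  refine Nat.mul_le_mul_left _ ?_
  rw [Nat.lcmUpto_eq_prod_pow_log]
  rcases Nat.eq_zero_or_pos n with rfl | hn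
  · simp
  · refine (Finset.prod_le_pow_card _ _ n fun p _ => Nat.pow_log_le_self p hn.ne').trans ?_
    rw [Nat.primesLE_card_eq_primeCounting]

/-- The first `N` primes are at most `w * (N + 1)` for any `w` with `w * (N + 1) < 2 ^ w`, that
is, `O(N log N)`. -/
theorem pr_le {w N : ℕ} (hw : 0 < w) (h : w * (N + 1) + 1 ≤ 2 ^ w) {i : ℕ} (hi : i < N) :
    pr i ≤ w * (N + 1) := by
  obtain ⟨n, hn⟩ : ∃ n, n = w * (N + 1) := ⟨_, rfl⟩
  have h1 : 2 ^ n ≤ 2 ^ (w * (1 + Nat.primeCounting n)) := by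
    calc 2 ^ n ≤ (n + 1) * n ^ Nat.primeCounting n := two_pow_le_mul_pow_primeCounting n
      _ ≤ 2 ^ w * (2 ^ w) ^ Nat.primeCounting n := by gcongr <;> omega
      _ = _ := by rw [← pow_mul, ← pow_add]; ring_nf
  have h2 := (Nat.pow_le_pow_iff_right (by norm_num)).1 h1
  have h3 : N ≤ Nat.primeCounting n := by
    have h4 : w * (N + 1) ≤ w * (1 + Nat.primeCounting n) := hn ▸ h2
    have := Nat.le_of_mul_le_mul_left h4 hw
    omega
  have h4 : pr i < n + 1 := Nat.nth_lt_of_lt_count (lt_of_lt_of_le hi h3)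
  omega

/-! ### Collisions of exponents -/

section
variable {F : Type u} [Field F]

/-- Some exponent in `R` other than `d` has the same residue modulo `p` as `d`. -/
def Collides (R : Finset ℕ) (p d : ℕ) : Prop := ∃ e ∈ R, e ≠ d ∧ e % p = d % p

open scoped Classical in
/-- Few primes make an exponent collide: their product divides the product of the differences. -/
theorem two_pow_card_collides_le {R : Finset ℕ} {d D : ℕ} (hR : ∀ e ∈ R, e < D) (hd : d < D)
    (M : ℕ) : 2 ^ ((Finset.range M).filter fun j => Collides R (pr j) d).card ≤
      (D - 1) ^ (R.erase d).card := by
  have hpos : ∀ e ∈ R.erase d, 0 < ((e : ℤ) - d).natAbs := fun e he =>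
    Int.natAbs_pos.2 (sub_ne_zero.2 (by exact_mod_cast (Finset.mem_erase.1 he).1))
  calc _ ≤ ∏ j ∈ (Finset.range M).filter fun j => Collides R (pr j) d, pr j :=
        Finset.pow_card_le_prod _ _ _ fun j _ => (prime_pr j).two_le
    _ ≤ ∏ e ∈ R.erase d, ((e : ℤ) - d).natAbs := by
        refine Nat.le_of_dvd (Finset.prod_pos hpos) ?_
        refine Finset.prod_dvd_of_isRelPrime ?_ ?_
        · intro i _ j _ hij
          exact Nat.coprime_iff_isRelPrime.1
            ((Nat.coprime_primes (prime_pr i) (prime_pr j)).2 (pr_injective.ne hij))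
        · intro j hj
          obtain ⟨e, he, hed, hmod⟩ := (Finset.mem_filter.1 hj).2
          refine dvd_trans ?_ (Finset.dvd_prod_of_mem _ (Finset.mem_erase.2 ⟨hed, he⟩))
          rw [← Int.natCast_dvd]
          exact (Nat.modEq_iff_dvd.1 (show d ≡ e [MOD pr j] from hmod.symm))
    _ ≤ _ := by
        refine Finset.prod_le_pow_card _ _ _ fun e he => ?_
        have := hR e (Finset.mem_of_mem_erase he)
        omega

open scoped Classical in
theorem card_collides_lt {R : Finset ℕ} {d D m : ℕ} (hR : ∀ e ∈ R, e < D) (hd : d < D)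
    (hD : 2 ≤ D) (hm : 1 ≤ m) (hRm : (R.erase d).card ≤ m) (M : ℕ) :
    ((Finset.range M).filter fun j => Collides R (pr j) d).card < Nat.clog 2 (D ^ m) := by
  rw [Nat.lt_clog_iff_pow_lt (by norm_num)]
  calc _ ≤ _ := two_pow_card_collides_le hR hd M
    _ ≤ (D - 1) ^ m := Nat.pow_le_pow_right (by omega) hRm
    _ < D ^ m := Nat.pow_lt_pow_left (by omega) (by omega)

/-- The coefficients of a residue are the sums of the coefficients over the classes of exponents.
-/
theorem coeff_cyc {p : ℕ} (hp : 0 < p) (g : F[X]) {s : Finset ℕ} (hs : g.support ⊆ s) (i : ℕ) :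
    (cyc p g).coeff i = ∑ e ∈ s.filter (fun e => e % p = i), g.coeff e := by
  conv_lhs => rw [g.as_sum_support, Finset.sum_subset hs (fun e _ he => by
    rw [notMem_support_iff.1 he, monomial_zero_right]), cyc_sum hp]
  rw [finsetSum_coeff, Finset.sum_filter]
  refine Finset.sum_congr rfl fun e _ => ?_
  rw [cyc_monomial hp, coeff_monomial]

theorem coeff_cyc_of_not_collides {p : ℕ} (hp : 0 < p) {g : F[X]} {s : Finset ℕ}
    (hs : g.support ⊆ s) {d : ℕ} (h : ¬ Collides s p d) :
    (cyc p g).coeff (d % p) = g.coeff d := by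
  rw [coeff_cyc hp g hs]
  by_cases hd : d ∈ s
  · refine Finset.sum_eq_single_of_mem d (by simp [hd]) fun e he hed => ?_
    rw [Finset.mem_filter] at he
    exact absurd ⟨e, he.1, hed, he.2⟩ h
  · rw [notMem_support_iff.1 fun hd' => hd (hs hd')]
    refine Finset.sum_eq_zero fun e he => ?_
    rw [Finset.mem_filter] at he
    exact absurd ⟨e, he.1, fun h' => hd (h' ▸ he.1), he.2⟩ h

/-- Multiplication by `x` shifts the residues by one. -/
theorem coeff_cyc_X_mul {p : ℕ} (hp : 0 < p) (g : F[X]) {e : ℕ} (he : e < p) :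
    (cyc p (X * g)).coeff e = (cyc p g).coeff ((e + p - 1) % p) := by
  induction g using Polynomial.induction_on' with
  | add f g hf hg => rw [mul_add, cyc_add, cyc_add, coeff_add, coeff_add, hf, hg]
  | monomial n a =>
    rw [X_mul_monomial, cyc_monomial hp, cyc_monomial hp, coeff_monomial, coeff_monomial]
    refine if_congr ?_ rfl rfl
    have h1 : e = e % p := (Nat.mod_eq_of_lt he).symm
    constructor
    · intro h
      have : (n + 1 + (p - 1)) ≡ (e + (p - 1)) [MOD p] := Nat.ModEq.add_right _ (h.trans h1)
      rw [show n + 1 + (p - 1) = n + p by omega, show e + (p - 1) = e + p - 1 by omega] at this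
      rw [← this, Nat.add_mod_right]
    · intro h
      have : (n + 1) ≡ (e + p - 1 + 1) [MOD p] := Nat.ModEq.add_right _ h
      rw [show e + p - 1 + 1 = e + p by omega] at this
      rw [this, Nat.add_mod_right, ← h1]

theorem support_X_mul_derivative_subset (g : F[X]) :
    (X * derivative g).support ⊆ g.support := by
  intro i hi
  rw [mem_support_iff] at hi ⊢
  rcases i with _ | i
  · simp at hi
  · rw [coeff_X_mul, coeff_derivative] at hi
    exact left_ne_zero_of_mul hi

theorem coeff_X_mul_derivative (g : F[X]) (i : ℕ) :
    (X * derivative g).coeff i = i * g.coeff i := by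
  rcases i with _ | i
  · simp
  · rw [coeff_X_mul, coeff_derivative, mul_comm]; push_cast; rfl

/-! ### The test for terms -/

/-- Subtraction of one non-zero term lowers the number of terms only by cancellation. -/
theorem numTerms_sub_monomial_lt_iff {g : F[X]} {i : ℕ} {c : F} (hc : c ≠ 0) :
    numTerms (g - monomial i c) < numTerms g ↔ g.coeff i = c := by
  have hco : ∀ j, (g - monomial i c).coeff j = if i = j then g.coeff j - c else g.coeff j := by
    intro j
    rw [coeff_sub, coeff_monomial]
    split_ifs <;> simp
  constructor
  · intro h
    by_contra hne
    refine absurd h (not_lt.2 (Finset.card_le_card fun j hj => ?_))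
    rw [mem_support_iff] at hj ⊢
    rw [hco]
    split_ifs with hij
    · rw [← hij]; exact sub_ne_zero.2 hne
    · exact hj
  · intro h
    refine Finset.card_lt_card (Finset.ssubset_iff_of_subset ?_ |>.2 ⟨i, ?_, ?_⟩)
    · intro j hj
      rw [mem_support_iff, hco] at hj
      rw [mem_support_iff]
      split_ifs at hj with hij
      · rw [← hij, h]; exact hc
      · exact hj
    · rw [mem_support_iff, h]; exact hc
    · rw [mem_support_iff, hco, if_pos rfl, h, sub_self, not_not]

theorem numA_eq {T D : ℕ} (hT : 1 ≤ T) :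
    numA T D = max 1 (Nat.clog 2 (D ^ (T - 1))) := by
  rw [numA, ← Real.natCeil_logb_natCast]
  push_cast [Real.logb_pow, hT]
  rfl

theorem numB_eq (T D : ℕ) : numB T D = Nat.clog 2 (D ^ T) := by
  rw [numB, ← Real.natCeil_logb_natCast]
  push_cast [Real.logb_pow]
  rfl

/-! ### The candidates that pass the test -/

/-- The sum of the terms of `f` with exponents in `H`. -/
def part (f : F[X]) (H : Finset ℕ) : F[X] := ∑ d ∈ H, monomial d (f.coeff d)

theorem coeff_part (f : F[X]) (H : Finset ℕ) (i : ℕ) :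
    (part f H).coeff i = if i ∈ H then f.coeff i else 0 := by
  simp only [part, finsetSum_coeff, coeff_monomial, Finset.sum_ite_eq']

theorem support_sub_part (f : F[X]) (H : Finset ℕ) :
    (f - part f H).support = f.support \ H := by
  ext i
  rw [mem_support_iff, coeff_sub, coeff_part, Finset.mem_sdiff, mem_support_iff]
  by_cases h : i ∈ H <;> simp [h]

theorem support_part {f : F[X]} {H : Finset ℕ} (hH : H ⊆ f.support) : (part f H).support = H := by
  ext i
  rw [mem_support_iff, coeff_part]
  by_cases h : i ∈ H
  · simpa [h] using hH h
  · simp [h]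

theorem image_eq (S : SLP F) (fs : F[X]) (j : ℕ) : image S fs j = cyc (pr j) (S.poly - fs) :=
  (cyc_sub _ _ _).symm

theorem pr_pos (j : ℕ) : 0 < pr j := (prime_pr j).pos

theorem bestIndex_spec (S : SLP F) (fs : F[X]) (T D : ℕ) :
    bestIndex S fs T D < numPrimes T D ∧
      numTerms (image S fs (bestIndex S fs T D)) = maxTerms S fs T D := by
  have hN : 0 < numPrimes T D := by
    have : 1 ≤ numA T D := le_max_left _ _
    have : 4 * numA T D ≤ numPrimes T D := le_max_left _ _
    omega
  obtain ⟨j, hj, hmax⟩ := Finset.exists_mem_eq_sup (Finset.range (numPrimes T D))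
    ⟨0, Finset.mem_range.2 hN⟩ fun j => numTerms (image S fs j)
  exact Nat.sInf_mem (s := {j | j < numPrimes T D ∧ numTerms (image S fs j) = maxTerms S fs T D})
    ⟨j, Finset.mem_range.1 hj, hmax.symm⟩

/-- The candidates in terms of the Euler derivative `x g'` of the difference `g`; its image at `e`
is the coefficient that the algorithm reads at `e - 1` from the image of `g'`. -/
theorem mem_candidates {S : SLP F} {fs : F[X]} {T D : ℕ} {t : F × ℕ} :
    t ∈ candidates S fs T D ↔ ∃ e < pr (bestIndex S fs T D),
      (image S fs (bestIndex S fs T D)).coeff e ≠ 0 ∧ t.2 < D ∧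
      (t.2 : F) = (cyc (pr (bestIndex S fs T D)) (X * derivative (S.poly - fs))).coeff e /
        (image S fs (bestIndex S fs T D)).coeff e ∧
      t.1 = (image S fs (bestIndex S fs T D)).coeff e := by
  obtain ⟨p, hp⟩ : ∃ p, p = pr (bestIndex S fs T D) := ⟨_, rfl⟩
  have hp0 : 0 < p := hp ▸ pr_pos _
  obtain ⟨c, d⟩ := t
  simp only [candidates, uTerms, ← hp, ← cyc_sub, ← derivative_sub, Finset.mem_image,
    Finset.mem_filter, Finset.mem_product, Finset.mem_range, mem_support_iff, Prod.exists,
    Prod.mk.injEq]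
  constructor
  · rintro ⟨e, d', ⟨⟨he, hd⟩, hq⟩, rfl, rfl⟩
    have hep : e < p := by
      by_contra h
      refine he (coeff_eq_zero_of_degree_lt (lt_of_lt_of_le ?_ (Nat.cast_le.2 (not_lt.1 h))))
      rw [image_eq, ← hp]
      exact degree_cyc_lt hp0 _
    exact ⟨e, hep, he, hd, by rw [coeff_cyc_X_mul hp0 _ hep]; exact hq, rfl⟩
  · rintro ⟨e, hep, he, hd, hq, rfl⟩
    exact ⟨e, d, ⟨⟨he, hd⟩, by rw [← coeff_cyc_X_mul hp0 _ hep]; exact hq⟩, rfl, rfl⟩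

open scoped Classical in
/-- For a non-zero coefficient the test can be read off from single coefficients of the images. -/
theorem certified_iff_card {S : SLP F} {fs : F[X]} {T D : ℕ} {c : F} (hc : c ≠ 0) (d : ℕ) :
    Certified S fs T D (c, d) ↔
      numB T D ≤ ((Finset.range (numA T D + numB T D - 1)).filter fun j =>
        (cyc (pr j) (S.poly - fs)).coeff (d % pr j) = c).card := by
  rw [Certified]
  refine iff_of_eq (congrArg _ (congrArg _ (Finset.filter_congr fun j _ => ?_)))
  rw [cyc_monomial (pr_pos j), numTerms_sub_monomial_lt_iff hc, image_eq]

open scoped Classical in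
/-- The terms of the difference pass the test: an exponent of the difference collides with another
one for fewer than `N₁` primes. -/
theorem card_collides_lt_numA {r : F[X]} {T D : ℕ} (hT : 1 ≤ T) (hr : ∀ e ∈ r.support, e < D)
    (hcard : numTerms r ≤ T) {d : ℕ} (hd : d ∈ r.support) (M : ℕ) :
    ((Finset.range M).filter fun j => Collides r.support (pr j) d).card < numA T D := by
  rw [numA_eq hT]
  have hcard' : (r.support.erase d).card ≤ T - 1 := by
    rw [Finset.card_erase_of_mem hd]; exact Nat.sub_le_sub_right hcard 1
  by_cases hT1 : 1 ≤ T - 1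
  · by_cases hD : 2 ≤ D
    · exact lt_max_of_lt_right (card_collides_lt hr (hr d hd) hD hT1 hcard' M)
    · refine lt_max_of_lt_left ?_
      rw [Nat.lt_one_iff, Finset.card_eq_zero, Finset.filter_eq_empty_iff]
      rintro j - ⟨e, he, hed, -⟩
      have := hr d hd
      have := hr e he
      omega
  · refine lt_max_of_lt_left ?_
    rw [Nat.lt_one_iff, Finset.card_eq_zero, Finset.filter_eq_empty_iff]
    rintro j - ⟨e, he, hed, -⟩
    have := Finset.card_pos.2 ⟨e, Finset.mem_erase.2 ⟨hed, he⟩⟩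
    omega

/-- Among the candidates, the test accepts exactly the terms of the difference. -/
theorem certified_iff {S : SLP F} {fs : F[X]} {T D : ℕ} (hT : 1 ≤ T)
    (hr : ∀ e ∈ (S.poly - fs).support, e < D) (hcard : numTerms (S.poly - fs) ≤ T) {c : F} {d : ℕ}
    (ht : (c, d) ∈ candidates S fs T D) :
    Certified S fs T D (c, d) ↔ (S.poly - fs).coeff d = c := by
  classical
  obtain ⟨e, hep, he, hd, hq, hc⟩ := mem_candidates.1 ht
  obtain ⟨r, hrdef⟩ : ∃ r, r = S.poly - fs := ⟨_, rfl⟩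
  dsimp only at hd hq hc
  have hc0 : c ≠ 0 := hc ▸ he
  rw [certified_iff_card hc0]
  rw [← hrdef] at hr hcard ⊢
  constructor
  · intro h
    by_contra hne
    by_cases hD : 2 ≤ D
    · refine absurd h (not_le.2 (lt_of_lt_of_eq (lt_of_le_of_lt
        (Finset.card_le_card ?_) (card_collides_lt hr hd hD hT ((Finset.card_le_card
          (Finset.erase_subset _ _)).trans hcard) (numA T D + numB T D - 1)))
        (numB_eq T D).symm))
      intro j hj
      rw [Finset.mem_filter] at hj ⊢
      refine ⟨hj.1, ?_⟩
      by_contra hcol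
      exact hne (coeff_cyc_of_not_collides (pr_pos j) subset_rfl hcol ▸ hj.2)
    · -- Here the difference is a constant, and it equals all its images.
      have hdeg : r.degree < (pr (bestIndex S fs T D) : WithBot ℕ) := by
        rw [degree_lt_iff_coeff_zero]
        intro i hi
        by_contra hi0
        have := hr i (mem_support_iff.2 hi0)
        have := pr_pos (bestIndex S fs T D)
        omega
      have himg : image S fs (bestIndex S fs T D) = r := by
        rw [image_eq, ← hrdef, cyc_eq_self (pr_pos _) hdeg]
      rw [himg] at he hc
      have := hr e (mem_support_iff.2 he)
      exact hne (by rw [hc, show d = e by omega])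
  · intro h
    have hds : d ∈ r.support := mem_support_iff.2 (h ▸ hc0)
    have h1 := card_collides_lt_numA hT hr hcard hds (numA T D + numB T D - 1)
    have h2 := Finset.card_filter_add_card_filter_not (s := Finset.range (numA T D + numB T D - 1))
      (fun j => Collides r.support (pr j) d)
    have h3 : ((Finset.range (numA T D + numB T D - 1)).filter fun j =>
        ¬ Collides r.support (pr j) d).card ≤
        ((Finset.range (numA T D + numB T D - 1)).filter fun j =>
          (cyc (pr j) r).coeff (d % pr j) = c).card := by
      refine Finset.card_le_card fun j hj => ?_
      rw [Finset.mem_filter] at hj ⊢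
      exact ⟨hj.1, by rw [coeff_cyc_of_not_collides (pr_pos j) subset_rfl hj.2, h]⟩
    rw [Finset.card_range] at h2
    omega

open scoped Classical in
/-- The exponents of the terms that one call of DUIHalf finds. -/
def found (S : SLP F) (fs : F[X]) (T D : ℕ) : Finset ℕ :=
  ((candidates S fs T D).filter (Certified S fs T D)).image Prod.snd

theorem mem_found {S : SLP F} {fs : F[X]} {T D d : ℕ} :
    d ∈ found S fs T D ↔ ∃ c, (c, d) ∈ candidates S fs T D ∧ Certified S fs T D (c, d) := by
  simp [found]

theorem found_subset {S : SLP F} {fs : F[X]} {T D : ℕ} (hT : 1 ≤ T)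
    (hr : ∀ e ∈ (S.poly - fs).support, e < D) (hcard : numTerms (S.poly - fs) ≤ T) :
    found S fs T D ⊆ (S.poly - fs).support := by
  intro d hd
  obtain ⟨c, hc, hcert⟩ := mem_found.1 hd
  obtain ⟨e, -, he, -, -, hce⟩ := mem_candidates.1 hc
  rw [mem_support_iff, (certified_iff hT hr hcard hc).1 hcert]
  exact ne_of_eq_of_ne hce he

/-- The terms that pass the test have distinct exponents, since the test forces the coefficient.
-/
theorem DUIHalf_eq {S : SLP F} {fs : F[X]} {T D : ℕ} (hT : 1 ≤ T)
    (hr : ∀ e ∈ (S.poly - fs).support, e < D) (hcard : numTerms (S.poly - fs) ≤ T) (T₁ : ℕ) :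
    DUIHalf S fs T T₁ D = part (S.poly - fs) (found S fs T D) := by
  classical
  have key : ∑ t ∈ (candidates S fs T D).filter (Certified S fs T D), monomial t.2 t.1 =
      part (S.poly - fs) (found S fs T D) := by
    have hcoeff : ∀ t ∈ (candidates S fs T D).filter (Certified S fs T D),
        (S.poly - fs).coeff t.2 = t.1 := fun t ht =>
      (certified_iff hT hr hcard (Finset.mem_filter.1 ht).1).1 (Finset.mem_filter.1 ht).2
    rw [part, found, Finset.sum_image]
    · refine Finset.sum_congr rfl fun t ht => ?_
      rw [hcoeff t ht]
    · intro s hs t ht hst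
      refine Prod.ext ?_ hst
      rw [← hcoeff s hs, ← hcoeff t ht, hst]
  rw [DUIHalf]
  split_ifs with h0
  · rw [← key]
    have himg : image S fs (bestIndex S fs T D) = 0 := by
      have := (bestIndex_spec S fs T D).2
      rw [h0, numTerms, Finset.card_eq_zero, support_eq_empty] at this
      exact this
    have : candidates S fs T D = ∅ := by
      refine Finset.eq_empty_of_forall_notMem fun t ht => ?_
      obtain ⟨e, -, he, -⟩ := mem_candidates.1 ht
      rw [himg, coeff_zero] at he
      exact he rfl
    rw [this, Finset.filter_empty, Finset.sum_empty]
  · convert key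

/-! ### At least half of the terms are found -/

open scoped Classical in
/-- Residues hit by several exponents use up two exponents each. -/
theorem two_mul_card_image_le (R : Finset ℕ) (p : ℕ) :
    2 * (R.image (· % p)).card ≤ R.card + (R.filter fun d => ¬ Collides R p d).card := by
  have hmap : ∀ d ∈ R, d % p ∈ R.image (· % p) := fun d hd => Finset.mem_image_of_mem _ hd
  have hmap' : ∀ d ∈ R.filter (fun d => ¬ Collides R p d), d % p ∈ R.image (· % p) :=
    fun d hd => hmap d (Finset.filter_subset _ _ hd)
  rw [Finset.card_eq_sum_card_fiberwise hmap, Finset.card_eq_sum_card_fiberwise hmap',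
    ← Finset.sum_add_distrib, mul_comm, ← smul_eq_mul]
  refine Finset.card_nsmul_le_sum _ _ _ fun i hi => ?_
  obtain ⟨d, hd, rfl⟩ := Finset.mem_image.1 hi
  by_cases hc : Collides R p d
  · obtain ⟨e, he, hed, hmod⟩ := hc
    have : 1 < (R.filter fun x => x % p = d % p).card :=
      Finset.one_lt_card.2 ⟨e, by simp [he, hmod], d, by simp [hd], hed⟩
    omega
  · have h1 : 0 < (R.filter fun x => x % p = d % p).card :=
      Finset.card_pos.2 ⟨d, by simp [hd]⟩
    have h2 : 0 < ((R.filter fun d => ¬ Collides R p d).filter fun x => x % p = d % p).card :=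
      Finset.card_pos.2 ⟨d, by simp [hd, hc]⟩
    omega

theorem support_cyc_subset {p : ℕ} (hp : 0 < p) (r : F[X]) :
    (cyc p r).support ⊆ r.support.image (· % p) := by
  intro i hi
  rw [mem_support_iff, coeff_cyc hp r subset_rfl] at hi
  obtain ⟨e, he, -⟩ := Finset.exists_ne_zero_of_sum_ne_zero hi
  rw [Finset.mem_filter] at he
  exact Finset.mem_image.2 ⟨e, he⟩

open scoped Classical in
theorem card_not_collides_le_numTerms {p : ℕ} (hp : 0 < p) (r : F[X]) :
    (r.support.filter fun d => ¬ Collides r.support p d).card ≤ numTerms (cyc p r) := by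
  refine Finset.card_le_card_of_injOn (· % p) (fun d hd => ?_) fun d hd e he hde => ?_
  · rw [Finset.mem_coe, Finset.mem_filter] at hd
    rw [Finset.mem_coe, mem_support_iff, coeff_cyc_of_not_collides hp subset_rfl hd.2]
    exact mem_support_iff.1 hd.1
  · rw [Finset.mem_coe, Finset.mem_filter] at hd he
    by_contra hne
    exact he.2 ⟨d, hd.1, hne, hde⟩

open scoped Classical in
/-- The selected prime keeps three quarters of the terms: on average over the first `4 N₁` primes,
at least three quarters of the exponents do not collide. -/
theorem three_mul_numTerms_le {S : SLP F} {fs : F[X]} {T D : ℕ} (hT : 1 ≤ T)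
    (hr : ∀ e ∈ (S.poly - fs).support, e < D) (hcard : numTerms (S.poly - fs) ≤ T) :
    3 * numTerms (S.poly - fs) ≤ 4 * maxTerms S fs T D := by
  obtain ⟨r, hrdef⟩ : ∃ r, r = S.poly - fs := ⟨_, rfl⟩
  obtain ⟨n, hn⟩ : ∃ n, n = numA T D := ⟨_, rfl⟩
  have hn1 : 1 ≤ n := hn ▸ le_max_left _ _
  rw [← hrdef] at hr hcard ⊢
  have hle : ∀ j ∈ Finset.range (4 * n),
      (r.support.filter fun d => ¬ Collides r.support (pr j) d).card ≤ maxTerms S fs T D := by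
    intro j hj
    refine (card_not_collides_le_numTerms (pr_pos j) r).trans ?_
    rw [hrdef, ← image_eq]
    refine Finset.le_sup (f := fun j => numTerms (image S fs j)) ?_
    rw [Finset.mem_range] at hj ⊢
    exact lt_of_lt_of_le hj (hn ▸ le_max_left _ _)
  have hge : ∀ d ∈ r.support,
      3 * n ≤ ((Finset.range (4 * n)).filter fun j => ¬ Collides r.support (pr j) d).card := by
    intro d hd
    have h1 := card_collides_lt_numA hT hr hcard hd (4 * n)
    have h2 := Finset.card_filter_add_card_filter_not (s := Finset.range (4 * n))
      (fun j => Collides r.support (pr j) d)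
    rw [Finset.card_range] at h2
    omega
  have h := Finset.card_nsmul_le_sum _ _ _ hge
  have h' := Finset.sum_le_card_nsmul _ _ _ hle
  have hswap : ∑ d ∈ r.support, ((Finset.range (4 * n)).filter fun j =>
      ¬ Collides r.support (pr j) d).card = ∑ j ∈ Finset.range (4 * n),
        (r.support.filter fun d => ¬ Collides r.support (pr j) d).card :=
    Finset.sum_card_bipartiteAbove_eq_sum_card_bipartiteBelow
      (fun d j => ¬ Collides r.support (pr j) d)
  rw [hswap] at h
  have h'' := h.trans h'
  rw [Finset.card_range, smul_eq_mul, smul_eq_mul] at h''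
  have h3 : n * (3 * r.support.card) ≤ n * (4 * maxTerms S fs T D) := by linarith
  exact Nat.le_of_mul_le_mul_left h3 hn1

/-- A term whose exponent does not collide at the selected prime is found. -/
theorem mem_found_of_not_collides {S : SLP F} {fs : F[X]} {T D : ℕ} (hT : 1 ≤ T)
    (hr : ∀ e ∈ (S.poly - fs).support, e < D) (hcard : numTerms (S.poly - fs) ≤ T) {d : ℕ}
    (hd : d ∈ (S.poly - fs).support)
    (hcol : ¬ Collides (S.poly - fs).support (pr (bestIndex S fs T D)) d) :
    d ∈ found S fs T D := by
  have hc0 := mem_support_iff.1 hd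
  have hp := pr_pos (bestIndex S fs T D)
  have hcand : ((S.poly - fs).coeff d, d) ∈ candidates S fs T D := by
    have h1 := coeff_cyc_of_not_collides hp subset_rfl hcol
    have h2 := coeff_cyc_of_not_collides hp (support_X_mul_derivative_subset (S.poly - fs)) hcol
    refine mem_candidates.2 ⟨d % pr (bestIndex S fs T D), Nat.mod_lt _ hp, ?_, hr d hd, ?_, ?_⟩
    · rw [image_eq, h1]; exact hc0
    · rw [image_eq, h1, h2, coeff_X_mul_derivative, mul_div_cancel_right₀ _ hc0]
    · rw [image_eq, h1]
  exact mem_found.2 ⟨_, hcand, (certified_iff hT hr hcard hcand).2 rfl⟩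

/-- At the selected prime at least half of the exponents do not collide. -/
theorem two_mul_card_sdiff_found_le {S : SLP F} {fs : F[X]} {T D : ℕ} (hT : 1 ≤ T)
    (hr : ∀ e ∈ (S.poly - fs).support, e < D) (hcard : numTerms (S.poly - fs) ≤ T) :
    2 * ((S.poly - fs).support \ found S fs T D).card ≤ numTerms (S.poly - fs) := by
  classical
  have h1 := three_mul_numTerms_le hT hr hcard
  have h2 := two_mul_card_image_le (S.poly - fs).support (pr (bestIndex S fs T D))
  have h3 := Finset.card_le_card (support_cyc_subset (pr_pos (bestIndex S fs T D)) (S.poly - fs))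
  rw [← image_eq, ← numTerms, (bestIndex_spec S fs T D).2] at h3
  have h4 : ((S.poly - fs).support \ found S fs T D).card ≤
      ((S.poly - fs).support.filter fun d =>
        Collides (S.poly - fs).support (pr (bestIndex S fs T D)) d).card := by
    refine Finset.card_le_card fun d hd => ?_
    rw [Finset.mem_sdiff] at hd
    rw [Finset.mem_filter]
    refine ⟨hd.1, ?_⟩
    by_contra hcol
    exact hd.2 (mem_found_of_not_collides hT hr hcard hd.1 hcol)
  have h5 := Finset.card_filter_add_card_filter_not (s := (S.poly - fs).support)
    (fun d => Collides (S.poly - fs).support (pr (bestIndex S fs T D)) d)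
  unfold numTerms at h1 ⊢
  omega

/-! ### Correctness of the loop -/

/-- One pass, on the sum of the terms of the polynomial with exponents in `H`. -/
theorem DUIHalf_part {S : SLP F} {T D : ℕ} {H : Finset ℕ} (hT : 1 ≤ T)
    (hD : S.poly.natDegree < D) (hcard : numTerms S.poly ≤ T) (T₁ : ℕ) :
    found S (part S.poly H) T D ⊆ S.poly.support \ H ∧
    DUIHalf S (part S.poly H) T T₁ D = part S.poly (found S (part S.poly H) T D) ∧
    part S.poly H + DUIHalf S (part S.poly H) T T₁ D =
      part S.poly (H ∪ found S (part S.poly H) T D) ∧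
    2 * (S.poly.support \ (H ∪ found S (part S.poly H) T D)).card ≤
      (S.poly.support \ H).card := by
  have hs := support_sub_part S.poly H
  have hr : ∀ e ∈ (S.poly - part S.poly H).support, e < D := by
    intro e he
    rw [hs] at he
    exact lt_of_le_of_lt (le_natDegree_of_mem_supp e (Finset.sdiff_subset he)) hD
  have hc : numTerms (S.poly - part S.poly H) ≤ T := by
    rw [numTerms, hs]
    exact (Finset.card_le_card Finset.sdiff_subset).trans hcard
  have hsub := found_subset hT hr hc
  have hhalf := two_mul_card_sdiff_found_le hT hr hc
  rw [numTerms] at hhalf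
  rw [hs] at hsub hhalf
  have hDUI := DUIHalf_eq hT hr hc T₁
  obtain ⟨A, hA⟩ : ∃ A, A = found S (part S.poly H) T D := ⟨_, rfl⟩
  rw [← hA] at hsub hhalf hDUI ⊢
  have hdisj : Disjoint H A :=
    (Finset.disjoint_of_subset_left hsub Finset.sdiff_disjoint).symm
  have heq : part (S.poly - part S.poly H) A = part S.poly A := by
    refine Finset.sum_congr rfl fun d hd => ?_
    rw [coeff_sub, coeff_part, if_neg (Finset.disjoint_right.1 hdisj hd), sub_zero]
  rw [heq] at hDUI
  refine ⟨hsub, hDUI, ?_, ?_⟩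
  · rw [hDUI, part, part, part, Finset.sum_union hdisj]
  · rwa [sdiff_sdiff_left] at hhalf

/-- Each pass at least halves the number of missing terms, as it does with the bound `T₁`, so
none is missing at the end. -/
theorem duiLoop_fst {S : SLP F} {T D : ℕ} (hT : 1 ≤ T) (hD : S.poly.natDegree < D)
    (hcard : numTerms S.poly ≤ T) : ∀ (T₁ : ℕ) (H : Finset ℕ),
    (S.poly.support \ H).card ≤ T₁ → H ⊆ S.poly.support →
      (duiLoop S T D T₁ (part S.poly H)).1 = S.poly := by
  intro T₁
  induction T₁ using Nat.strong_induction_on with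
  | _ T₁ ih =>
  intro H hH hHs
  rw [duiLoop]
  split_ifs with h0
  · subst h0
    rw [Nat.le_zero, Finset.card_eq_zero, Finset.sdiff_eq_empty_iff_subset] at hH
    dsimp only
    rw [Finset.Subset.antisymm hHs hH]
    exact S.poly.as_sum_support.symm
  · obtain ⟨hsub, -, hadd, hhalf⟩ := DUIHalf_part hT hD hcard (H := H) T₁
    dsimp only
    rw [hadd]
    exact ih _ (by omega) _ (by omega)
      (Finset.union_subset hHs (hsub.trans Finset.sdiff_subset))

theorem DUIPoly_eq {S : SLP F} {T D : ℕ} (hD : S.poly.natDegree < D)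
    (hcard : numTerms S.poly ≤ T) : DUIPoly S T D = S.poly := by
  have h0 : part S.poly ∅ = 0 := Finset.sum_empty
  rcases Nat.eq_zero_or_pos T with rfl | hT
  · rw [DUIPoly, duiLoop, dif_pos rfl]
    rw [numTerms, Nat.le_zero, Finset.card_eq_zero, support_eq_empty] at hcard
    exact hcard.symm
  · have := duiLoop_fst hT hD hcard T ∅ (by rw [Finset.sdiff_empty]; exact hcard)
      (Finset.empty_subset _)
    rwa [h0] at this

end

/-! ### The table of images -/

section
variable {F : Type u} [Field F]

/-- A list of entries for `r`, where the entry with index `j` belongs to the number `q j`. -/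
def IsTable (w D : ℕ) (q : ℕ → ℕ) (r : F[X]) (es : List (Val F)) : Prop :=
  ∀ (j : ℕ) (h : j < es.length), IsEntry w D (q j) r es[j]

theorem IsTable.tail {w D : ℕ} {q : ℕ → ℕ} {r : F[X]} {e : Val F} {es : List (Val F)}
    (h : IsTable w D q r (e :: es)) : IsTable w D (fun j => q (j + 1)) r es := fun j hj =>
  h (j + 1) (by rw [List.length_cons]; omega)

theorem IsTable.cons {w D : ℕ} {q : ℕ → ℕ} {r : F[X]} {e : Val F} {es : List (Val F)}
    (he : IsEntry w D (q 0) r e) (h : IsTable w D (fun j => q (j + 1)) r es) :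
    IsTable w D q r (e :: es) := by
  rintro (_ | j) hj
  · exact he
  · exact h j (by rw [List.length_cons] at hj; omega)

/-- The straight-line program is evaluated once for each prime, before the first pass. -/
theorem entries_spec (S : SLP F) {w D B : ℕ} (hD : S.poly.natDegree < D) (hDF : D ≤ ringChar F)
    (hw : 4 * B ≤ 2 ^ w) (hL : S.length ≤ 2 ^ w) (n : ℕ) :
    ∀ q : ℕ → ℕ, (∀ i < n, 2 ≤ q i ∧ q i ≤ B) →
    Cl prog 25 (.pair (Val.list ((List.range n).map fun i => .nat (q i)))
        (.pair (.nat D) (Val.list (S.instrs.map Instr.code)))) fun v d =>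
      (∃ es, v = Val.list es ∧ es.length = n ∧ IsTable w D q S.poly es) ∧
        d ≤ (2 * D.size + 200000 * (S.length * (B * (w + 2) ^ 4)) + 30) * (n + 1) := by
  have s0 := Nat.size_zero
  induction n with
  | zero =>
    intro q hq
    refine Cl.intro rfl ?_
    dsimp only [entriesE, List.range_zero, List.map_nil, Val.list, Sym, onSome, Val.onPair,
      Val.split, List.getElem?_cons_zero, List.getElem?_cons_succ]
    exact ⟨⟨[], rfl, rfl, fun j hj => absurd hj (Nat.not_lt_zero j)⟩, by omega⟩
  | succ n ih =>
    intro q hq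
    have h0 := hq 0 (by omega)
    rw [List.range_succ_eq_map, List.map_cons, List.map_map]
    refine Cl.intro rfl ?_
    dsimp only [entriesE, Val.list, Sym, onSome, Val.onPair,
      Val.split, List.getElem?_cons_zero, List.getElem?_cons_succ]
    refine (entry_spec S hD hDF h0.1 (by omega) hL).mono ?_
    rintro e d₁ ⟨he, hd₁⟩
    refine (ih (fun j => q (j + 1)) fun i hi => hq (i + 1) (by omega)).mono ?_
    rintro _ d₂ ⟨⟨es, rfl, hes, ht⟩, hd₂⟩
    refine ⟨⟨e :: es, rfl, by rw [List.length_cons, hes], ht.cons he⟩, ?_⟩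
    have : S.length * (q 0 * (w + 2) ^ 4) ≤ S.length * (B * (w + 2) ^ 4) := by
      gcongr; exact h0.2
    rw [mul_add_one _ (n + 1)]
    omega

theorem numTerms_interleave (f g : F[X]) :
    numTerms (expand F 2 f + X * expand F 2 g) = numTerms f + numTerms g := by
  have h : (expand F 2 f + X * expand F 2 g).support =
      f.support.image (fun i => 2 * i) ∪ g.support.image (fun i => 2 * i + 1) := by
    ext i
    rw [mem_support_iff, Finset.mem_union, Finset.mem_image, Finset.mem_image]
    rcases Nat.even_or_odd' i with ⟨j, rfl | rfl⟩
    · rw [coeff_interleave_even, ← mem_support_iff]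
      refine ⟨fun h => Or.inl ⟨j, h, rfl⟩, ?_⟩
      rintro (⟨i, hi, h⟩ | ⟨i, hi, h⟩)
      · rwa [show j = i by omega]
      · omega
    · rw [coeff_interleave_odd, ← mem_support_iff]
      refine ⟨fun h => Or.inr ⟨j, h, rfl⟩, ?_⟩
      rintro (⟨i, hi, h⟩ | ⟨i, hi, h⟩)
      · omega
      · rwa [show j = i by omega]
  rw [numTerms, h, Finset.card_union_of_disjoint, Finset.card_image_of_injective,
    Finset.card_image_of_injective]
  · rfl
  · intro a b h; dsimp only at h; omega
  · intro a b h; dsimp only at h; omega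
  · rw [Finset.disjoint_left]
    intro i hi hi'
    obtain ⟨a, -, rfl⟩ := Finset.mem_image.1 hi
    obtain ⟨b, -, h⟩ := Finset.mem_image.1 hi'
    omega

theorem numTerms_tpoly_le {k : ℕ} {u : Val F} (hu : Full IsFld k u) :
    numTerms (tpoly u) ≤ 2 ^ k := by
  rw [numTerms, ← Finset.card_range (2 ^ k)]
  refine Finset.card_le_card fun i hi => Finset.mem_range.2 ?_
  by_contra h
  exact mem_support_iff.1 hi (tpoly_coeff_eq_zero hu i (not_lt.1 h))

/-- The number of non-zero leaves is the number of terms. -/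
theorem count_spec (w k : ℕ) (hk : k ≤ w) : ∀ u : Val F, Full IsFld k u →
    Cl prog 26 u fun v d => v = .nat (numTerms (tpoly u)) ∧
      d + (3 * w + 20) ≤ 2 * (3 * w + 20) * 2 ^ k := by
  have s0 := Nat.size_zero
  have s1 := Nat.size_one
  induction k with
  | zero =>
    rintro u ⟨a, rfl⟩
    refine Cl.intro rfl ?_
    dsimp only [countE, Sym, onSome, Val.onPair, Val.onFld, Val.split,
      List.getElem?_cons_zero, List.getElem?_cons_succ]
    rw [numTerms, tpoly]
    refine ⟨fun h => ⟨?_, by omega⟩, fun h => ⟨?_, by omega⟩⟩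
    · rw [h, C_0, support_zero, Finset.card_empty]
    · rw [support_C h, Finset.card_singleton]
  | succ k ih =>
    rintro u ⟨a, b, rfl, ha, hb⟩
    refine Cl.intro rfl ?_
    dsimp only [countE, Sym, onSome, Val.onPair, Val.onFld, Val.onNat, Val.split, NatOp.apply,
      NatOp.cost, List.getElem?_cons_zero, List.getElem?_cons_succ]
    refine (ih (by omega) a ha).mono ?_
    rintro _ d₁ ⟨rfl, hd₁⟩
    refine (ih (by omega) b hb).mono ?_
    rintro _ d₂ ⟨rfl, hd₂⟩
    have hlt : 2 ^ k < 2 ^ w := Nat.pow_lt_pow_right (by norm_num) (by omega)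
    have ha' : (numTerms (tpoly a)).size ≤ w :=
      Nat.size_le.2 (lt_of_le_of_lt (numTerms_tpoly_le ha) hlt)
    have hb' : (numTerms (tpoly b)).size ≤ w :=
      Nat.size_le.2 (lt_of_le_of_lt (numTerms_tpoly_le hb) hlt)
    refine ⟨by rw [tpoly, numTerms_interleave], ?_⟩
    rw [pow_succ, ← mul_assoc, mul_two]
    omega

/-- The first entry with the maximal number of terms. -/
theorem best_spec {w D B : ℕ} (hB : 4 * B < 2 ^ w) {r : F[X]} (es : List (Val F)) (hes : es ≠ []) :
    ∀ q : ℕ → ℕ, (∀ i < es.length, q i ≤ B) → IsTable w D q r es →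
    Cl prog 27 (Val.list es) fun v d =>
      (∃ (i : ℕ) (hi : i < es.length),
        v = .pair (.nat (numTerms (cyc (q i) r))) es[i] ∧
        (∀ j < es.length, numTerms (cyc (q j) r) ≤ numTerms (cyc (q i) r)) ∧
        (∀ j < i, numTerms (cyc (q j) r) < numTerms (cyc (q i) r))) ∧
      d ≤ (2 * (3 * w + 20) * (4 * B) + 2 * w + 40) * es.length := by
  induction es with
  | nil => exact absurd rfl hes
  | cons e es ih =>
    intro q hq ht
    obtain ⟨k, v, rfl, ⟨u, u', rfl, hu, hu', hup, hup'⟩, hk, hkp, -⟩ := ht 0 (by simp)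
    have hq0 := hq 0 (by simp)
    have hnt : ∀ t : F[X], ∀ p k, ∀ u : Val F, Full IsFld k u → tpoly u = cyc p t → p ≤ B →
        2 ^ k ≤ 4 * p → (numTerms (cyc p t)).size ≤ w := by
      intro t p k u hu h hp hk
      rw [← h]
      have := numTerms_tpoly_le hu
      exact Nat.size_le.2 (by omega)
    have hs := hnt r _ _ u hu hup hq0 hkp
    have hcount : 2 * (3 * w + 20) * 2 ^ k ≤ 2 * (3 * w + 20) * (4 * B) :=
      Nat.mul_le_mul_left _ (by omega)
    refine Cl.intro rfl ?_
    dsimp only [bestE, Val.list, Sym, onSome, Val.onPair,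
      Val.split, List.getElem?_cons_zero, List.getElem?_cons_succ]
    refine (count_spec w k hk u hu).mono ?_
    rintro _ d₁ ⟨rfl, hd₁⟩
    cases es with
    | nil =>
      dsimp only [Val.list, Val.onPair]
      refine ⟨⟨0, by simp, by rw [hup]; rfl, ?_, fun j hj => absurd hj (Nat.not_lt_zero j)⟩, ?_⟩
      · intro j hj
        rw [List.length_singleton] at hj
        rw [show j = 0 by omega]
      · rw [List.length_singleton, mul_one]
        omega
    | cons e' es =>
      dsimp only [Val.list, Val.onPair]
      refine (ih (by simp) (fun j => q (j + 1))
        (fun i hi => hq (i + 1) (by rw [List.length_cons]; omega)) ht.tail).mono ?_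
      rintro _ d₂ ⟨⟨i, hi, rfl, hmax, hfirst⟩, hd₂⟩
      have hsi : (numTerms (cyc (q (i + 1)) r)).size ≤ w := by
        obtain ⟨k', v', -, ⟨u₁, u₁', -, hu₁, -, hup₁, -⟩, -, hkp', -⟩ := ht.tail i hi
        exact hnt r _ _ u₁ hu₁ hup₁ (hq (i + 1) (by rw [List.length_cons]; omega)) hkp'
      dsimp only [Val.onNat, Val.onPair]
      rw [hup]
      have hlen : ∀ A : ℕ, ∀ a : Val F, A * (a :: e' :: es).length = A * (e' :: es).length + A :=
        fun A a => mul_add_one _ _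
      have hbound := hlen (2 * (3 * w + 20) * (4 * B) + 2 * w + 40)
        (.pair (.nat (q 0)) (.pair (.nat k) (.pair u u')))
      refine ⟨fun h => ⟨⟨i + 1, Nat.succ_lt_succ hi, rfl, ?_, ?_⟩, by omega⟩,
        fun h => ⟨⟨0, Nat.succ_pos _, rfl, ?_, fun j hj => absurd hj (Nat.not_lt_zero j)⟩,
          by omega⟩⟩
      · rintro (_ | j) hj
        · exact h.le
        · exact hmax j (Nat.lt_of_succ_lt_succ hj)
      · rintro (_ | j) hj
        · exact h
        · exact hfirst j (by omega)
      · rintro (_ | j) hj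
        · exact le_rfl
        · exact (hmax j (Nat.lt_of_succ_lt_succ hj)).trans (not_lt.1 h)

/-- The price of one access to an entry. -/
def accCost (w s : ℕ) : ℕ := (s + 1) * (w + 1) + opCost w * (w + 1)

open scoped Classical in
theorem cert_spec {w D : ℕ} (hw : 2 ≤ w) {r : F[X]} {c : F} {d : ℕ} (hd : d < D) (n : ℕ)
    (hn : n < 2 ^ w) : ∀ (es : List (Val F)) (q : ℕ → ℕ), n ≤ es.length →
    (∀ i < es.length, 0 < q i ∧ q i < 2 ^ w) → IsTable w D q r es →
    Cl prog 28 (.pair (.nat n) (.pair (Val.list es) (.pair (.fld c) (.nat d)))) fun v b =>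
      v = .nat (Nat.count (fun j => (cyc (q j) r).coeff (d % q j) = c) n) ∧
        b ≤ 20 * accCost w D.size * (n + 1) := by
  have s0 := Nat.size_zero
  have s1 := Nat.size_one
  have hK := le_opCost w
  have hK2 : 3 * opCost w ≤ opCost w * (w + 1) := by
    rw [mul_comm]; exact Nat.mul_le_mul_left _ (by omega)
  have hds : d.size ≤ D.size := Nat.size_le_size hd.le
  induction n with
  | zero =>
    intro es q _ _ _
    refine Cl.intro rfl ?_
    dsimp only [certE, Sym, onSome, Val.onPair, Val.onNat, Val.split,
      List.getElem?_cons_zero, List.getElem?_cons_succ]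
    refine ⟨fun _ => ⟨rfl, ?_⟩, fun h => absurd h (by omega)⟩
    unfold accCost
    omega
  | succ n ih =>
    intro es q hlen hq ht
    cases es with
    | nil => simp at hlen
    | cons e es =>
      rw [List.length_cons] at hlen hq
      obtain ⟨k, v, rfl, ⟨u, u', rfl, hu, hu', hup, hup'⟩, hk, hkp, hmod⟩ := ht 0 (by simp)
      obtain ⟨hq0, hq1⟩ := hq 0 (by omega)
      have hqs : (q 0).size ≤ w := Nat.size_le.2 hq1
      have hns : (n + 1).size ≤ w := Nat.size_le.2 hn
      have hi := hmod d hd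
      have his : (d % q 0).size ≤ w := Nat.size_le.2 ((Nat.mod_lt _ hq0).trans hq1)
      have c1 : NatOp.cost .sub (n + 1) 1 ≤ opCost w := cost_le_opCost _ hns (by omega)
      have c2 : NatOp.cost .mod d (q 0) ≤ (D.size + 1) * (w + 1) := by
        dsimp only [NatOp.cost]; gcongr
      have c3 : 10 * opCost w * (k + 1) ≤ 10 * (opCost w * (w + 1)) := by
        rw [mul_assoc]; gcongr
      have hcnt : ∀ P : ℕ → Prop, ∀ [DecidablePred P], (Nat.count P n).size ≤ w := fun P _ =>
        Nat.size_le.2 (lt_of_le_of_lt (Nat.count_le P) (by omega))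
      have c4 : ∀ P : ℕ → Prop, ∀ [DecidablePred P], ∀ b ≤ 1,
          NatOp.cost .add b (Nat.count P n) ≤ opCost w := fun P _ b hb =>
        cost_le_opCost _ ((size_le_of_le hb).trans (by omega)) (hcnt P)
      refine Cl.intro rfl ?_
      dsimp only [certE, Val.list, Sym, onSome, Val.onPair, Val.onNat, Val.onFld, Val.split,
        NatOp.apply, List.getElem?_cons_zero, List.getElem?_cons_succ, Nat.add_one_sub_one]
      refine ⟨fun h => absurd h (by omega), fun _ => ?_⟩
      refine (get_spec w hw IsFld k hk _ u his hu).mono ?_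
      rintro _ d₁ ⟨rfl, hd₁⟩
      rw [leaf_eq_coeff k u _ hu hi, hup]
      dsimp only
      have hrec := ih (by omega) es (fun j => q (j + 1)) (by omega)
        (fun i hi => hq (i + 1) (by omega)) ht.tail
      rw [mul_add_one (20 * accCost w D.size), Nat.count_succ', add_comm (Nat.count _ n)]
      refine ⟨fun h => hrec.mono ?_, fun h => hrec.mono ?_⟩
      · rintro _ d₂ ⟨rfl, hd₂⟩
        refine ⟨by rw [if_pos h], ?_⟩
        have := c4 (fun j => (cyc (q (j + 1)) r).coeff (d % q (j + 1)) = c) 1 le_rfl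
        have : 20 * accCost w D.size = 20 * ((D.size + 1) * (w + 1)) +
          20 * (opCost w * (w + 1)) := by unfold accCost; ring
        omega
      · rintro _ d₂ ⟨rfl, hd₂⟩
        refine ⟨by rw [if_neg h], ?_⟩
        have := c4 (fun j => (cyc (q (j + 1)) r).coeff (d % q (j + 1)) = c) 0 (by omega)
        have : 20 * accCost w D.size = 20 * ((D.size + 1) * (w + 1)) +
          20 * (opCost w * (w + 1)) := by unfold accCost; ring
        omega

end

/-! ### Sorted lists of terms -/

section
variable {F : Type u} [Field F]

/-- The item of a term `c x^d` of `f`: the term, and the coefficient `d c` of the term of `x f'`. -/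
def item (f : F[X]) (d : ℕ) : Val F :=
  .pair (.pair (.fld (f.coeff d)) (.nat d)) (.fld (d * f.coeff d))

/-- Insertion of an exponent into an increasing list; an exponent that occurs already is not
repeated. -/
theorem insert_spec (f : F[X]) {s d : ℕ} (hd : d.size ≤ s) (l : List ℕ) (hl : ∀ x ∈ l, x.size ≤ s)
    (hs : l.Pairwise (· < ·)) :
    Cl prog 30 (.pair (item f d) (Val.list (l.map (item f)))) fun v b =>
      (∃ l' : List ℕ, v = Val.list (l'.map (item f)) ∧ l'.Pairwise (· < ·) ∧
        ∀ x, x ∈ l' ↔ x = d ∨ x ∈ l) ∧ b ≤ (4 * s + 60) * (l.length + 1) := by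
  have s0 := Nat.size_zero
  induction l with
  | nil =>
    refine Cl.intro rfl ?_
    dsimp only [insertE, List.map_nil, Val.list, item, Sym, onSome, Val.onPair, Val.onNat,
      Val.split, List.getElem?_cons_zero, List.getElem?_cons_succ]
    exact ⟨⟨[d], rfl, List.pairwise_singleton _ _, by simp⟩, by rw [List.length_nil]; omega⟩
  | cons a l ih =>
    have ha := hl a (by simp)
    obtain ⟨hal, hs'⟩ := List.pairwise_cons.1 hs
    have hlen : (4 * s + 60) * ((a :: l).length + 1) =
        (4 * s + 60) * (l.length + 1) + (4 * s + 60) := mul_add_one _ _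
    refine Cl.intro rfl ?_
    dsimp only [insertE, List.map_cons, Val.list, item, Sym, onSome, Val.onPair, Val.onNat,
      Val.split, List.getElem?_cons_zero, List.getElem?_cons_succ]
    refine ⟨fun h => ⟨⟨d :: a :: l, rfl, ?_, by simp⟩, by omega⟩,
      fun h => ⟨fun h' => ?_, fun h' => ⟨⟨a :: l, rfl, hs, ?_⟩, by omega⟩⟩⟩
    · refine List.pairwise_cons.2 ⟨fun x hx => ?_, hs⟩
      rcases List.mem_cons.1 hx with rfl | hx
      · exact h
      · exact h.trans (hal x hx)
    · refine (ih (fun x hx => hl x (List.mem_cons_of_mem _ hx)) hs').mono ?_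
      rintro _ b ⟨⟨l', rfl, hl', hmem⟩, hb⟩
      refine ⟨⟨a :: l', rfl, List.pairwise_cons.2 ⟨fun x hx => ?_, hl'⟩, fun x => ?_⟩, by omega⟩
      · rcases (hmem x).1 hx with rfl | hx
        · exact h'
        · exact hal x hx
      · rw [List.mem_cons, List.mem_cons, hmem]
        tauto
    · obtain rfl : a = d := by omega
      intro x
      simp

theorem length_le_card {l : List ℕ} (hl : l.Pairwise (· < ·)) {R : Finset ℕ} (h : ∀ x ∈ l, x ∈ R) :
    l.length ≤ R.card := by
  rw [← List.toFinset_card_of_nodup (hl.imp fun h => h.ne)]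
  exact Finset.card_le_card fun x hx => h x (List.mem_toFinset.1 hx)

theorem merge_spec (f : F[X]) {s T : ℕ} {R : Finset ℕ} (hR : ∀ x ∈ R, x.size ≤ s) (hT : R.card ≤ T)
    (l₁ : List ℕ) : ∀ l₂ : List ℕ, (∀ x ∈ l₁, x ∈ R) → (∀ x ∈ l₂, x ∈ R) → l₂.Pairwise (· < ·) →
    Cl prog 34 (.pair (Val.list (l₁.map (item f))) (Val.list (l₂.map (item f)))) fun v b =>
      (∃ l : List ℕ, v = Val.list (l.map (item f)) ∧ l.Pairwise (· < ·) ∧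
        ∀ x, x ∈ l ↔ x ∈ l₁ ∨ x ∈ l₂) ∧
        b ≤ ((4 * s + 60) * (T + 1) + 30) * (l₁.length + 1) := by
  induction l₁ with
  | nil =>
    intro l₂ _ h₂ hs
    refine Cl.intro rfl ?_
    dsimp only [mergeE, List.map_nil, Val.list, Sym, onSome, Val.onPair,
      Val.split, List.getElem?_cons_zero, List.getElem?_cons_succ]
    refine ⟨⟨l₂, rfl, hs, by simp⟩, ?_⟩
    rw [List.length_nil, zero_add, mul_one]
    omega
  | cons a l₁ ih =>
    intro l₂ h₁ h₂ hs
    have hlen : ((4 * s + 60) * (T + 1) + 30) * ((a :: l₁).length + 1) =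
      ((4 * s + 60) * (T + 1) + 30) * (l₁.length + 1) + ((4 * s + 60) * (T + 1) + 30) :=
      mul_add_one _ _
    have haR := h₁ a (by simp)
    have hlen₂ := (length_le_card hs h₂).trans hT
    have hb' : (4 * s + 60) * (l₂.length + 1) ≤ (4 * s + 60) * (T + 1) := by gcongr
    refine Cl.intro rfl ?_
    dsimp only [mergeE, List.map_cons, Val.list, Sym, onSome, Val.onPair,
      Val.split, List.getElem?_cons_zero, List.getElem?_cons_succ]
    refine (insert_spec f (hR a haR) l₂ (fun x hx => hR x (h₂ x hx)) hs).mono ?_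
    rintro _ b ⟨⟨l, rfl, hl, hmem⟩, hb⟩
    refine (ih l (fun x hx => h₁ x (List.mem_cons_of_mem _ hx)) (fun x hx => ?_) hl).mono ?_
    · rcases (hmem x).1 hx with rfl | hx
      · exact haR
      · exact h₂ x hx
    · rintro _ b' ⟨⟨l', rfl, hl', hmem'⟩, hb'⟩
      refine ⟨⟨l', rfl, hl', fun x => ?_⟩, by omega⟩
      rw [hmem', hmem, List.mem_cons]
      tauto

theorem strip_spec (f : F[X]) (l : List ℕ) :
    Cl prog 35 (Val.list (l.map (item f))) fun v b =>
      v = Val.list (l.map fun d => .pair (.fld (f.coeff d)) (.nat d)) ∧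
        b ≤ 30 * (l.length + 1) := by
  have s0 := Nat.size_zero
  induction l with
  | nil =>
    refine Cl.intro rfl ?_
    dsimp only [stripE, List.map_nil, Val.list, Sym, onSome, Val.onPair,
      Val.split, List.getElem?_cons_zero, List.getElem?_cons_succ]
    exact ⟨rfl, by rw [List.length_nil]; omega⟩
  | cons a l ih =>
    refine Cl.intro rfl ?_
    dsimp only [stripE, List.map_cons, Val.list, item, Sym, onSome, Val.onPair,
      Val.split, List.getElem?_cons_zero, List.getElem?_cons_succ]
    refine Cl.mono ih ?_
    rintro _ b ⟨rfl, hb⟩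
    exact ⟨rfl, by rw [List.length_cons]; omega⟩

theorem sort_eq_of_pairwise {l : List ℕ} (hl : l.Pairwise (· < ·)) {A : Finset ℕ}
    (h : ∀ x, x ∈ l ↔ x ∈ A) : A.sort (· ≤ ·) = l := by
  have : A = l.toFinset := by ext x; rw [List.mem_toFinset, h]
  rw [this]
  exact (List.toFinset_sort (· ≤ ·) (hl.imp fun h => h.ne)).2 (hl.imp fun h => h.le)

/-- A stripped list is a sparse representation. -/
theorem sparseVal_part {f : F[X]} {l : List ℕ} (hl : l.Pairwise (· < ·)) {A : Finset ℕ}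
    (h : ∀ x, x ∈ l ↔ x ∈ A) (hA : A ⊆ f.support) :
    sparseVal (part f A) = Val.list (l.map fun d => .pair (.fld (f.coeff d)) (.nat d)) := by
  rw [sparseVal, support_part hA, sort_eq_of_pairwise hl h]
  congr 1
  refine List.map_congr_left fun d hd => ?_
  rw [coeff_part, if_pos ((h d).1 hd)]

/-! ### Subtraction of terms from the table -/

/-- When a term is subtracted, one leaf of each tree changes; the straight-line program is not
evaluated again. -/
theorem subItem_spec {w D p : ℕ} (hw : 2 ≤ w) (hp : 0 < p) (hpw : p < 2 ^ w) {r e : _}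
    (he : IsEntry w D p r e) (f : F[X]) {d : ℕ} (hd : d < D) :
    Cl prog 31 (.pair e (item f d)) fun v b =>
      IsEntry w D p (r - monomial d (f.coeff d)) v ∧ b ≤ 50 * accCost w D.size := by
  obtain ⟨k, v, rfl, ⟨u, u', rfl, hu, hu', hup, hup'⟩, hk, hkp, hmod⟩ := he
  have hK := le_opCost w
  have hK2 : 3 * opCost w ≤ opCost w * (w + 1) := by
    rw [mul_comm]; exact Nat.mul_le_mul_left _ (by omega)
  have hds : d.size ≤ D.size := Nat.size_le_size hd.le
  have hps : p.size ≤ w := Nat.size_le.2 hpw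
  have hi := hmod d hd
  have his : (d % p).size ≤ w := Nat.size_le.2 ((Nat.mod_lt _ hp).trans hpw)
  have c2 : NatOp.cost .mod d p ≤ (D.size + 1) * (w + 1) := by
    dsimp only [NatOp.cost]; gcongr
  have c3 : 10 * opCost w * (k + 1) ≤ 10 * (opCost w * (w + 1)) := by
    rw [mul_assoc]; gcongr
  have hder : (X : F[X]) * derivative (monomial d (f.coeff d)) = monomial d (d * f.coeff d) := by
    ext i
    rw [coeff_X_mul_derivative, coeff_monomial, coeff_monomial]
    split_ifs with h
    · rw [h]
    · rw [mul_zero]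
  refine Cl.intro rfl ?_
  dsimp only [subItemE, item, Sym, onSome, Val.onPair, Val.onNat, Val.onFld, Val.split,
    NatOp.apply, FldOp.apply, List.getElem?_cons_zero, List.getElem?_cons_succ]
  refine (get_spec w hw IsFld k hk _ u his hu).mono ?_
  rintro _ d₁ ⟨rfl, hd₁⟩
  rw [leaf_eq_coeff k u _ hu hi]
  dsimp only
  refine (setFld_spec w hw _ hk hi hu).mono ?_
  rintro t d₂ ⟨⟨ht, htp⟩, hd₂⟩
  refine (get_spec w hw IsFld k hk _ u' his hu').mono ?_
  rintro _ d₃ ⟨rfl, hd₃⟩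
  rw [leaf_eq_coeff k u' _ hu' hi]
  dsimp only
  refine (setFld_spec w hw _ hk hi hu').mono ?_
  rintro t' d₄ ⟨⟨ht', htp'⟩, hd₄⟩
  refine ⟨⟨k, _, rfl, ⟨t, t', rfl, ht, ht', ?_, ?_⟩, hk, hkp, hmod⟩, ?_⟩
  · rw [htp, sub_sub_cancel_left, map_neg, ← sub_eq_add_neg, hup, cyc_sub, cyc_monomial hp]
  · rw [htp', sub_sub_cancel_left, map_neg, ← sub_eq_add_neg, hup', derivative_sub, mul_sub,
      cyc_sub, hder, cyc_monomial hp]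
  · have : 50 * accCost w D.size = 50 * ((D.size + 1) * (w + 1)) +
      50 * (opCost w * (w + 1)) := by unfold accCost; ring
    omega

theorem subItems_spec {w D p : ℕ} (hw : 2 ≤ w) (hp : 0 < p) (hpw : p < 2 ^ w) (f : F[X])
    (l : List ℕ) (hl : ∀ x ∈ l, x < D) : ∀ {r e}, IsEntry w D p r e →
    Cl prog 32 (.pair e (Val.list (l.map (item f)))) fun v b =>
      IsEntry w D p (r - (l.map fun d => monomial d (f.coeff d)).sum) v ∧
        b ≤ 60 * accCost w D.size * (l.length + 1) := by
  have hK := le_opCost w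
  have hacc : opCost w ≤ accCost w D.size :=
    (Nat.le_mul_of_pos_right _ (by omega)).trans (Nat.le_add_left _ _)
  induction l with
  | nil =>
    intro r e he
    refine Cl.intro rfl ?_
    dsimp only [subItemsE, List.map_nil, Val.list, Sym, onSome, Val.onPair,
      Val.split, List.getElem?_cons_zero, List.getElem?_cons_succ]
    refine ⟨by rwa [List.map_nil, List.sum_nil, sub_zero], ?_⟩
    rw [List.length_nil, zero_add, mul_one]
    omega
  | cons a l ih =>
    intro r e he
    have hlen : 60 * accCost w D.size * ((a :: l).length + 1) =
      60 * accCost w D.size * (l.length + 1) + 60 * accCost w D.size := mul_add_one _ _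
    refine Cl.intro rfl ?_
    dsimp only [subItemsE, List.map_cons, Val.list, Sym, onSome, Val.onPair,
      Val.split, List.getElem?_cons_zero, List.getElem?_cons_succ]
    refine (subItem_spec hw hp hpw he f (hl a (by simp))).mono ?_
    rintro e' b ⟨he', hb⟩
    refine (ih (fun x hx => hl x (List.mem_cons_of_mem _ hx)) he').mono ?_
    rintro v b' ⟨hv, hb'⟩
    refine ⟨by rwa [List.map_cons, List.sum_cons, ← sub_sub], by omega⟩

theorem subEntries_spec {w D : ℕ} (hw : 2 ≤ w) (f : F[X])
    (l : List ℕ) (hl : ∀ x ∈ l, x < D) {r : F[X]} (es : List (Val F)) : ∀ q : ℕ → ℕ,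
    (∀ i < es.length, 0 < q i ∧ q i < 2 ^ w) → IsTable w D q r es →
    Cl prog 33 (.pair (Val.list es) (Val.list (l.map (item f)))) fun v b =>
      (∃ es', v = Val.list es' ∧ es'.length = es.length ∧
        IsTable w D q (r - (l.map fun d => monomial d (f.coeff d)).sum) es') ∧
        b ≤ (60 * accCost w D.size * (l.length + 1) + 30) * (es.length + 1) := by
  have s0 := Nat.size_zero
  induction es with
  | nil =>
    intro q hq ht
    refine Cl.intro rfl ?_
    dsimp only [subEntriesE, Val.list, Sym, onSome, Val.onPair,
      Val.split, List.getElem?_cons_zero, List.getElem?_cons_succ]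
    refine ⟨⟨[], rfl, rfl, fun j hj => absurd hj (Nat.not_lt_zero j)⟩, ?_⟩
    rw [List.length_nil, zero_add, mul_one]
    omega
  | cons e es ih =>
    intro q hq ht
    have hlen : (60 * accCost w D.size * (l.length + 1) + 30) * ((e :: es).length + 1) =
      (60 * accCost w D.size * (l.length + 1) + 30) * (es.length + 1) +
        (60 * accCost w D.size * (l.length + 1) + 30) := mul_add_one _ _
    refine Cl.intro rfl ?_
    dsimp only [subEntriesE, Val.list, Sym, onSome, Val.onPair,
      Val.split, List.getElem?_cons_zero, List.getElem?_cons_succ]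
    obtain ⟨hq0, hq1⟩ := hq 0 (Nat.succ_pos _)
    refine (subItems_spec hw hq0 hq1 f l hl (ht 0 (Nat.succ_pos _))).mono ?_
    rintro e' b ⟨he', hb⟩
    refine (ih (fun j => q (j + 1)) (fun i hi => hq (i + 1) (Nat.succ_lt_succ hi)) ht.tail).mono ?_
    rintro _ b' ⟨⟨es', rfl, hes', ht'⟩, hb'⟩
    refine ⟨⟨e' :: es', rfl, by rw [List.length_cons, hes', List.length_cons], ht'.cons he'⟩,
      by omega⟩

end

/-! ### Collection of the terms that are found -/

section
variable {F : Type u} [Field F]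

theorem natCast_injOn_of_le_ringChar {D a b : ℕ} (hD : D ≤ ringChar F) (ha : a < D) (hb : b < D)
    (h : (a : F) = b) : a = b :=
  CharP.natCast_injOn_Iio F (ringChar F) (Set.mem_Iio.2 (by omega)) (Set.mem_Iio.2 (by omega)) h

theorem readNat_le (a : F) (D : ℕ) : readNat a D ≤ D := Nat.sInf_le (Or.inr rfl)

theorem natCast_readNat {a : F} {D : ℕ} (h : readNat a D < D) : (readNat a D : F) = a := by
  rcases Nat.sInf_mem (s := {k : ℕ | (k : F) = a ∨ k = D}) ⟨D, Or.inr rfl⟩ with h' | h'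
  · exact h'
  · exact absurd h' h.ne

theorem readNat_eq {a : F} {D d : ℕ} (hD : D ≤ ringChar F) (hd : d < D) (h : (d : F) = a) :
    readNat a D = d := by
  have hle : readNat a D ≤ d := Nat.sInf_le (Or.inl h)
  exact natCast_injOn_of_le_ringChar hD (by omega) hd ((natCast_readNat (by omega)).trans h.symm)

open scoped Classical in
/-- The coefficients `c` and `h` of images of `r` and `x r'` yield the candidate term `c x^d`, and
at least `m` of the first `n` images of `r` have the coefficient `c` at the residue of `d`. -/
def Accepts (r : F[X]) (q : ℕ → ℕ) (D n m : ℕ) (c h : F) (d : ℕ) : Prop :=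
  c ≠ 0 ∧ d < D ∧ (d : F) = h / c ∧
    m ≤ Nat.count (fun j => (cyc (q j) r).coeff (d % q j) = c) n

/-- The price of one candidate term. -/
def candCost (w s n T : ℕ) : ℕ := 40 * accCost w s * (n + 1) + (4 * s + 60) * (T + 1)

/-- The collection of the accepted exponents, by recursion on the two trees. The set `R` is the
support of the polynomial `f` in the application; membership in `R` bounds the length of the list
at any time. The cost of the tests is charged to the non-zero coefficients of the image. -/
theorem collect_spec {w D n m T : ℕ} (hw : 2 ≤ w) (hDF : D ≤ ringChar F) {r f : F[X]}
    {q : ℕ → ℕ} {es : List (Val F)} (hq : ∀ i < es.length, 0 < q i ∧ q i < 2 ^ w)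
    (ht : IsTable w D q r es) (hn : n < 2 ^ w) (hm : m < 2 ^ w) (hnes : n ≤ es.length)
    {R : Finset ℕ} (hR : ∀ x ∈ R, x < D) (hT : R.card ≤ T) (k : ℕ) :
    ∀ (u u' : Val F) (l : List ℕ), Full IsFld k u → Full IsFld k u' →
    (∀ i < 2 ^ k, ∀ d, Accepts r q D n m ((tpoly u).coeff i) ((tpoly u').coeff i) d →
      d ∈ R ∧ f.coeff d = (tpoly u).coeff i) →
    (∀ x ∈ l, x ∈ R) → l.Pairwise (· < ·) →
    Cl prog 29 (.pair (.pair (.nat D) (.pair (.nat n) (.pair (.nat m) (Val.list es))))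
        (.pair (Val.list (l.map (item f))) (.pair u u'))) fun v b =>
      (∃ l' : List ℕ, v = Val.list (l'.map (item f)) ∧ l'.Pairwise (· < ·) ∧
        (∀ x ∈ l', x ∈ R) ∧ ∀ x, x ∈ l' ↔ x ∈ l ∨ ∃ i < 2 ^ k,
          Accepts r q D n m ((tpoly u).coeff i) ((tpoly u').coeff i) x) ∧
        b + 40 ≤ 80 * 2 ^ k + numTerms (tpoly u) * candCost w D.size n T := by
  have hK := le_opCost w
  have hK2 : 3 * opCost w ≤ opCost w * (w + 1) := by
    rw [mul_comm]; exact Nat.mul_le_mul_left _ (by omega)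
  have hns : n.size ≤ w := Nat.size_le.2 hn
  have hms : m.size ≤ w := Nat.size_le.2 hm
  induction k with
  | zero =>
    rintro u u' l ⟨c, rfl⟩ ⟨h, rfl⟩ hgood hl hs
    have hgood' : ∀ d, Accepts r q D n m c h d → d ∈ R ∧ f.coeff d = c := by
      simpa [tpoly] using hgood
    have hiff : ∀ x, (∃ i < 1, Accepts r q D n m ((tpoly (.fld c : Val F)).coeff i)
        ((tpoly (.fld h : Val F)).coeff i) x) ↔ Accepts r q D n m c h x := by
      intro x
      simp [tpoly]
    have hdsize : (readNat (h / c) D).size ≤ D.size := Nat.size_le_size (readNat_le _ _)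
    have hnot : ∀ C : Prop, (∀ x, ¬ Accepts r q D n m c h x) → C →
        (∃ l' : List ℕ, Val.list (l.map (item f)) = Val.list (l'.map (item f)) ∧
        l'.Pairwise (· < ·) ∧
        (∀ x ∈ l', x ∈ R) ∧ ∀ x, x ∈ l' ↔ x ∈ l ∨ ∃ i < 2 ^ 0,
          Accepts r q D n m ((tpoly (.fld c : Val F)).coeff i)
            ((tpoly (.fld h : Val F)).coeff i) x) ∧ C := by
      intro C hno hC
      refine ⟨⟨l, rfl, hs, hl, fun x => ?_⟩, hC⟩
      rw [pow_zero, hiff]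
      exact ⟨Or.inl, fun h => h.resolve_right (hno x)⟩
    refine Cl.intro rfl ?_
    dsimp only [collectE, Sym, onSome, Val.onPair, Val.onNat, Val.onFld, Val.split, FldOp.apply,
      List.getElem?_cons_zero, List.getElem?_cons_succ]
    refine ⟨fun hc => hnot _ (fun x hx => hx.1 hc) (by omega), fun hc => ?_⟩
    have hone : numTerms (tpoly (.fld c : Val F)) = 1 := by
      rw [numTerms, tpoly, support_C hc, Finset.card_singleton]
    have hcost : accCost w D.size = (D.size + 1) * (w + 1) + opCost w * (w + 1) := rfl
    have hs1 : D.size ≤ (D.size + 1) * (w + 1) :=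
      (Nat.le_succ _).trans (Nat.le_mul_of_pos_right _ (by omega))
    have hcand : candCost w D.size n T = 20 * accCost w D.size * (n + 1) +
        (4 * D.size + 60) * (T + 1) + 20 * (accCost w D.size * (n + 1)) := by
      unfold candCost; ring
    have hacc : accCost w D.size ≤ accCost w D.size * (n + 1) :=
      Nat.le_mul_of_pos_right _ (by omega)
    rw [hone, one_mul, pow_zero]
    refine ⟨fun hd => ?_, fun hd => hnot _ (fun x hx => ?_) (by omega)⟩
    · have hcast := natCast_readNat hd
      obtain ⟨d, hd_eq⟩ : ∃ d, readNat (h / c) D = d := ⟨_, rfl⟩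
      rw [hd_eq] at hd hcast hdsize ⊢
      refine (cert_spec hw hd n hn es q hnes hq ht).mono ?_
      rintro _ d₁ ⟨rfl, hd₁⟩
      classical
      obtain ⟨a, ha⟩ : ∃ a, Nat.count (fun j => (cyc (q j) r).coeff (d % q j) = c) n = a :=
        ⟨_, rfl⟩
      have has : a.size ≤ w :=
        Nat.size_le.2 (lt_of_le_of_lt (ha ▸ Nat.count_le _) hn)
      have hacceq : ∀ x, Accepts r q D n m c h x ↔ x = d ∧ m ≤ a := by
        intro x
        constructor
        · rintro ⟨-, hx, hxq, hcount⟩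
          obtain rfl : d = x := by rw [← hd_eq]; exact readNat_eq hDF hx hxq
          refine ⟨rfl, ?_⟩
          rw [← ha]
          convert hcount
        · rintro ⟨rfl, hma⟩
          refine ⟨hc, hd, hcast, ?_⟩
          rw [← ha] at hma
          convert hma
      rw [show ∀ i : DecidablePred fun j => (cyc (q j) r).coeff (d % q j) = c,
        @Nat.count (fun j => (cyc (q j) r).coeff (d % q j) = c) i n = a from fun i => by
          rw [← ha]; congr]
      dsimp only [Val.onNat]
      refine ⟨fun hlt => hnot _ (fun x hx => ?_) (by omega), fun hge => ?_⟩
      · have := ((hacceq x).1 hx).2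
        omega
      · have hAcc := (hacceq d).2 ⟨rfl, not_lt.1 hge⟩
        obtain ⟨hdR, hfd⟩ := hgood' d hAcc
        have hitem : (.pair (.pair (.fld c) (.nat d)) (.fld h) : Val F) = item f d := by
          rw [item, hfd, hcast, div_mul_cancel₀ _ hc]
        rw [hitem]
        have hlen := (length_le_card hs hl).trans hT
        have hlen' : (4 * D.size + 60) * (l.length + 1) ≤ (4 * D.size + 60) * (T + 1) := by gcongr
        refine (insert_spec f hdsize l (fun x hx => Nat.size_le_size (hR x (hl x hx)).le)
          hs).mono ?_
        rintro _ d₂ ⟨⟨l', rfl, hl', hmem⟩, hd₂⟩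
        refine ⟨⟨l', rfl, hl', fun x hx => ?_, fun x => ?_⟩, by omega⟩
        · rcases (hmem x).1 hx with rfl | hx
          · exact hdR
          · exact hl x hx
        · rw [hmem, hiff, hacceq, or_comm]
          exact or_congr_right ⟨fun h => ⟨h, not_lt.1 hge⟩, fun h => h.1⟩
    · exact absurd (readNat_eq hDF hx.2.1 hx.2.2.1 ▸ hx.2.1) hd
  | succ k ih =>
    rintro u u' l ⟨a, b, rfl, ha, hb⟩ ⟨a', b', rfl, ha', hb'⟩ hgood hl hs
    rw [tpoly, tpoly] at hgood ⊢
    have hpow : 2 ^ (k + 1) = 2 * 2 ^ k := pow_succ' 2 k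
    refine Cl.intro rfl ?_
    dsimp only [collectE, Sym, onSome, Val.onPair, Val.onNat, Val.onFld, Val.split,
      List.getElem?_cons_zero, List.getElem?_cons_succ]
    refine (ih a a' l ha ha' (fun i hi d hd => ?_) hl hs).mono ?_
    · have := hgood (2 * i) (by omega) d
      rw [coeff_interleave_even, coeff_interleave_even] at this
      exact this hd
    rintro _ d₁ ⟨⟨l₁, rfl, hs₁, hl₁, hmem₁⟩, hd₁⟩
    refine (ih b b' l₁ hb hb' (fun i hi d hd => ?_) hl₁ hs₁).mono ?_
    · have := hgood (2 * i + 1) (by omega) d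
      rw [coeff_interleave_odd, coeff_interleave_odd] at this
      exact this hd
    rintro _ d₂ ⟨⟨l₂, rfl, hs₂, hl₂, hmem₂⟩, hd₂⟩
    refine ⟨⟨l₂, rfl, hs₂, hl₂, fun x => ?_⟩, ?_⟩
    · rw [hmem₂, hmem₁, or_assoc]
      refine or_congr_right ⟨?_, ?_⟩
      · rintro (⟨i, hi, h⟩ | ⟨i, hi, h⟩)
        · exact ⟨2 * i, by omega, by rwa [coeff_interleave_even, coeff_interleave_even]⟩
        · exact ⟨2 * i + 1, by omega, by rwa [coeff_interleave_odd, coeff_interleave_odd]⟩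
      · rintro ⟨i, hi, h⟩
        rcases Nat.even_or_odd' i with ⟨j, rfl | rfl⟩
        · rw [coeff_interleave_even, coeff_interleave_even] at h
          exact Or.inl ⟨j, by omega, h⟩
        · rw [coeff_interleave_odd, coeff_interleave_odd] at h
          exact Or.inr ⟨j, by omega, h⟩
    · rw [numTerms_interleave, add_mul]
      omega

end

/-! ### The loop -/

section
variable {F : Type u} [Field F]

/-- The exponents found in one pass are those accepted from the images at the selected prime. -/
theorem mem_found_iff {S : SLP F} {fs : F[X]} {T D k d : ℕ} {u u' : F[X]}
    (hu : u = cyc (pr (bestIndex S fs T D)) (S.poly - fs))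
    (hu' : u' = cyc (pr (bestIndex S fs T D)) (X * derivative (S.poly - fs)))
    (hk : ∀ i, 2 ^ k ≤ i → u.coeff i = 0) :
    d ∈ found S fs T D ↔ ∃ i < 2 ^ k, Accepts (S.poly - fs) pr D (numA T D + numB T D - 1)
      (numB T D) (u.coeff i) (u'.coeff i) d := by
  classical
  have hcert : ∀ c : F, c ≠ 0 → (Certified S fs T D (c, d) ↔ numB T D ≤
      Nat.count (fun j => (cyc (pr j) (S.poly - fs)).coeff (d % pr j) = c)
        (numA T D + numB T D - 1)) := by
    intro c hc
    rw [certified_iff_card hc, Nat.count_eq_card_filter_range]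
  rw [mem_found]
  constructor
  · rintro ⟨c, hc, hcertd⟩
    obtain ⟨e, -, he, hd, hq, hce⟩ := mem_candidates.1 hc
    rw [image_eq, ← hu] at he hq hce
    rw [← hu'] at hq
    dsimp only at hd hq hce
    subst hce
    refine ⟨e, ?_, he, hd, hq, ?_⟩
    · by_contra h
      exact he (hk e (not_lt.1 h))
    · convert (hcert _ he).1 hcertd
  · rintro ⟨e, -, he, hd, hq, hcount⟩
    refine ⟨u.coeff e, mem_candidates.2 ⟨e, ?_, ?_, hd, ?_, ?_⟩, (hcert _ he).2 ?_⟩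
    · by_contra h
      refine he (coeff_eq_zero_of_degree_lt (lt_of_lt_of_le ?_ (Nat.cast_le.2 (not_lt.1 h))))
      rw [hu]
      exact degree_cyc_lt (pr_pos _) _
    · rwa [image_eq, ← hu]
    · rwa [image_eq, ← hu, ← hu']
    · rw [image_eq, ← hu]
    · convert hcount

/-- An accepted exponent has the coefficient for which it was accepted. -/
theorem accepts_coeff_eq {S : SLP F} {fs : F[X]} {T D d i : ℕ} {u u' : F[X]} (hT : 1 ≤ T)
    (hr : ∀ e ∈ (S.poly - fs).support, e < D) (hcard : numTerms (S.poly - fs) ≤ T)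
    (hu : u = cyc (pr (bestIndex S fs T D)) (S.poly - fs))
    (hu' : u' = cyc (pr (bestIndex S fs T D)) (X * derivative (S.poly - fs)))
    (h : Accepts (S.poly - fs) pr D (numA T D + numB T D - 1)
      (numB T D) (u.coeff i) (u'.coeff i) d) : (S.poly - fs).coeff d = u.coeff i := by
  classical
  obtain ⟨he, hd, hq, hcount⟩ := h
  have hc : (u.coeff i, d) ∈ candidates S fs T D := by
    refine mem_candidates.2 ⟨i, ?_, ?_, hd, ?_, ?_⟩
    · by_contra h
      refine he (coeff_eq_zero_of_degree_lt (lt_of_lt_of_le ?_ (Nat.cast_le.2 (not_lt.1 h))))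
      rw [hu]
      exact degree_cyc_lt (pr_pos _) _
    · rwa [image_eq, ← hu]
    · rwa [image_eq, ← hu, ← hu']
    · rw [image_eq, ← hu]
  refine (certified_iff hT hr hcard hc).1 ?_
  rw [certified_iff_card he, ← Nat.count_eq_card_filter_range]
  convert hcount

/-- The price of one pass of the loop. -/
def passCost (w s B N n T : ℕ) : ℕ :=
  (2 * (3 * w + 20) * (4 * B) + 2 * w + 40) * N + (320 * B + T * candCost w s n T) +
    (60 * accCost w s * (T + 1) + 30) * (N + 1) + ((4 * s + 60) * (T + 1) + 30) * (T + 1) +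
    30 * (T + 1) + 2 * opCost w + 400

theorem size_half {n : ℕ} (hn : 0 < n) : (n / 2).size + 1 ≤ n.size := by
  have h1 : 0 < n.size := Nat.size_pos.2 hn
  have h2 : (n / 2).size ≤ n.size - 1 := by
    rw [Nat.size_le]
    have h3 := Nat.lt_size_self n
    have h4 : 2 ^ n.size = 2 * 2 ^ (n.size - 1) := by
      rw [← pow_succ', Nat.sub_add_cancel h1]
    omega
  omega

/-- The value of the list of all passes. -/
def passesVal (l : List (ℕ × F[X])) : Val F :=
  Val.list (l.map fun r => .pair (.nat r.1) (sparseVal r.2))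

/-- The invariant of the loop: the list holds the exponents found so far in increasing order, and
the table holds the images of what is missing. The number of passes is the binary length of `T₁`.
-/
theorem loop_spec (S : SLP F) {w D B T : ℕ} (hw : 2 ≤ w) (hD : S.poly.natDegree < D)
    (hDF : D ≤ ringChar F) (hcard : numTerms S.poly ≤ T) (hT : 1 ≤ T)
    (hB : ∀ i < numPrimes T D, pr i ≤ B) (hBw : 4 * B < 2 ^ w)
    (hn : numA T D + numB T D - 1 < 2 ^ w) (hm : numB T D < 2 ^ w) (hTw : T < 2 ^ w) (T₁ : ℕ) :
    T₁ ≤ T → ∀ (l : List ℕ) (es : List (Val F)), l.Pairwise (· < ·) →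
    (∀ x ∈ l, x ∈ S.poly.support) → es.length = numPrimes T D →
    IsTable w D pr (S.poly - part S.poly l.toFinset) es →
    (S.poly.support \ l.toFinset).card ≤ T₁ →
    Cl prog 36 (.pair (.pair (.nat D) (.pair (.nat (numA T D + numB T D - 1)) (.nat (numB T D))))
        (.pair (.nat T₁) (.pair (Val.list es) (Val.list (l.map (item S.poly)))))) fun v b =>
      v = .pair (Val.list ((S.poly.support.sort (· ≤ ·)).map (item S.poly)))
        (passesVal (duiLoop S T D T₁ (part S.poly l.toFinset)).2) ∧
      b ≤ passCost w D.size B (numPrimes T D) (numA T D + numB T D - 1) T * (T₁.size + 1) := by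
  classical
  have s0 := Nat.size_zero
  have s1 := Nat.size_one
  have s2 := size_two
  have hpc : 2 * opCost w + 400 ≤
      passCost w D.size B (numPrimes T D) (numA T D + numB T D - 1) T := by
    unfold passCost; omega
  induction T₁ using Nat.strong_induction_on with
  | _ T₁ ih =>
  intro hT₁ l es hl hls hes ht hleft
  have hTs : T₁.size ≤ w := Nat.size_le.2 (by omega)
  obtain ⟨H, hH⟩ : ∃ H, H = l.toFinset := ⟨_, rfl⟩
  have hlH : ∀ x, x ∈ l ↔ x ∈ H := fun x => by rw [hH, List.mem_toFinset]
  have hHs : H ⊆ S.poly.support := fun x hx => hls x ((hlH x).2 hx)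
  rw [← hH] at ht hleft ⊢
  refine Cl.intro rfl ?_
  dsimp only [loopE, Sym, onSome, Val.onPair, Val.onNat,
      Val.split, List.getElem?_cons_zero, List.getElem?_cons_succ]
  refine ⟨fun h0 => ?_, fun h0 => ?_⟩
  · obtain rfl : T₁ = 0 := by omega
    have hHeq : H = S.poly.support := by
      rw [Nat.le_zero, Finset.card_eq_zero, Finset.sdiff_eq_empty_iff_subset] at hleft
      exact Finset.Subset.antisymm hHs hleft
    refine ⟨?_, ?_⟩
    · rw [duiLoop, dif_pos rfl, ← hHeq, sort_eq_of_pairwise hl hlH]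
      rfl
    · rw [Nat.size_zero, zero_add, mul_one]
      omega
  · obtain ⟨hsub, hDUI, hadd, hhalf⟩ := DUIHalf_part hT hD hcard (H := H) T₁
    obtain ⟨A, hA⟩ : ∃ A, A = found S (part S.poly H) T D := ⟨_, rfl⟩
    rw [← hA] at hsub hDUI hadd hhalf
    have hr : ∀ e ∈ (S.poly - part S.poly H).support, e < D := by
      intro e he
      rw [support_sub_part] at he
      exact lt_of_le_of_lt (le_natDegree_of_mem_supp e (Finset.sdiff_subset he)) hD
    have hrc : numTerms (S.poly - part S.poly H) ≤ T := by
      rw [numTerms, support_sub_part]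
      exact (Finset.card_le_card Finset.sdiff_subset).trans hcard
    have hq : ∀ i < es.length, 0 < pr i ∧ pr i < 2 ^ w := fun i hi =>
      ⟨pr_pos i, by have := hB i (hes ▸ hi); omega⟩
    have hNpos : 0 < numPrimes T D := (Nat.zero_le _).trans_lt (bestIndex_spec S 0 T D).1
    refine (best_spec hBw es (by rintro rfl; rw [← hes] at hNpos; simp at hNpos) pr
      (fun i hi => hB i (hes ▸ hi)) ht).mono ?_
    rintro _ d₁ ⟨⟨i, hi, rfl, hmax, hfirst⟩, hd₁⟩
    have hbest : bestIndex S (part S.poly H) T D = i := by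
      have hα : numTerms (cyc (pr i) (S.poly - part S.poly H)) =
          maxTerms S (part S.poly H) T D := by
        refine le_antisymm ?_ (Finset.sup_le fun j hj => ?_)
        · rw [← image_eq]
          exact Finset.le_sup (f := fun j => numTerms (image S (part S.poly H) j))
            (Finset.mem_range.2 (hes ▸ hi))
        · rw [image_eq]
          exact hmax j (hes ▸ Finset.mem_range.1 hj)
      refine le_antisymm (Nat.sInf_le ⟨hes ▸ hi, by rw [image_eq]; exact hα⟩) ?_
      by_contra hlt
      have h1 := hfirst _ (not_le.1 hlt)
      rw [← image_eq, (bestIndex_spec S (part S.poly H) T D).2, hα] at h1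
      exact lt_irrefl _ h1
    obtain ⟨k, v, hev, ⟨u, u', rfl, hu, hu', hup, hup'⟩, hk, hkp, hmod⟩ := ht i hi
    rw [hev]
    dsimp only [Val.onPair]
    rw [← hbest] at hup hup'
    have hfound : ∀ d, d ∈ A ↔ ∃ i < 2 ^ k, Accepts (S.poly - part S.poly H) pr D
        (numA T D + numB T D - 1) (numB T D) ((tpoly u).coeff i) ((tpoly u').coeff i) d := by
      intro d
      rw [hA]
      exact mem_found_iff hup hup' (tpoly_coeff_eq_zero hu)
    have hnN : numA T D + numB T D - 1 ≤ es.length := hes ▸ le_max_right _ _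
    refine (collect_spec (R := S.poly.support \ H) (T := T) (f := S.poly) hw hDF hq ht hn hm hnN
      (fun x hx => hr x (by rwa [support_sub_part]))
      ((Finset.card_le_card Finset.sdiff_subset).trans hcard) k u u' [] hu hu' ?_
      (fun x hx => absurd hx (List.not_mem_nil)) List.Pairwise.nil).mono ?_
    · intro j hj d hacc
      have hdA : d ∈ A := (hfound d).2 ⟨j, hj, hacc⟩
      refine ⟨hsub hdA, ?_⟩
      rw [← accepts_coeff_eq hT hr hrc hup hup' hacc, coeff_sub, coeff_part,
        if_neg (Finset.mem_sdiff.1 (hsub hdA)).2, sub_zero]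
    rintro _ d₂ ⟨⟨l', rfl, hl', hl'R, hmem⟩, hd₂⟩
    have hlA : ∀ x, x ∈ l' ↔ x ∈ A := by
      intro x
      rw [hmem, hfound]
      simp
    have hpartA : (l'.map fun d => monomial d (S.poly.coeff d)).sum = part S.poly A := by
      have : A = l'.toFinset := by ext x; rw [List.mem_toFinset, hlA]
      rw [part, this, List.sum_toFinset _ (hl'.imp fun h => h.ne)]
    refine (subEntries_spec hw S.poly l' (fun x hx => hr x (by
      rw [support_sub_part]; exact hl'R x hx)) es pr hq ht).mono ?_
    rintro _ d₃ ⟨⟨es', rfl, hes', ht'⟩, hd₃⟩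
    refine (merge_spec (s := D.size) (T := T) S.poly (R := S.poly.support) (fun x hx =>
      Nat.size_le_size (lt_of_le_of_lt (le_natDegree_of_mem_supp x hx) hD).le) hcard l' l
      (fun x hx => Finset.sdiff_subset (hl'R x hx)) hls hl).mono ?_
    rintro _ d₄ ⟨⟨l'', rfl, hl'', hmem''⟩, hd₄⟩
    have hl''HA : l''.toFinset = H ∪ A := by
      ext x
      rw [List.mem_toFinset, hmem'', hlA, hlH, Finset.mem_union, or_comm]
    have hs'' : ∀ x ∈ l'', x ∈ S.poly.support := by
      intro x hx
      rcases (hmem'' x).1 hx with h | h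
      · exact Finset.sdiff_subset (hl'R x h)
      · exact hls x h
    rw [hpartA, sub_sub] at ht'
    have hrec := ih (T₁ / 2) (by omega) (by omega) l'' es' hl'' hs'' (hes'.trans hes)
      (by rw [hl''HA, ← hadd, hDUI]; exact ht')
      (by rw [hl''HA]; exact (Nat.le_div_iff_mul_le (by norm_num)).2 (by omega))
    refine hrec.mono ?_
    rintro _ d₅ ⟨rfl, hd₅⟩
    dsimp only [Val.onPair]
    refine (strip_spec S.poly l').mono ?_
    rintro _ d₆ ⟨rfl, hd₆⟩
    refine ⟨?_, ?_⟩
    · conv_rhs => rw [duiLoop, dif_neg (show ¬ T₁ = 0 by omega)]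
      dsimp only
      rw [hadd, ← hl''HA, hbest, hDUI, passesVal, passesVal, List.map_cons, Val.list,
        sparseVal_part hl' hlA (hsub.trans Finset.sdiff_subset)]
    · have hsz := size_half (Nat.pos_of_ne_zero (by omega : T₁ ≠ 0))
      have hlen' : l'.length ≤ T := (length_le_card hl' fun x hx =>
        Finset.sdiff_subset (hl'R x hx)).trans hcard
      have b1 : NatOp.cost .div T₁ 2 ≤ opCost w := cost_le_opCost _ hTs (by omega)
      have b2 : numTerms (tpoly u) * candCost w D.size (numA T D + numB T D - 1) T ≤
          T * candCost w D.size (numA T D + numB T D - 1) T := by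
        refine Nat.mul_le_mul_right _ ?_
        rw [hup]
        exact ((Finset.card_le_card (support_cyc_subset (pr_pos _) _)).trans
          Finset.card_image_le).trans hrc
      have b3 : (60 * accCost w D.size * (l'.length + 1) + 30) * (es.length + 1) ≤
          (60 * accCost w D.size * (T + 1) + 30) * (numPrimes T D + 1) := by
        rw [hes]; gcongr
      have b4 : ((4 * D.size + 60) * (T + 1) + 30) * (l'.length + 1) ≤
          ((4 * D.size + 60) * (T + 1) + 30) * (T + 1) := by gcongr
      have b5 := hB i (hes ▸ hi)
      have b6 : passCost w D.size B (numPrimes T D) (numA T D + numB T D - 1) T *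
          ((T₁ / 2).size + 1) + passCost w D.size B (numPrimes T D) (numA T D + numB T D - 1) T ≤
          passCost w D.size B (numPrimes T D) (numA T D + numB T D - 1) T * (T₁.size + 1) := by
        rw [← mul_add_one]
        gcongr
      have hK := le_opCost w
      rw [hes] at hd₁
      refine le_trans ?_ b6
      generalize passCost w D.size B (numPrimes T D) (numA T D + numB T D - 1) T *
          ((T₁ / 2).size + 1) = X₁ at *
      unfold passCost
      omega

end

/-! ### The total cost -/

theorem clog_le_size (v : ℕ) : Nat.clog 2 v ≤ v.size :=
  (Nat.clog_le_iff_le_pow (by norm_num)).2 (Nat.lt_size_self v).le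

theorem size_pow_le_of_le {T D m : ℕ} (h : m ≤ T) : (D ^ m).size ≤ T * D.size + 1 :=
  (size_pow_le D m).trans (by gcongr)

theorem numA_le {T D : ℕ} (hT : 1 ≤ T) : numA T D ≤ T * D.size + 1 := by
  rw [numA_eq hT]
  exact max_le (by omega) ((clog_le_size _).trans (size_pow_le_of_le (by omega)))

theorem numB_le (T D : ℕ) : numB T D ≤ T * D.size + 1 := by
  rw [numB_eq]
  exact (clog_le_size _).trans (size_pow_le_of_le le_rfl)

theorem numPrimes_le {T D : ℕ} (hT : 1 ≤ T) : numPrimes T D ≤ 4 * (T * D.size + 1) := by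
  have h1 := numA_le (D := D) hT
  have h2 := numB_le T D
  exact max_le (by omega) (by omega)

section
variable {F : Type u} [Field F]

/-- The bounds that hold throughout the run: `B` is at least as large as all primes in use, and
`2 ^ w` exceeds `4 * B` and is at least the number of instructions. -/
structure RunBounds (S : SLP F) (w D B T : ℕ) : Prop where
  hw : 2 ≤ w
  hD : S.poly.natDegree < D
  hDF : D ≤ ringChar F
  hcard : numTerms S.poly ≤ T
  hT : 1 ≤ T
  hB : B = w * (4 * (T * D.size + 1) + 1)
  hBw : 4 * B + 4 < 2 ^ w
  hL : S.length ≤ 2 ^ w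

theorem RunBounds.le_bound {S : SLP F} {w D B T : ℕ} (h : RunBounds S w D B T) :
    8 * (T * D.size + 1) + 2 ≤ B := by
  calc 8 * (T * D.size + 1) + 2 = 2 * (4 * (T * D.size + 1) + 1) := by ring
    _ ≤ B := h.hB ▸ Nat.mul_le_mul_right _ h.hw

theorem RunBounds.size_le {S : SLP F} {w D B T : ℕ} (h : RunBounds S w D B T) {x : ℕ}
    (hx : x ≤ B) : x.size ≤ w := Nat.size_le.2 (by have := h.hBw; omega)

theorem RunBounds.one_le_size {S : SLP F} {w D B T : ℕ} (h : RunBounds S w D B T) :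
    1 ≤ D.size := Nat.size_pos.2 (by have := h.hD; omega)

/-- The price of the passes and of the preparation of the table. -/
def tableCost (w s B z L n T : ℕ) : ℕ :=
  20 * opCost w * (B + 2) * B + (2 * s + 200000 * (L * (B * (w + 2) ^ 4)) + 30) * (4 * z + 1) +
    passCost w s B (4 * z) n T * (w + 1) + 30 * (T + 1) + 100

/-- The postcondition is arbitrary, so that the bound can be used in the middle of the evaluation
of the enclosing expression. -/
theorem passes_spec {S : SLP F} {w D B T : ℕ} (h : RunBounds S w D B T) (a₁ a₂ a₃ : ℕ) :
    ∀ Q : Val F → ℕ → Prop,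
      (∀ b ≤ tableCost w D.size B (T * D.size + 1) S.length (numA T D + numB T D - 1) T,
        Q (outputVal (DUIPoly S T D) (DUIPasses S T D)) b) →
      Sym prog passesE [.nat (numPrimes T D), .nat a₁, .nat (numA T D + numB T D - 1),
        .nat (numB T D), .nat a₂, .nat a₃, inputVal S T D] Q := by
  intro Q hQ
  have hBz := h.le_bound
  have hA := numA_le (D := D) h.hT
  have hB' := numB_le T D
  have hN := numPrimes_le (D := D) h.hT
  have hTz : T ≤ T * D.size + 1 := by
    have := Nat.le_mul_of_pos_right T h.one_le_size; omega
  obtain ⟨hw, hD, hDF, hcard, hT, hB, hBw, hL⟩ := id h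
  obtain ⟨z, hz⟩ : ∃ z, z = T * D.size + 1 := ⟨_, rfl⟩
  rw [← hz] at hA hB' hN hB hBz hTz hQ
  have s0 := Nat.size_zero
  have s2 := size_two
  have hpr : ∀ i < numPrimes T D, pr i ≤ B := fun i hi =>
    (pr_le (by omega) (by rw [← hB]; omega) (lt_of_lt_of_le hi hN)).trans hB.ge
  have hn : numA T D + numB T D - 1 < 2 ^ w := by omega
  dsimp only [passesE, inputVal, Sym, onSome, Val.onPair, Val.onNat,
    Val.split, NatOp.apply, List.getElem?_cons_zero, List.getElem?_cons_succ]
  have hc2 : Nat.count Nat.Prime 2 = 0 := by decide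
  refine (primes_spec w (B + 1) hw (by omega) (B - 1) 2 (numPrimes T D) le_rfl (by omega)
    (h.size_le (by omega)) (fun i hi => ?_)).mono ?_
  · rw [hc2, zero_add] at hi
    exact Nat.lt_succ_of_le (hpr i hi)
  rintro _ d₅ ⟨rfl, hd₅⟩
  simp only [hc2, zero_add]
  refine (entries_spec S hD hDF (B := B) (by omega) hL (numPrimes T D) pr
    (fun i hi => ⟨(prime_pr i).two_le, hpr i hi⟩)).mono ?_
  rintro _ d₆ ⟨⟨es, rfl, hes, ht⟩, hd₆⟩
  have h0 : part S.poly (∅ : Finset ℕ) = 0 := Finset.sum_empty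
  refine (loop_spec S hw hD hDF hcard hT hpr (by omega) hn (by omega) (by omega) T le_rfl []
    es List.Pairwise.nil (fun x hx => absurd hx List.not_mem_nil) hes ?_ ?_).mono ?_
  · rw [List.toFinset_nil, h0, sub_zero]; exact ht
  · rw [List.toFinset_nil, Finset.sdiff_empty]; exact hcard
  rintro _ d₇ ⟨rfl, hd₇⟩
  dsimp only [Val.onPair]
  refine (strip_spec S.poly _).mono ?_
  rintro _ d₈ ⟨rfl, hd₈⟩
  rw [Finset.length_sort] at hd₈
  have hout : outputVal (DUIPoly S T D) (DUIPasses S T D) =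
      .pair (Val.list ((S.poly.support.sort (· ≤ ·)).map fun d =>
        .pair (.fld (S.poly.coeff d)) (.nat d)))
        (passesVal (duiLoop S T D T (part S.poly ([] : List ℕ).toFinset)).2) := by
    rw [List.toFinset_nil, h0, outputVal, DUIPoly_eq hD hcard]
    rfl
  rw [← hout]
  refine hQ _ ?_
  have hcard' : S.poly.support.card ≤ T := hcard
  have hTs : T.size ≤ w := h.size_le (by omega)
  have b4 : 20 * opCost w * (B + 1 + 1) * (B - 1 + 1) = 20 * opCost w * (B + 2) * B := by
    rw [show B - 1 + 1 = B by omega]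
  have b5 : (2 * D.size + 200000 * (S.length * (B * (w + 2) ^ 4)) + 30) *
      (numPrimes T D + 1) ≤ (2 * D.size + 200000 * (S.length * (B * (w + 2) ^ 4)) + 30) *
      (4 * z + 1) := by gcongr
  have b6 : passCost w D.size B (numPrimes T D) (numA T D + numB T D - 1) T * (T.size + 1) ≤
      passCost w D.size B (4 * z) (numA T D + numB T D - 1) T * (w + 1) := by
    have : passCost w D.size B (numPrimes T D) (numA T D + numB T D - 1) T ≤
        passCost w D.size B (4 * z) (numA T D + numB T D - 1) T := by
      unfold passCost; gcongr
    gcongr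
  unfold tableCost
  omega

theorem counts_spec {S : SLP F} {w D B T : ℕ} (h : RunBounds S w D B T) (a : ℕ) :
    ∀ Q : Val F → ℕ → Prop,
      (∀ b ≤ tableCost w D.size B (T * D.size + 1) S.length (numA T D + numB T D - 1) T +
          20 * ((D.size + 1) * (T * D.size + 2)) * (T + 1) +
          10 * (T * D.size + 1 + 5) * (T * D.size + 1 + 1) + 10 * opCost w + 100,
        Q (outputVal (DUIPoly S T D) (DUIPasses S T D)) b) →
      Sym prog countsE [.nat (numA T D), .nat a, inputVal S T D] Q := by
  intro Q hQ
  have hBz := h.le_bound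
  have hA := numA_le (D := D) h.hT
  have hB' := numB_le T D
  have s0 := Nat.size_zero
  have s1 := Nat.size_one
  have s4 := size_four
  have hw := h.hw
  have hK := le_opCost w
  dsimp only [countsE, Sym, inputVal, onSome, Val.onPair, Val.onNat,
    Val.split, NatOp.apply, List.getElem?_cons_zero, List.getElem?_cons_succ]
  refine (pow_spec D T h.one_le_size T le_rfl).mono ?_
  rintro _ d₃ ⟨rfl, hd₃⟩
  refine (clog_spec (T * D.size + 1) (D ^ T) (size_pow_le_of_le le_rfl)).mono ?_
  rintro _ d₄ ⟨rfl, hd₄⟩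
  rw [← numB_eq]
  dsimp only
  have c1 : NatOp.cost .add (numA T D) (numB T D) ≤ opCost w :=
    cost_le_opCost _ (h.size_le (by omega)) (h.size_le (by omega))
  have c2 : NatOp.cost .sub (numA T D + numB T D) 1 ≤ opCost w :=
    cost_le_opCost _ (h.size_le (by omega)) (by omega)
  have c3 : NatOp.cost .mul 4 (numA T D) ≤ opCost (w + 1) :=
    cost_le_opCost _ (by omega) ((h.size_le (by omega)).trans (Nat.le_succ w))
  have c4 : opCost (w + 1) ≤ 3 * opCost w := by unfold opCost; nlinarith
  have z1 : (4 * numA T D).size ≤ w := h.size_le (by omega)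
  have z2 : (numA T D + numB T D - 1).size ≤ w := h.size_le (by omega)
  have hNeq : numPrimes T D = max (4 * numA T D) (numA T D + numB T D - 1) := rfl
  have htail := passes_spec h (4 * numA T D) (numA T D) a
  refine ⟨fun hlt => ?_, fun hlt => ?_⟩
  · rw [max_eq_right hlt.le] at hNeq
    rw [hNeq] at htail
    exact htail _ fun b hb => hQ _ (by omega)
  · rw [max_eq_left (not_lt.1 hlt)] at hNeq
    rw [hNeq] at htail
    exact htail _ fun b hb => hQ _ (by omega)

/-- The price of DUIPoly. -/
def totalCost (w s B z L n T : ℕ) : ℕ :=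
  tableCost w s B z L n T + 40 * ((s + 1) * (T * s + 2)) * (T + 1) + 20 * (z + 5) * (z + 1) +
    20 * opCost w + 500

theorem main_spec {S : SLP F} {w D B T : ℕ} (h : RunBounds S w D B T) :
    Cl prog 0 (inputVal S T D) fun v b =>
      v = outputVal (DUIPoly S T D) (DUIPasses S T D) ∧
        b ≤ totalCost w D.size B (T * D.size + 1) S.length (numA T D + numB T D - 1) T := by
  have hBz := h.le_bound
  have hA := numA_le (D := D) h.hT
  have s0 := Nat.size_zero
  have s1 := Nat.size_one
  have hT := h.hT
  have hK := le_opCost w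
  have hTz : T ≤ T * D.size + 1 := by
    have := Nat.le_mul_of_pos_right T h.one_le_size; omega
  have hTs : T.size ≤ w := h.size_le (by omega)
  have c1 : NatOp.cost .sub T 1 ≤ opCost w := cost_le_opCost _ hTs (by have := h.hw; omega)
  refine Cl.intro rfl ?_
  dsimp only [mainE, inputVal, Sym, onSome, Val.onPair, Val.onNat,
      Val.split, NatOp.apply, List.getElem?_cons_zero, List.getElem?_cons_succ]
  refine ⟨fun h => absurd h (by omega), fun _ => ?_⟩
  refine (pow_spec D T h.one_le_size (T - 1) (by omega)).mono ?_
  rintro _ d₁ ⟨rfl, hd₁⟩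
  refine (clog_spec (T * D.size + 1) (D ^ (T - 1)) (size_pow_le_of_le (by omega))).mono ?_
  rintro _ d₂ ⟨rfl, hd₂⟩
  dsimp only
  have hAeq := numA_eq (D := D) hT
  obtain ⟨a, ha⟩ : ∃ a, a = Nat.clog 2 (D ^ (T - 1)) := ⟨_, rfl⟩
  rw [← ha] at hAeq ⊢
  have has : a.size ≤ w := h.size_le (by omega)
  have hrest := counts_spec h a
  have b1 : 20 * ((D.size + 1) * (T * D.size + 2)) * (T - 1 + 1) ≤
      20 * ((D.size + 1) * (T * D.size + 2)) * (T + 1) := by gcongr; omega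
  have b2 : 40 * ((D.size + 1) * (T * D.size + 2)) * (T + 1) =
    2 * (20 * ((D.size + 1) * (T * D.size + 2)) * (T + 1)) := by ring
  have b3 : 20 * (T * D.size + 1 + 5) * (T * D.size + 1 + 1) =
    2 * (10 * (T * D.size + 1 + 5) * (T * D.size + 1 + 1)) := by ring
  unfold totalCost
  refine ⟨fun hlt => ?_, fun hlt => ?_⟩
  · rw [max_eq_left (by omega)] at hAeq
    rw [hAeq] at hrest
    have hA1 : numA T D = 1 := hAeq
    refine hrest _ fun b hb => ⟨rfl, ?_⟩
    rw [hA1]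
    omega
  · rw [max_eq_right (by omega)] at hAeq
    have hA1 : a = numA T D := hAeq.symm
    subst hA1
    exact hrest _ fun b hb => ⟨rfl, by omega⟩

end

/-! ### Comparison with the bound of the theorem -/

theorem accCost_le (w s : ℕ) : accCost w s ≤ 2 * ((s + 1) * (w + 2) ^ 3) := by
  have h1 : (s + 1) * (w + 1) ≤ (s + 1) * (w + 2) ^ 3 := by
    gcongr
    exact (Nat.le_succ _).trans (Nat.le_self_pow (by norm_num) _)
  have h2 : opCost w * (w + 1) ≤ 1 * (w + 2) ^ 3 := by
    unfold opCost
    rw [one_mul, pow_succ (w + 2) 2]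
    gcongr
    omega
  have h3 : 1 * (w + 2) ^ 3 ≤ (s + 1) * (w + 2) ^ 3 := by gcongr; omega
  unfold accCost
  omega

theorem passCost_le {w s z n T B : ℕ} (hs : 1 ≤ s) (hT : 1 ≤ T) (hz : z = T * s + 1)
    (hn : n ≤ 2 * z) (hB : B ≤ 5 * ((w + 2) * z)) :
    passCost w s B (4 * z) n T ≤ 8000 * ((w + 2) ^ 3 * z ^ 2) := by
  obtain ⟨M, hM⟩ : ∃ M, M = w + 2 := ⟨_, rfl⟩
  have hM2 : 2 ≤ M := by omega
  have hTs : T ≤ T * s := Nat.le_mul_of_pos_right _ hs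
  have hsT : s ≤ T * s := Nat.le_mul_of_pos_left _ hT
  have hz2 : 2 ≤ z := by omega
  have hacc := accCost_le w s
  have ho : opCost w = M ^ 2 := by rw [hM]; rfl
  rw [← hM] at hacc hB ⊢
  have e1 : (T + 1) * (s + 1) ≤ 4 * z := by nlinarith
  have e2 : T * (s + 1) ≤ 2 * z := by nlinarith
  have e3 : (4 * s + 60) * (T + 1) ≤ 240 * z := by nlinarith
  have m1 : M ≤ M ^ 3 := Nat.le_self_pow (by norm_num) _
  have m2 : M ^ 2 ≤ M ^ 3 := Nat.pow_le_pow_right (by omega) (by norm_num)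
  have zz : z ≤ z ^ 2 := Nat.le_self_pow (by norm_num) _
  obtain ⟨G, hG⟩ : ∃ G, G = M ^ 3 * z ^ 2 := ⟨_, rfl⟩
  have g1 : z ^ 2 ≤ G := hG ▸ Nat.le_mul_of_pos_left _ (by positivity)
  have g2 : M ^ 3 ≤ G := hG ▸ Nat.le_mul_of_pos_right _ (by positivity)
  have g3 : M * z ≤ G := hG ▸ Nat.mul_le_mul m1 zz
  have g4 : M ^ 2 * z ^ 2 ≤ G := hG ▸ Nat.mul_le_mul_right _ m2
  have g5 : M ^ 3 * z ≤ G := hG ▸ Nat.mul_le_mul_left _ zz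
  have t1 : (2 * (3 * w + 20) * (4 * B) + 2 * w + 40) * (4 * z) ≤ 1700 * G := by
    have h1 : 3 * w + 20 ≤ 10 * M := by omega
    have h2 : 2 * (3 * w + 20) * (4 * B) ≤ 2 * (10 * M) * (4 * (5 * (M * z))) := by gcongr
    calc _ ≤ (2 * (10 * M) * (4 * (5 * (M * z))) + 20 * M) * (4 * z) :=
          Nat.mul_le_mul_right _ (by omega)
      _ = 1600 * (M ^ 2 * z ^ 2) + 80 * (M * z) := by ring
      _ ≤ _ := by omega
  have t2 : T * candCost w s n T ≤ 720 * G := by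
    have hn1 : n + 1 ≤ 3 * z := by omega
    calc T * candCost w s n T ≤
          T * (40 * (2 * ((s + 1) * M ^ 3)) * (3 * z) + (4 * s + 60) * (T + 1)) := by
          unfold candCost; gcongr
      _ = 240 * (T * (s + 1)) * (M ^ 3 * z) + T * ((4 * s + 60) * (T + 1)) := by ring
      _ ≤ 240 * (2 * z) * (M ^ 3 * z) + z * (240 * z) := by gcongr; omega
      _ = 480 * (M ^ 3 * z ^ 2) + 240 * z ^ 2 := by ring
      _ ≤ _ := by omega
  have t3 : (60 * accCost w s * (T + 1) + 30) * (4 * z + 1) ≤ 2550 * G := by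
    calc _ ≤ (60 * (2 * ((s + 1) * M ^ 3)) * (T + 1) + 30) * (5 * z) := by gcongr; omega
      _ = 600 * ((T + 1) * (s + 1)) * (M ^ 3 * z) + 150 * z := by ring
      _ ≤ 600 * (4 * z) * (M ^ 3 * z) + 150 * z := by gcongr
      _ = 2400 * (M ^ 3 * z ^ 2) + 150 * z := by ring
      _ ≤ _ := by omega
  have t4 : ((4 * s + 60) * (T + 1) + 30) * (T + 1) ≤ 540 * G := by
    calc _ ≤ (240 * z + 30) * (2 * z) := by gcongr; omega
      _ = 480 * z ^ 2 + 60 * z := by ring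
      _ ≤ _ := by omega
  unfold passCost
  rw [ho]
  omega

/-- With `z = T s + 1`, where `s` is the binary length of `D`, the cost is `L z²` up to powers of
`w`. -/
theorem totalCost_le {w s z n T B L : ℕ} (hs : 1 ≤ s) (hT : 1 ≤ T) (hL : 1 ≤ L)
    (hz : z = T * s + 1) (hn : n ≤ 2 * z) (hB : B = w * (4 * z + 1)) :
    totalCost w s B z L n T ≤ 10000000 * (L * (w + 2) ^ 5 * z ^ 2) := by
  have hTs : T ≤ T * s := Nat.le_mul_of_pos_right _ hs
  have hsT : s ≤ T * s := Nat.le_mul_of_pos_left _ hT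
  have hz2 : 2 ≤ z := by omega
  have hB' : B ≤ 5 * ((w + 2) * z) := by
    calc B ≤ (w + 2) * (5 * z) := by rw [hB]; gcongr <;> omega
      _ = _ := by ring
  have hpass := passCost_le hs hT hz hn hB'
  obtain ⟨M, hM⟩ : ∃ M, M = w + 2 := ⟨_, rfl⟩
  have ho : opCost w = M ^ 2 := by rw [hM]; rfl
  rw [← hM] at hB' hpass ⊢
  obtain ⟨G, hG⟩ : ∃ G, G = L * M ^ 5 * z ^ 2 := ⟨_, rfl⟩
  have hM2 : 2 ≤ M := by omega
  have zz : z ≤ z ^ 2 := Nat.le_self_pow (by norm_num) _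
  have g0 : M ^ 5 * z ^ 2 ≤ G := by
    rw [hG, mul_assoc]; exact Nat.le_mul_of_pos_left _ hL
  have g1 : z ^ 2 ≤ G := (Nat.le_mul_of_pos_left _ (by positivity)).trans g0
  have g2 : M ^ 2 ≤ G := ((Nat.pow_le_pow_right (by omega) (by norm_num)).trans
    (Nat.le_mul_of_pos_right _ (by positivity))).trans g0
  have g4 : M ^ 4 * z ^ 2 ≤ G :=
    (Nat.mul_le_mul_right _ (Nat.pow_le_pow_right (by omega) (by norm_num))).trans g0
  have t1 : 40 * ((s + 1) * (T * s + 2)) * (T + 1) ≤ 320 * G := by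
    have e1 : (T + 1) * (s + 1) ≤ 4 * z := by nlinarith
    calc _ = 40 * ((T + 1) * (s + 1)) * (z + 1) := by rw [hz]; ring
      _ ≤ 40 * (4 * z) * (2 * z) := by gcongr; omega
      _ = 320 * z ^ 2 := by ring
      _ ≤ _ := by omega
  have t2 : 20 * (z + 5) * (z + 1) ≤ 160 * G := by
    calc _ ≤ 20 * (4 * z) * (2 * z) := by gcongr <;> omega
      _ = 160 * z ^ 2 := by ring
      _ ≤ _ := by omega
  have hMz : 4 ≤ M * z := Nat.mul_le_mul hM2 hz2
  have t3 : 20 * M ^ 2 * (B + 2) * B ≤ 700 * G := by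
    calc _ ≤ 20 * M ^ 2 * (7 * (M * z)) * (5 * (M * z)) := by gcongr; omega
      _ = 700 * (M ^ 4 * z ^ 2) := by ring
      _ ≤ _ := by omega
  have t4 : (2 * s + 200000 * (L * (B * M ^ 4)) + 30) * (4 * z + 1) ≤ 5000200 * G := by
    calc _ ≤ (2 * z + 200000 * (L * (5 * (M * z) * M ^ 4)) + 30) * (5 * z) := by
          gcongr <;> omega
      _ = 10 * z ^ 2 + 5000000 * (L * M ^ 5 * z ^ 2) + 150 * z := by ring
      _ ≤ _ := by omega
  have t5 : passCost w s B (4 * z) n T * (w + 1) ≤ 8000 * G := by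
    calc _ ≤ 8000 * (M ^ 3 * z ^ 2) * M := by gcongr; omega
      _ = 8000 * (M ^ 4 * z ^ 2) := by ring
      _ ≤ _ := by omega
  unfold totalCost tableCost
  rw [ho, ← hM]
  omega

/-- The parameter `w`: its exponential exceeds all numbers that are stored in the trees. -/
theorem bound_lt_two_pow {L z : ℕ} (hL : 1 ≤ L) (hz : 1 ≤ z) :
    4 * ((2 * (L * z).size + 10) * (4 * z + 1)) + 4 < 2 ^ (2 * (L * z).size + 10) ∧
      L ≤ 2 ^ (2 * (L * z).size + 10) := by
  obtain ⟨t, ht⟩ : ∃ t, t = (L * z).size := ⟨_, rfl⟩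
  rw [← ht]
  have h1 : L * z < 2 ^ t := ht ▸ Nat.lt_size_self _
  have h2 : z ≤ L * z := Nat.le_mul_of_pos_left _ hL
  have h3 : L ≤ L * z := Nat.le_mul_of_pos_right _ hz
  have h4 : t < 2 ^ t := Nat.lt_two_pow_self
  have h5 : 2 ^ (2 * t + 10) = 1024 * (2 ^ t * 2 ^ t) := by rw [pow_add, two_mul, pow_add]; ring
  have h6 : 1 ≤ 2 ^ t := Nat.one_le_two_pow
  rw [h5]
  constructor
  · calc _ ≤ 4 * ((12 * 2 ^ t) * (5 * 2 ^ t)) + 4 * (2 ^ t * 2 ^ t) := by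
          have : 4 ≤ 4 * (2 ^ t * 2 ^ t) := Nat.le_mul_of_pos_right _ (by positivity)
          gcongr <;> omega
      _ = 244 * (2 ^ t * 2 ^ t) := by ring
      _ < _ := Nat.mul_lt_mul_of_pos_right (by norm_num) (by positivity)
  · calc L ≤ 2 ^ t * 1 := by omega
      _ ≤ 1024 * (2 ^ t * 2 ^ t) := by nlinarith

theorem size_le_logb {n : ℕ} (hn : 1 ≤ n) : (n.size : ℝ) ≤ Real.logb 2 n + 1 := by
  have h0 : 1 ≤ n.size := Nat.size_pos.2 hn
  have h1 : 2 ^ (n.size - 1) ≤ n := by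
    by_contra h
    have := Nat.size_le.2 (not_le.1 h)
    omega
  have h2 : ((n.size - 1 : ℕ) : ℝ) ≤ Real.logb 2 n := by
    rw [Real.le_logb_iff_rpow_le (by norm_num) (by exact_mod_cast hn), Real.rpow_natCast]
    exact_mod_cast h1
  have h3 : (n.size : ℝ) = ((n.size - 1 : ℕ) : ℝ) + 1 := by
    rw [Nat.cast_sub h0]; push_cast; ring
  linarith

theorem one_le_sizeBound {L T D : ℕ} (hL : 1 ≤ L) : 1 ≤ sizeBound L T D := by
  have h1 : (1 : ℝ) ≤ L := by exact_mod_cast hL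
  have h2 : (1 : ℝ) ≤ (max 1 (T : ℝ)) ^ 2 := one_le_pow₀ (le_max_left _ _)
  have h3 : (1 : ℝ) ≤ (max 1 (Real.logb 2 D)) ^ 2 := one_le_pow₀ (le_max_left _ _)
  unfold sizeBound
  exact one_le_mul_of_one_le_of_one_le (one_le_mul_of_one_le_of_one_le h1 h2) h3

theorem one_le_logb_one_add {x : ℝ} (h : 1 ≤ x) : 1 ≤ Real.logb 2 (1 + x) := by
  rw [Real.le_logb_iff_rpow_le (by norm_num) (by linarith), Real.rpow_one]
  linarith

/-- The numbers `L z²` and `φ` agree up to a constant factor, and `w` is at most a multiple of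
`log₂ (1 + φ)`. -/
theorem cost_le_sizeBound {L T D b : ℕ} (hL : 1 ≤ L) (hT : 1 ≤ T) (hD : 1 ≤ D)
    (hb : b ≤ 10000000 * (L * (2 * (L * (T * D.size + 1)).size + 12) ^ 5 *
      (T * D.size + 1) ^ 2)) :
    (b : ℝ) ≤ (10000000 * 16 * 24 ^ 5 : ℕ) * sizeBound L T D *
      Real.logb 2 (1 + sizeBound L T D) ^ 5 := by
  obtain ⟨z, hz⟩ : ∃ z, z = T * D.size + 1 := ⟨_, rfl⟩
  obtain ⟨φ, hφ⟩ : ∃ φ, φ = sizeBound L T D := ⟨_, rfl⟩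
  have hφ1 : 1 ≤ φ := hφ ▸ one_le_sizeBound hL
  rw [← hz] at hb
  rw [← hφ]
  have hLr : (1 : ℝ) ≤ L := by exact_mod_cast hL
  have hTr : (1 : ℝ) ≤ T := by exact_mod_cast hT
  have hzr : (1 : ℝ) ≤ z := by rw [hz]; push_cast; nlinarith [Nat.cast_nonneg (α := ℝ) D.size]
  obtain ⟨l, hl⟩ : ∃ l, l = max 1 (Real.logb 2 D) := ⟨_, rfl⟩
  have hl1 : 1 ≤ l := hl ▸ le_max_left _ _
  have hφ' : φ = L * (T : ℝ) ^ 2 * l ^ 2 := by rw [hφ, sizeBound, max_eq_right hTr, hl]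
  have hsz : (D.size : ℝ) ≤ 2 * l := by
    have := size_le_logb hD
    have : Real.logb 2 D ≤ l := hl ▸ le_max_right _ _
    linarith
  have hz4 : (z : ℝ) ≤ 4 * (T * l) := by
    rw [hz]
    push_cast
    nlinarith [mul_le_mul_of_nonneg_left hsz (by linarith : (0 : ℝ) ≤ T),
      mul_le_mul hTr hl1 (by norm_num) (by linarith)]
  have hz2 : (L : ℝ) * (z : ℝ) ^ 2 ≤ 16 * φ := by
    have : (z : ℝ) ^ 2 ≤ (4 * (T * l)) ^ 2 := by gcongr
    rw [hφ']
    nlinarith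
  have hLz : (L : ℝ) * z ≤ 16 * φ := by
    refine le_trans ?_ hz2
    gcongr
    nlinarith
  have hΛ := one_le_logb_one_add hφ1
  obtain ⟨Λ, hΛdef⟩ : ∃ Λ, Λ = Real.logb 2 (1 + φ) := ⟨_, rfl⟩
  rw [← hΛdef] at hΛ ⊢
  have hw : (2 * ((L * z).size : ℝ) + 12) ≤ 24 * Λ := by
    have h1 := size_le_logb (n := L * z) (Nat.mul_pos hL (by omega))
    have h2 : Real.logb 2 ((L * z : ℕ) : ℝ) ≤ Real.logb 2 (2 ^ 4 * (1 + φ)) := by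
      refine Real.logb_le_logb_of_le (by norm_num) ?_ ?_
      · push_cast; nlinarith
      · push_cast; linarith
    rw [Real.logb_mul (by norm_num) (by linarith), ← hΛdef, ← Real.rpow_natCast,
      Real.logb_rpow (by norm_num) (by norm_num)] at h2
    push_cast at h1 h2
    linarith
  have hb' : (b : ℝ) ≤ 10000000 * (L * (2 * ((L * z).size : ℝ) + 12) ^ 5 * (z : ℝ) ^ 2) := by
    exact_mod_cast hb
  calc (b : ℝ) ≤ 10000000 * (L * (2 * ((L * z).size : ℝ) + 12) ^ 5 * (z : ℝ) ^ 2) := hb'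
    _ = 10000000 * ((2 * ((L * z).size : ℝ) + 12) ^ 5 * (L * (z : ℝ) ^ 2)) := by ring
    _ ≤ 10000000 * ((24 * Λ) ^ 5 * (16 * φ)) := by gcongr
    _ = _ := by push_cast; ring

/-- The program computes the output of DUIPoly within the bound. For `T = 0` it stops at once. -/
theorem run_within_bound {F : Type u} [Field F] {S : SLP F} {T D : ℕ}
    (hD : S.poly.natDegree < D) (hDF : D ≤ ringChar F) (hcard : S.poly.support.card ≤ T) :
    Cl prog 0 (inputVal S T D) fun v b =>
      v = outputVal (DUIPoly S T D) (DUIPasses S T D) ∧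
        (b : ℝ) ≤ (10000000 * 16 * 24 ^ 5 : ℕ) * sizeBound S.length T D *
          (Real.logb 2 (1 + sizeBound S.length T D)) ^ 5 := by
  have hL : 1 ≤ S.length := List.length_pos_iff.2 S.ne_nil
  rcases Nat.eq_zero_or_pos T with rfl | hT
  · have hf : S.poly = 0 := by
      rwa [Nat.le_zero, Finset.card_eq_zero, Polynomial.support_eq_empty] at hcard
    have hout : outputVal (DUIPoly S 0 D) (DUIPasses S 0 D) = .pair (.nat 0) (.nat 0) := by
      rw [DUIPoly_eq hD hcard, DUIPasses, duiLoop, dif_pos rfl, hf, outputVal, sparseVal,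
        Polynomial.support_zero, Finset.sort_empty]
      rfl
    have s0 := Nat.size_zero
    have s1 := Nat.size_one
    refine Cl.intro rfl ?_
    dsimp only [mainE, inputVal, Sym, onSome, Val.onPair, Val.onNat,
      Val.split, List.getElem?_cons_zero, List.getElem?_cons_succ]
    refine ⟨fun _ => ⟨hout.symm, ?_⟩, fun h => absurd h (by omega)⟩
    have h1 : (1 : ℝ) ≤ sizeBound S.length 0 D := one_le_sizeBound hL
    have h2 := one_le_pow₀ (n := 5) (one_le_logb_one_add h1)
    have h3 := one_le_mul_of_one_le_of_one_le h1 h2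
    have h4 : ((10000000 * 16 * 24 ^ 5 : ℕ) : ℝ) * 1 ≤
        (10000000 * 16 * 24 ^ 5 : ℕ) * (sizeBound S.length 0 D *
          (Real.logb 2 (1 + sizeBound S.length 0 D)) ^ 5) := by gcongr
    rw [mul_assoc]
    refine le_trans ?_ h4
    rw [s0, s1]
    norm_num
  · obtain ⟨z, hz⟩ : ∃ z, z = T * D.size + 1 := ⟨_, rfl⟩
    obtain ⟨h1, h2⟩ := bound_lt_two_pow hL (show 1 ≤ T * D.size + 1 by omega)
    -- At most `4 z` primes are used, which gives the bound `B = w (4 z + 1)` on them; twice the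
    -- binary length of `L z` makes `2 ^ w` exceed a multiple of `(L z)²`, and so of `w z`.
    have hRB : RunBounds S (2 * (S.length * (T * D.size + 1)).size + 10) D
        ((2 * (S.length * (T * D.size + 1)).size + 10) * (4 * (T * D.size + 1) + 1)) T :=
      ⟨by omega, hD, hDF, hcard, hT, rfl, h1, h2⟩
    refine (main_spec hRB).mono ?_
    rintro v b ⟨rfl, hb⟩
    refine ⟨rfl, cost_le_sizeBound hL hT (by omega) (hb.trans ?_)⟩
    have h3 := numA_le (D := D) hT
    have h4 := numB_le T D
    exact totalCost_le hRB.one_le_size hT hL rfl (by omega) rfl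

end

end SparseInterp

theorem mainTheorem2 :
    ∃ (P : SparseInterp.Program) (C k : ℕ),
      ∀ (F : Type u) [Field F] [Finite F] (f : Polynomial F) (S : SparseInterp.SLP F) (T D : ℕ),
        S.poly = f →
        f.natDegree < D →
        D ≤ ringChar F →
        f.support.card ≤ T →
        SparseInterp.DUIPoly S T D = f ∧
        ∃ fieldOps bitOps : ℕ,
          SparseInterp.Program.Runs P (SparseInterp.inputVal S T D)
            (SparseInterp.outputVal (SparseInterp.DUIPoly S T D) (SparseInterp.DUIPasses S T D))
            fieldOps bitOps ∧
          (fieldOps : ℝ) ≤ C * SparseInterp.sizeBound S.length T D *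
            (Real.logb 2 (1 + SparseInterp.sizeBound S.length T D)) ^ k ∧
          (bitOps : ℝ) ≤ C * SparseInterp.sizeBound S.length T D *
            (Real.logb 2 (1 + SparseInterp.sizeBound S.length T D)) ^ k := by
  refine ⟨SparseInterp.prog, 10000000 * 16 * 24 ^ 5, 5, ?_⟩
  intro F _ _ f S T D hf hD hDF hcard
  subst hf
  refine ⟨SparseInterp.DUIPoly_eq hD hcard, ?_⟩
  obtain ⟨body, v, c, hbody, heval, rfl, hc⟩ :=
    SparseInterp.run_within_bound hD hDF hcard
  refine ⟨c.1, c.2, ⟨body, hbody, heval⟩, le_trans ?_ hc, hc⟩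
  exact_mod_cast heval.fst_le_snd
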